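/- For positive integers $\alpha_1,\dots,\alpha_r$ with $\alpha_r\ge 2$ put $$\zeta(\alpha_1,\dots,\alpha_r)=\sum_{1\le k_1<k_2<\cdots<k_r}k_1^{-\alpha_1}\cdots k_r^{-\alpha_r},\qquad \zeta^\star(\alpha_1,\dots,\alpha_r)=\sum_{1\le k_1\le k_2\le\cdots\le k_r}k_1^{-\alpha_1}\cdots k_r^{-\alpha_r},$$ let $\{a\}^m$ denote $m$ repetitions of $a$, and let the values at the empty index be $1$. Then for every integer $n\ge 0$, \begin{eqnarray*} \zeta^\star(4,\{2\}^n) &=& -\binom{2n+4}{3}\zeta(2n+4)+2(2n+3)\left(1-\frac1{2^{2n+3}}\right)\zeta(2n+4)-\zeta(2n+4)\\ &&+\sum^n_{j=1}(-1)^{j+1}\sum_{c_{j0}+c_{j1}+\cdots+c_{jj}=2n+1-2j} \zeta(c_{j0}+3,c_{j1}+2,\ldots,c_{jj}+2)\,W(c_j)\\ &&+\sum_{p+q=2n}(-1)^q\binom{p+2}{2}\zeta(\{1\}^{p+2},q+2) -\sum_{a+b=n}\zeta(1,2a+3)\,\zeta^\star(\{2\}^b)\\ &&+\sum_{a+b=n}b\,\zeta(2a+2)\,\zeta^\star(\{2\}^{b+1})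 +\sum_{a+b+c=n-1}\zeta^\star(\{2\}^a,3,\{2\}^b)\,\zeta(2c+3), \end{eqnarray*} where all summation variables $p,q,a,b,c,c_{j0},\dots,c_{jj}$ are nonnegative integers (so the last sum is empty for $n=0$), $c_j=(c_{j0},\dots,c_{jj})$, and $$W(c_j)=\binom{c_{j0}+3}{3}(c_{j1}+1)\cdots(c_{jj}+1).$$ -/

import Mathlib

open scoped BigOperators

noncomputable section

/-- The term `k₁ ^ (-s₁) * ⋯ * k_r ^ (-s_r)` of the series of multiple zeta (star) values. -/
def mzvTerm (s : List ℕ) (k : Fin s.length → ℕ+) : ℝ :=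
  ∏ i, (((k i : ℕ) : ℝ) ^ s.get i)⁻¹

/-- The multiple zeta value `ζ(s₁, …, s_r)`: the sum over `1 ≤ k₁ < k₂ < ⋯ < k_r`.
The value at the empty index is `1`. -/
def mzv (s : List ℕ) : ℝ :=
  ∑' k : {k : Fin s.length → ℕ+ // StrictMono k}, mzvTerm s k.1

/-- The multiple zeta-star value `ζ⋆(s₁, …, s_r)`: the sum over `1 ≤ k₁ ≤ k₂ ≤ ⋯ ≤ k_r`.
The value at the empty index is `1`. -/
def mzvStar (s : List ℕ) : ℝ :=
  ∑' k : {k : Fin s.length → ℕ+ // Monotone k}, mzvTerm s k.1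

/-- The index `{a}^m`, that is `m` repetitions of `a`. -/
abbrev rep (a m : ℕ) : List ℕ := List.replicate m a

/-- The index `(c₀ + 3, c₁ + 2, …, c_j + 2)`. -/
def cIndex {j : ℕ} (c : Fin (j + 1) → ℕ) : List ℕ :=
  (c 0 + 3) :: List.ofFn (fun i : Fin j => c i.succ + 2)

/-- The weight `W(c₀, …, c_j) = binom(c₀ + 3, 3) (c₁ + 1) ⋯ (c_j + 1)`. -/
def cWeight {j : ℕ} (c : Fin (j + 1) → ℕ) : ℕ :=
  (c 0 + 3).choose 3 * ∏ i : Fin j, (c i.succ + 1)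

theorem summable_pi_prod {g : ℕ+ → ℝ} (h0 : ∀ x, 0 ≤ g x) (hg : Summable g) (r : ℕ) :
    Summable (fun k : Fin r → ℕ+ => ∏ i, g (k i)) := by
  induction r with
  | zero => exact Summable.of_finite
  | succ r ih =>
    have h := hg.mul_of_nonneg ih h0 (fun k => Finset.prod_nonneg fun i _ => h0 _)
    refine ((Fin.consEquiv (fun _ : Fin (r + 1) => ℕ+)).summable_iff).1 ?_
    refine h.congr fun x => ?_
    simp [Fin.prod_univ_succ, Fin.consEquiv]

/-- The series of `ζ⋆(s)` converges if all entries of `s` are positive and the last one is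
at least `2`. -/
theorem summable_mzvStar (s : List ℕ) (h1 : ∀ a ∈ s, 1 ≤ a)
    (h2 : ∀ a ∈ s.getLast?, 2 ≤ a) :
    Summable (fun k : {k : Fin s.length → ℕ+ // Monotone k} => mzvTerm s k.1) := by
  rcases Nat.eq_zero_or_pos s.length with h | hr
  · obtain rfl := List.length_eq_zero_iff.1 h
    have : Finite {k : Fin ([] : List ℕ).length → ℕ+ // Monotone k} :=
      haveI : Finite (Fin ([] : List ℕ).length → ℕ+) := inferInstanceAs (Finite (Fin 0 → ℕ+))
      Subtype.finite
    exact Summable.of_finite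
  set r := s.length with hrdef
  set e : ℝ := 1 + 1 / (r : ℝ) with he
  have hrR : (0 : ℝ) < r := by exact_mod_cast hr
  have hs : Summable (fun x : ℕ+ => ((x : ℕ) : ℝ) ^ (-e)) := by
    have : Summable (fun x : ℕ => (x : ℝ) ^ (-e)) :=
      Real.summable_nat_rpow.2 (by rw [he]; have : 0 < 1 / (r : ℝ) := by positivity
                                   linarith)
    exact this.comp_injective PNat.coe_injective
  have hS := (summable_pi_prod (fun x => by positivity) hs r).comp_injective
    (Subtype.val_injective (p := fun k : Fin r → ℕ+ => Monotone k))
  refine Summable.of_nonneg_of_le (fun k => Finset.prod_nonneg fun i _ => by positivity)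
    (fun k => ?_) hS
  obtain ⟨k, hk⟩ := k
  simp only [mzvTerm, Function.comp]
  have hpos : ∀ i, (1 : ℝ) ≤ ((k i : ℕ) : ℝ) := fun i => by exact_mod_cast (k i).pos
  have hpos' : ∀ i, (0 : ℝ) < ((k i : ℕ) : ℝ) := fun i => by linarith [hpos i]
  let l : Fin r := ⟨r - 1, by omega⟩
  have hl2 : 2 ≤ s.get l := by
    apply h2
    rw [List.getLast?_eq_getElem?]
    simp [l, hrdef]
  simp only [Real.rpow_neg (hpos' _).le, Finset.prod_inv_distrib]
  apply inv_anti₀ (Finset.prod_pos fun i _ => Real.rpow_pos_of_pos (hpos' i) _)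
  calc ∏ i, ((k i : ℕ) : ℝ) ^ e
      = (∏ i, ((k i : ℕ) : ℝ)) * ∏ i, ((k i : ℕ) : ℝ) ^ (1 / (r : ℝ)) := by
        rw [← Finset.prod_mul_distrib]
        refine Finset.prod_congr rfl fun i _ => ?_
        rw [he, Real.rpow_add (hpos' i), Real.rpow_one]
    _ ≤ (∏ i, ((k i : ℕ) : ℝ)) * ∏ i : Fin r, ((k l : ℕ) : ℝ) ^ (1 / (r : ℝ)) := by
        refine mul_le_mul_of_nonneg_left ?_ (Finset.prod_nonneg fun i _ => (hpos' i).le)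
        refine Finset.prod_le_prod (fun i _ => by positivity) fun i _ => ?_
        refine Real.rpow_le_rpow (hpos' i).le ?_ (by positivity)
        have : k i ≤ k l := hk (by rw [Fin.le_def]; simp only [l]; omega)
        exact_mod_cast this
    _ = (∏ i, ((k i : ℕ) : ℝ)) * ((k l : ℕ) : ℝ) := by
        rw [Finset.prod_const, Finset.card_univ, Fintype.card_fin, ← Real.rpow_natCast,
          ← Real.rpow_mul (hpos' l).le, one_div_mul_cancel hrR.ne', Real.rpow_one]
    _ = ∏ i, (((k i : ℕ) : ℝ) * if i = l then ((k l : ℕ) : ℝ) else 1) := by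
        rw [Finset.prod_mul_distrib, Finset.prod_ite_eq' Finset.univ l]
        simp
    _ ≤ ∏ i, ((k i : ℕ) : ℝ) ^ s.get i := by
        refine Finset.prod_le_prod (fun i _ => by have := hpos' i; have := hpos' l; split_ifs <;> positivity) fun i _ => ?_
        split_ifs with h
        · subst h
          calc _ = ((k l : ℕ) : ℝ) ^ 2 := by ring
            _ ≤ _ := pow_le_pow_right₀ (hpos l) hl2
        · calc _ = ((k i : ℕ) : ℝ) ^ 1 := by ring
            _ ≤ _ := pow_le_pow_right₀ (hpos i) (h1 _ (List.get_mem s i))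

/-- The series of `ζ(s)` converges if all entries of `s` are positive and the last one is
at least `2`. -/
theorem summable_mzv (s : List ℕ) (h1 : ∀ a ∈ s, 1 ≤ a) (h2 : ∀ a ∈ s.getLast?, 2 ≤ a) :
    Summable (fun k : {k : Fin s.length → ℕ+ // StrictMono k} => mzvTerm s k.1) := by
  have h := (summable_mzvStar s h1 h2).comp_injective
    (Subtype.map_injective (p := fun k : Fin s.length → ℕ+ => StrictMono k)
      (fun _ hk => hk.monotone) Function.injective_id)
  refine h.congr fun k => ?_
  rfl

end

/-! Both sides are compared through generating functions in `x ^ 2` for small `x > 0`, where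
coefficients are determined by values (`EvenRep.unique`). Let S = ∏ (1 - x²/k²)⁻¹ = πx / sin πx,
which generates ζ⋆({2}^n), and let Z and x·G be the even and odd parts of ∑ 1/(k(k - x)), so that Z
and G generate ζ(2n+2) and ζ(2n+3). The left side is generated by F = ∑ k⁻⁴ ∏_{j≥k} (1 - x²/j²)⁻¹.

F is evaluated by partial fractions. For the rational function R_N = `resKernel N x`, the value k²
R_N(k) tends to ∏_{j≥k} (1 - x²/j²)⁻¹, so F = lim ∑_{k≤N} k⁻² R_N(k). Since R_N vanishes at -1, …,
-N, each R_N(k) may be replaced by R_N(k) + R_N(-k). Expanding R_N over its simple poles s = -a and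
summing over k leaves three terms per pole: multiples of 1/a and of 1/a³, which recombine into
R_N(0) and R_N''(0)/2, and a⁻² times a partial sum of π cot πa (`sum_resKernel`,
`sum_resWeight_cube`). In the limit the residues contain the factor (x π cot πx)⁻¹
(`shiftGen_mul_shiftGen_neg`), which cancels the cotangent. What remains is expressed by H(x) = ∑ k
(k - x)⁻⁴ ∏_{j>k} (1 - x²/(j - x)²), whose expansion produces the alternating sums over c_j with the
weights W. With the differential equation cot' = -1 - cot² this becomes F = -A + 2S(Z² + x²G²),
where A = (H(x) - H(-x))/(2x) (`fourGen_eq_zeta`).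

The other terms of the theorem rewrite 2S(Z² + x²G²). The sums with a single 3 contribute x²SG²
(`sum_nested_two_three_two`). The function Γ(1-u)Γ(1-v)/Γ(1-u-v) equals 1 - uv ∑ ζ({1}^p, q+2) u^p
v^q (`gammaQuot_eq`); its second u-derivative at u = 0 gives the values ζ(1, q+2), and on v = -u,
where the quotient equals S, it gives the sum over p + q = 2n. The relation dS/d(x²) = ZS accounts
for the factor b, and S = x(π cot(πx/2) - π cot πx) makes ζ⋆({2}^n) a multiple of ζ(2n).
`fourSeries_eq` collects everything into one identity of power series. -/

noncomputable section

/-! ### Power series representations and uniqueness of coefficients -/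

/-- `g` is the sum of the power series with coefficients `c` on `|x| < r`. -/
def SeriesRep (r : ℝ) (c : ℕ → ℝ) (g : ℝ → ℝ) : Prop :=
  ∀ x, |x| < r → Summable (fun n => |c n| * |x| ^ n) ∧ HasSum (fun n => c n * x ^ n) (g x)

/-- `g` is the sum of the power series `φ` in `x ^ 2` on `0 < x < r`. -/
def EvenRep (r : ℝ) (φ : PowerSeries ℝ) (g : ℝ → ℝ) : Prop :=
  ∀ x, 0 < x → x < r → Summable (fun n => |PowerSeries.coeff n φ| * (x ^ 2) ^ n) ∧
    HasSum (fun n => PowerSeries.coeff n φ * (x ^ 2) ^ n) (g x)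

theorem SeriesRep.congr {r : ℝ} {c : ℕ → ℝ} {g g' : ℝ → ℝ} (h : SeriesRep r c g)
    (hg : ∀ x, |x| < r → g x = g' x) : SeriesRep r c g' := fun x hx => by
  rw [← hg x hx]; exact h x hx

theorem EvenRep.congr {r : ℝ} {c : PowerSeries ℝ} {g g' : ℝ → ℝ} (h : EvenRep r c g)
    (hg : ∀ x, 0 < x → x < r → g x = g' x) : EvenRep r c g' := fun x h0 hx => by
  rw [← hg x h0 hx]; exact h x h0 hx

theorem SeriesRep.mono {r r' : ℝ} {c : ℕ → ℝ} {g : ℝ → ℝ} (h : SeriesRep r c g) (hr : r' ≤ r) : SeriesRep r' c g :=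
  fun x hx => h x (hx.trans_le hr)

theorem abs_tsum_le {ι : Type*} {f : ι → ℝ} (h : Summable fun i => |f i|) :
    |∑' i, f i| ≤ ∑' i, |f i| := norm_tsum_le_tsum_norm (f := f) h

/-- Fubini: the second hypothesis makes the double series absolutely convergent, so it can be summed
by powers of `x` instead. -/
theorem SeriesRep.tsum {ι : Type*} {r : ℝ} {c : ι → ℕ → ℝ} {g : ι → ℝ → ℝ}
    (h : ∀ m, SeriesRep r (c m) (g m))
    (hs : ∀ x, 0 ≤ x → x < r → Summable (fun m => ∑' n, |c m n| * x ^ n)) :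
    SeriesRep r (fun n => ∑' m, c m n) (fun x => ∑' m, g m x) := by
  intro x hx
  have hS : Summable (fun p : ι × ℕ => |c p.1 p.2| * |x| ^ p.2) := by
    refine (summable_prod_of_nonneg (fun p => by positivity)).2
      ⟨fun m => (h m x hx).1, hs |x| (abs_nonneg _) hx⟩
  have hS' : Summable (fun p : ι × ℕ => c p.1 p.2 * x ^ p.2) := by
    refine Summable.of_norm (hS.congr fun p => ?_)
    simp
  have hsw : Summable (fun p : ℕ × ι => |c p.2 p.1| * |x| ^ p.1) :=
    ((Equiv.prodComm ℕ ι).summable_iff (f := fun p : ι × ℕ => |c p.1 p.2| * |x| ^ p.2)).2 hS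
  have hsw' : Summable (fun p : ℕ × ι => c p.2 p.1 * x ^ p.1) :=
    ((Equiv.prodComm ℕ ι).summable_iff (f := fun p : ι × ℕ => c p.1 p.2 * x ^ p.2)).2 hS'
  have h1 := (summable_prod_of_nonneg (f := fun p : ℕ × ι => |c p.2 p.1| * |x| ^ p.1)
    (fun p => by positivity)).1 hsw
  constructor
  · refine Summable.of_nonneg_of_le (fun n => by positivity) (fun n => ?_) h1.2
    rcases eq_or_ne x 0 with rfl | hx0
    · rcases n with _ | n
      · have h2 : Summable fun m => |c m 0| := (h1.1 0).congr fun m => by simp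
        simpa using abs_tsum_le h2
      · simp
    · have hxp : (0:ℝ) < |x| ^ n := by positivity
      have h2 : Summable (fun m => |c m n|) := by
        refine ((h1.1 n).mul_right (|x| ^ n)⁻¹).congr fun m => ?_
        rw [mul_assoc, mul_inv_cancel₀ hxp.ne', mul_one]
      change |∑' m, c m n| * |x| ^ n ≤ ∑' m, |c m n| * |x| ^ n
      rw [tsum_mul_right]
      exact mul_le_mul_of_nonneg_right (abs_tsum_le h2) hxp.le
  · have e1 : ∑' p : ι × ℕ, c p.1 p.2 * x ^ p.2 = ∑' m, g m x := by
      rw [hS'.tsum_prod]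
      exact tsum_congr fun m => (h m x hx).2.tsum_eq
    have e2 : HasSum (fun p : ℕ × ι => c p.2 p.1 * x ^ p.1) (∑' m, g m x) := by
      rw [← e1]
      exact ((Equiv.prodComm ℕ ι).hasSum_iff (f := fun p : ι × ℕ => c p.1 p.2 * x ^ p.2)).2
        hS'.hasSum
    have := e2.prod_fiberwise (fun n => (hsw'.prod_factor n).hasSum)
    simpa [tsum_mul_right] using this

theorem SeriesRep.hasSum {r : ℝ} {c : ℕ → ℝ} {g : ℝ → ℝ} (h : SeriesRep r c g) {x : ℝ} (hx : |x| < r) :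
    HasSum (fun n => c n * x ^ n) (g x) := (h x hx).2

theorem SeriesRep.summable_deriv {r : ℝ} {c : ℕ → ℝ} {g : ℝ → ℝ} (h : SeriesRep r c g) {ρ : ℝ} (h0 : 0 ≤ ρ)
    (hρ : ρ < r) : Summable (fun n : ℕ => (n : ℝ) * |c n| * ρ ^ (n - 1)) := by
  -- A slightly larger radius absorbs the factor `n`, because `(n + 1) * (ρ / σ) ^ n` is bounded.
  obtain ⟨σ, h1, h2⟩ := exists_between hρ
  have hσ : 0 < σ := h0.trans_lt h1
  have hs := (h σ (by rwa [abs_of_pos hσ])).1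
  rw [abs_of_pos hσ] at hs
  have hq : ρ / σ < 1 := (div_lt_one hσ).2 h1
  have hq0 : 0 ≤ ρ / σ := by positivity
  have hb : Filter.Tendsto (fun n : ℕ => (n : ℝ) * (ρ / σ) ^ n) Filter.atTop (nhds 0) :=
    tendsto_self_mul_const_pow_of_lt_one hq0 hq
  have hb' : Filter.Tendsto (fun n : ℕ => ((n + 1 : ℕ) : ℝ) * (ρ / σ) ^ n) Filter.atTop (nhds 0) := by
    have := hb.add (tendsto_pow_atTop_nhds_zero_of_lt_one hq0 hq)
    simp only [add_zero] at this
    refine this.congr fun n => ?_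
    push_cast; ring
  obtain ⟨M, hM⟩ := hb'.bddAbove_range
  have hM' : ∀ n : ℕ, ((n + 1 : ℕ) : ℝ) * (ρ / σ) ^ n ≤ M := fun n => hM ⟨n, rfl⟩
  refine (summable_nat_add_iff 1).1 ?_
  have hs1 := ((summable_nat_add_iff 1).2 hs).mul_left (M / σ)
  refine Summable.of_nonneg_of_le (fun n => by positivity) (fun n => ?_) hs1
  have : ((n + 1 : ℕ) : ℝ) * |c (n + 1)| * ρ ^ (n + 1 - 1)
      = (((n + 1 : ℕ) : ℝ) * (ρ / σ) ^ n) * (|c (n + 1)| * σ ^ n) := by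
    rw [Nat.add_sub_cancel, div_pow]; field_simp
  rw [this]
  calc _ ≤ M * (|c (n + 1)| * σ ^ n) := mul_le_mul_of_nonneg_right (hM' n) (by positivity)
    _ = _ := by rw [pow_succ]; field_simp

theorem SeriesRep.hasDerivAt {r : ℝ} {c : ℕ → ℝ} {g : ℝ → ℝ} (h : SeriesRep r c g) {x : ℝ} (hx : |x| < r) :
    HasDerivAt g (∑' n : ℕ, c n * (n * x ^ (n - 1))) x := by
  obtain ⟨ρ, h1, h2⟩ := exists_between hx
  have h0 : 0 < ρ := (abs_nonneg x).trans_lt h1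
  have key := hasDerivAt_tsum_of_isPreconnected (t := Metric.ball (0:ℝ) ρ)
    (g := fun n y => c n * y ^ n) (g' := fun n y => c n * (n * y ^ (n - 1))) (y₀ := 0) (y := x)
    (h.summable_deriv h0.le h2) Metric.isOpen_ball (convex_ball 0 ρ).isPreconnected
    (fun n y _ => (hasDerivAt_pow n y).const_mul (c n))
    (fun n y hy => by
      have hy' : |y| ≤ ρ := by simpa using (mem_ball_zero_iff.1 hy).le
      rw [norm_mul, norm_mul, norm_pow]
      simp only [Real.norm_eq_abs, Nat.abs_cast]
      calc |c n| * (n * |y| ^ (n - 1)) ≤ |c n| * (n * ρ ^ (n - 1)) := by gcongr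
        _ = _ := by ring)
    (by simpa using h0) (h 0 (by simpa using h0.trans h2)).2.summable (by simpa using h1)
  refine key.congr_of_eventuallyEq ?_
  have : Metric.ball (0:ℝ) ρ ∈ nhds x := Metric.isOpen_ball.mem_nhds (by simpa using h1)
  filter_upwards [this] with y hy
  exact (h y (by have : |y| < ρ := by simpa using hy
                 linarith)).2.tsum_eq.symm

theorem SeriesRep.deriv {r : ℝ} {c : ℕ → ℝ} {g : ℝ → ℝ} (h : SeriesRep r c g) :
    SeriesRep r (fun n => (n + 1 : ℝ) * c (n + 1)) (deriv g) := by
  intro x hx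
  have hs := (summable_nat_add_iff 1).2 (h.summable_deriv (abs_nonneg x) hx)
  have hs' : Summable (fun n : ℕ => |(n + 1 : ℝ) * c (n + 1)| * |x| ^ n) := by
    refine hs.congr fun n => ?_
    have : (0:ℝ) ≤ (n:ℝ) + 1 := by positivity
    rw [abs_mul, abs_of_nonneg this, Nat.add_sub_cancel]
    push_cast; ring
  refine ⟨hs', ?_⟩
  rw [(h.hasDerivAt hx).deriv]
  have hs2 : Summable (fun n : ℕ => (n + 1 : ℝ) * c (n + 1) * x ^ n) :=
    Summable.of_norm (hs'.congr fun n => by simp [abs_mul])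
  have hs3 : Summable (fun n : ℕ => c n * (n * x ^ (n - 1))) := by
    refine (summable_nat_add_iff 1).1 (hs2.congr fun n => ?_)
    rw [Nat.add_sub_cancel]; push_cast; ring
  rw [hs3.tsum_eq_zero_add]
  simp only [CharP.cast_eq_zero, zero_mul, mul_zero, zero_add, Nat.add_sub_cancel]
  convert hs2.hasSum using 1
  exact tsum_congr fun n => by push_cast; ring

theorem SeriesRep.comp_neg {r : ℝ} {c : ℕ → ℝ} {g : ℝ → ℝ} (h : SeriesRep r c g) :
    SeriesRep r (fun n => (-1) ^ n * c n) (fun x => g (-x)) := by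
  intro x hx
  have := h (-x) (by rwa [abs_neg])
  refine ⟨by simpa [abs_mul] using this.1, ?_⟩
  refine HasSum.congr_fun this.2 fun n => ?_
  simp only [neg_pow x]; ring

/-- Once the earlier coefficients vanish, division by `t ^ n` leaves a series that is still zero for
`t > 0`, and dominated convergence as `t → 0+` isolates `c n`. One-sided information is enough. -/
theorem eq_zero_of_hasSum_zero {r : ℝ} (hr : 0 < r) {c : ℕ → ℝ}
    (hs : ∀ t, 0 < t → t < r → Summable (fun n => |c n| * t ^ n))
    (h : ∀ t, 0 < t → t < r → HasSum (fun n => c n * t ^ n) 0) (n : ℕ) : c n = 0 := by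
  induction n using Nat.strong_induction_on with
  | _ n ih =>
    have h2 : 0 < r / 2 := by positivity
    have hsn : Summable (fun m => |c (m + n)| * (r / 2) ^ m) := by
      have := ((summable_nat_add_iff n).2 (hs (r / 2) h2 (by linarith))).mul_right ((r / 2) ^ n)⁻¹
      refine this.congr fun m => ?_
      rw [pow_add]; field_simp
    have hlim : Filter.Tendsto (fun t : ℝ => ∑' m, c (m + n) * t ^ m) (nhdsWithin 0 (Set.Ioi 0))
        (nhds (∑' m, c (m + n) * (0:ℝ) ^ m)) := by
      refine tendsto_tsum_of_dominated_convergence hsn (fun m => ?_) ?_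
      · exact ((continuous_const.mul (continuous_pow m)).tendsto 0).mono_left nhdsWithin_le_nhds
      · filter_upwards [Ioo_mem_nhdsGT h2] with t ht m
        rw [norm_mul, norm_pow, Real.norm_eq_abs, Real.norm_eq_abs, abs_of_pos ht.1]
        have := ht.1.le
        have := ht.2.le
        gcongr
    have hzero : ∀ᶠ t in nhdsWithin (0:ℝ) (Set.Ioi 0), ∑' m, c (m + n) * t ^ m = 0 := by
      filter_upwards [Ioo_mem_nhdsGT hr] with t ht
      have h1 := h t ht.1 ht.2
      have h3 := (hasSum_nat_add_iff' n).2 h1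
      have h4 : ∑ i ∈ Finset.range n, c i * t ^ i = 0 :=
        Finset.sum_eq_zero fun i hi => by rw [ih i (Finset.mem_range.1 hi), zero_mul]
      rw [h4, sub_zero] at h3
      have h5 := h3.mul_right (t ^ n)⁻¹
      rw [zero_mul] at h5
      rw [← h5.tsum_eq]
      refine tsum_congr fun m => ?_
      have := ht.1
      rw [pow_add]; field_simp
    have h6 := tendsto_nhds_unique hlim ((Filter.tendsto_congr' hzero).2 tendsto_const_nhds)
    rw [tsum_eq_single 0 (fun m hm => by simp [hm])] at h6
    simpa using h6

theorem EvenRep.unique {r : ℝ} (hr : 0 < r) {φ ψ : PowerSeries ℝ} {g : ℝ → ℝ}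
    (h1 : EvenRep r φ g) (h2 : EvenRep r ψ g) : φ = ψ := by
  ext n
  have key := eq_zero_of_hasSum_zero (r := r ^ 2) (by positivity)
    (c := fun n => PowerSeries.coeff n φ - PowerSeries.coeff n ψ) ?_ ?_ n
  · linarith
  · intro t h0 ht
    have hx0 := Real.sqrt_pos.2 h0
    have hx : Real.sqrt t < r := (Real.sqrt_lt' hr).2 ht
    have a := (h1 _ hx0 hx).1.add (h2 _ hx0 hx).1
    rw [Real.sq_sqrt h0.le] at a
    refine Summable.of_nonneg_of_le (fun n => by positivity) (fun n => ?_) a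
    rw [← add_mul]
    gcongr
    exact (abs_sub _ _)
  · intro t h0 ht
    have hx0 := Real.sqrt_pos.2 h0
    have hx : Real.sqrt t < r := (Real.sqrt_lt' hr).2 ht
    have a := (h1 _ hx0 hx).2.sub (h2 _ hx0 hx).2
    rw [Real.sq_sqrt h0.le, sub_self] at a
    simpa [sub_mul] using a

theorem EvenRep.add {r : ℝ} {φ ψ : PowerSeries ℝ} {f g : ℝ → ℝ}
    (h1 : EvenRep r φ f) (h2 : EvenRep r ψ g) : EvenRep r (φ + ψ) (fun x => f x + g x) := by
  intro x h0 hx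
  constructor
  · refine Summable.of_nonneg_of_le (fun n => by positivity) (fun n => ?_)
      ((h1 x h0 hx).1.add (h2 x h0 hx).1)
    rw [← add_mul, map_add]
    gcongr
    exact abs_add_le _ _
  · simpa [add_mul] using (h1 x h0 hx).2.add (h2 x h0 hx).2

theorem EvenRep.mul {r : ℝ} {φ ψ : PowerSeries ℝ} {f g : ℝ → ℝ}
    (h1 : EvenRep r φ f) (h2 : EvenRep r ψ g) : EvenRep r (φ * ψ) (fun x => f x * g x) := by
  intro x h0 hx
  obtain ⟨s1, a1⟩ := h1 x h0 hx
  obtain ⟨s2, a2⟩ := h2 x h0 hx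
  have n1 : Summable (fun n => ‖PowerSeries.coeff n φ * (x ^ 2) ^ n‖) :=
    s1.congr fun n => by rw [norm_mul, norm_pow, Real.norm_eq_abs, Real.norm_eq_abs, abs_sq]
  have n2 : Summable (fun n => ‖PowerSeries.coeff n ψ * (x ^ 2) ^ n‖) :=
    s2.congr fun n => by rw [norm_mul, norm_pow, Real.norm_eq_abs, Real.norm_eq_abs, abs_sq]
  have e : ∀ n, ∑ kl ∈ Finset.HasAntidiagonal.antidiagonal n, (PowerSeries.coeff kl.1 φ * (x ^ 2) ^ kl.1) *
      (PowerSeries.coeff kl.2 ψ * (x ^ 2) ^ kl.2) = PowerSeries.coeff n (φ * ψ) * (x ^ 2) ^ n := by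
    intro n
    rw [PowerSeries.coeff_mul, Finset.sum_mul]
    refine Finset.sum_congr rfl fun kl hkl => ?_
    rw [← Finset.HasAntidiagonal.mem_antidiagonal.1 hkl, pow_add]; ring
  have n3 := summable_norm_sum_mul_antidiagonal_of_summable_norm n1 n2
  simp only [e] at n3
  refine ⟨n3.congr fun n => by
    rw [norm_mul, norm_pow, Real.norm_eq_abs, Real.norm_eq_abs, abs_sq], ?_⟩
  have := tsum_mul_tsum_eq_tsum_sum_antidiagonal_of_summable_norm n1 n2
  simp only [e] at this
  rw [a1.tsum_eq, a2.tsum_eq] at this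
  dsimp only
  rw [this]
  exact n3.of_norm.hasSum

theorem EvenRep.const {r : ℝ} (a : ℝ) : EvenRep r (PowerSeries.C a) (fun _ => a) := by
  intro x h0 hx
  have hz : ∀ n, n ≠ 0 → PowerSeries.coeff n (PowerSeries.C a) = 0 := fun n hn => by
    rw [PowerSeries.coeff_C, if_neg hn]
  constructor
  · refine summable_of_ne_finset_zero (s := {0}) fun n hn => ?_
    rw [hz n (by simpa using hn)]; simp
  · have := hasSum_single (f := fun n => PowerSeries.coeff n (PowerSeries.C a) * (x ^ 2) ^ n) 0
      (fun n hn => by rw [hz n hn, zero_mul])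
    simpa using this

theorem EvenRep.X {r : ℝ} : EvenRep r (PowerSeries.X) (fun x => x ^ 2) := by
  intro x h0 hx
  have hz : ∀ n, n ≠ 1 → PowerSeries.coeff n (PowerSeries.X : PowerSeries ℝ) = 0 := fun n hn => by
    rw [PowerSeries.coeff_X, if_neg hn]
  constructor
  · refine summable_of_ne_finset_zero (s := {1}) fun n hn => ?_
    rw [hz n (by simpa using hn)]; simp
  · have := hasSum_single (f := fun n => PowerSeries.coeff n (PowerSeries.X) * (x ^ 2) ^ n) 1
      (fun n hn => by rw [hz n hn, zero_mul])
    simpa using this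

theorem SeriesRep.even {r : ℝ} {c : ℕ → ℝ} {g : ℝ → ℝ} (h : SeriesRep r c g) :
    EvenRep r (PowerSeries.mk fun n => c (2 * n)) (fun x => (g x + g (-x)) / 2) := by
  intro x h0 hx
  have hx' : |x| < r := by rwa [abs_of_pos h0]
  obtain ⟨s, a⟩ := h x hx'
  have hinj : Function.Injective (fun n : ℕ => 2 * n) := fun a b h => by simpa using h
  constructor
  · refine (s.comp_injective hinj).congr fun n => ?_
    simp [pow_mul]
  · have b := ((a.add (h.comp_neg x hx').2).div_const 2)
    have b' := (hinj.hasSum_iff (f := fun n => (c n * x ^ n + (-1) ^ n * c n * x ^ n) / 2)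
      (a := (g x + g (-x)) / 2) (fun n hn => ?_)).2 b
    · refine b'.congr_fun (fun n => ?_) |> id
      simp [pow_mul]
    · have : Odd n := by
        rw [← Nat.not_even_iff_odd]
        rintro ⟨k, hk⟩
        exact hn ⟨k, by simp; omega⟩
      rw [this.neg_one_pow]; ring

/-- Here the value at `x = 0` would be `0 / 0`, which is why `EvenRep` asks only for `0 < x`. -/
theorem SeriesRep.odd {r : ℝ} {c : ℕ → ℝ} {g : ℝ → ℝ} (h : SeriesRep r c g) :
    EvenRep r (PowerSeries.mk fun n => c (2 * n + 1)) (fun x => (g x - g (-x)) / (2 * x)) := by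
  intro x h0 hx
  have hx' : |x| < r := by rwa [abs_of_pos h0]
  obtain ⟨s, a⟩ := h x hx'
  have hinj : Function.Injective (fun n : ℕ => 2 * n + 1) := fun a b h => by simpa using h
  constructor
  · refine ((s.mul_right x⁻¹).comp_injective hinj).congr fun n => ?_
    simp only [Function.comp, PowerSeries.coeff_mk, abs_of_pos h0, pow_succ, pow_mul]
    field_simp
  · have b := ((a.sub (h.comp_neg x hx').2).div_const (2 * x))
    have b' := (hinj.hasSum_iff (f := fun n => (c n * x ^ n - (-1) ^ n * c n * x ^ n) / (2 * x))
      (a := (g x - g (-x)) / (2 * x)) (fun n hn => ?_)).2 b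
    · refine b'.congr_fun (fun n => ?_) |> id
      simp only [Function.comp, PowerSeries.coeff_mk, pow_succ, pow_mul]
      simp
      field_simp
      ring
    · have : Even n := by
        rw [← Nat.not_odd_iff_even]
        rintro ⟨k, hk⟩
        exact hn ⟨k, by simp; omega⟩
      rw [this.neg_one_pow]; ring

/-! ### Tails of multiple zeta and zeta-star values -/

/-- The sum of `∏ k i ^ (-s i)` over the tuples of integers greater than `m` in which consecutive
entries differ by at least `δ`. -/
def nestedE (δ : ℕ) (s : List ℕ) (m : ℕ) : ENNReal :=
  ∑' k : Fin s.length → ℕ+, if (∀ i, m < (k i : ℕ)) ∧ (∀ i j, i < j → (k i : ℕ) + δ ≤ k j) then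
    ENNReal.ofReal (mzvTerm s k) else 0

/-- Real version of `nestedE`. -/
def nested (δ : ℕ) (s : List ℕ) (m : ℕ) : ℝ := (nestedE δ s m).toReal

/-- Indices for which the series of multiple zeta values converge. -/
def Admissible (s : List ℕ) : Prop := (∀ a ∈ s, 1 ≤ a) ∧ ∀ a ∈ s.getLast?, 2 ≤ a

theorem mzvTerm_nonneg (s : List ℕ) (k : Fin s.length → ℕ+) : 0 ≤ mzvTerm s k :=
  Finset.prod_nonneg fun i _ => by positivity

theorem mzv_eq_nested (s : List ℕ) : mzv s = nested 1 s 0 := by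
  have h := ENNReal.tsum_toReal_eq
    (f := fun k : {k : Fin s.length → ℕ+ // StrictMono k} => ENNReal.ofReal (mzvTerm s k.1))
    (fun _ => ENNReal.ofReal_ne_top)
  simp only [ENNReal.toReal_ofReal (mzvTerm_nonneg _ _)] at h
  rw [mzv, ← h, nested, nestedE]
  congr 1
  refine (tsum_subtype {k : Fin s.length → ℕ+ | StrictMono k}
    (fun k => ENNReal.ofReal (mzvTerm s k))).trans ?_
  refine tsum_congr fun k => ?_
  rw [Set.indicator_apply]
  refine if_congr ?_ rfl rfl
  constructor
  · intro h
    exact ⟨fun i => (k i).pos, fun i j hij => by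
      have : k i < k j := h hij
      exact_mod_cast this⟩
  · intro h i j hij
    have := h.2 i j hij
    exact_mod_cast this

theorem mzvStar_eq_nested (s : List ℕ) : mzvStar s = nested 0 s 0 := by
  have h := ENNReal.tsum_toReal_eq
    (f := fun k : {k : Fin s.length → ℕ+ // Monotone k} => ENNReal.ofReal (mzvTerm s k.1))
    (fun _ => ENNReal.ofReal_ne_top)
  simp only [ENNReal.toReal_ofReal (mzvTerm_nonneg _ _)] at h
  rw [mzvStar, ← h, nested, nestedE]
  congr 1
  refine (tsum_subtype {k : Fin s.length → ℕ+ | Monotone k}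
    (fun k => ENNReal.ofReal (mzvTerm s k))).trans ?_
  refine tsum_congr fun k => ?_
  rw [Set.indicator_apply]
  refine if_congr ?_ rfl rfl
  constructor
  · intro h
    exact ⟨fun i => (k i).pos, fun i j hij => by
      have : k i ≤ k j := h hij.le
      exact_mod_cast this⟩
  · intro h i j hij
    rcases hij.eq_or_lt with rfl | hij
    · exact le_rfl
    have := h.2 i j hij
    exact_mod_cast this

theorem nestedE_nil (δ m : ℕ) : nestedE δ [] m = 1 := by
  refine (tsum_eq_single (fun i : Fin 0 => i.elim0)
    (fun k hk => (hk (funext fun i => i.elim0)).elim)).trans ?_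
  rw [if_pos ⟨fun i => i.elim0, fun i => i.elim0⟩]
  simp [mzvTerm]

/-- Splits off the smallest entry `m + 1 + k`. The others must exceed `m + k + δ`, so `δ = 1` gives
strict and `δ = 0` weak inequalities in one recursion. -/
theorem nestedE_cons (δ a : ℕ) (s : List ℕ) (m : ℕ) :
    nestedE δ (a :: s) m =
      ∑' k : ℕ, ENNReal.ofReal (((m + 1 + k : ℕ) : ℝ) ^ a)⁻¹ * nestedE δ s (m + k + δ) := by
  have e1 : nestedE δ (a :: s) m = ∑' p : ℕ+ × (Fin s.length → ℕ+),
      if m < (p.1 : ℕ) then ENNReal.ofReal (((p.1 : ℕ) : ℝ) ^ a)⁻¹ *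
        (if (∀ i, (p.1 : ℕ) - 1 + δ < (p.2 i : ℕ)) ∧ (∀ i j, i < j → (p.2 i : ℕ) + δ ≤ p.2 j) then
          ENNReal.ofReal (mzvTerm s p.2) else 0) else 0 := by
    refine ((Fin.consEquiv (fun _ : Fin (s.length + 1) => ℕ+)).tsum_eq _).symm.trans ?_
    refine tsum_congr fun p => ?_
    obtain ⟨k, f⟩ := p
    have ht : mzvTerm (a :: s) (Fin.cons k f : Fin (s.length + 1) → ℕ+)
        = (((k : ℕ) : ℝ) ^ a)⁻¹ * mzvTerm s f := by
      simp [mzvTerm, Fin.prod_univ_succ, mul_comm]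
    simp only [Fin.consEquiv, Equiv.coe_fn_mk, ht]
    have hk := k.pos
    have hc : ((∀ i : Fin (s.length + 1), m < (((Fin.cons k f : Fin (s.length + 1) → ℕ+) i : ℕ+) : ℕ)) ∧
        (∀ i j : Fin (s.length + 1), i < j →
          (((Fin.cons k f : Fin (s.length + 1) → ℕ+) i : ℕ+) : ℕ) + δ
            ≤ (((Fin.cons k f : Fin (s.length + 1) → ℕ+) j : ℕ+) : ℕ))) ↔
        (m < (k : ℕ) ∧ ((∀ i, (k : ℕ) - 1 + δ < (f i : ℕ)) ∧
          (∀ i j, i < j → (f i : ℕ) + δ ≤ f j))) := by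
      simp only [Fin.forall_fin_succ, Fin.cons_zero, Fin.cons_succ, Fin.succ_lt_succ_iff,
        Fin.succ_pos, false_imp_iff, true_and, true_imp_iff, Fin.not_lt_zero]
      constructor
      · rintro ⟨⟨h1, h2⟩, h3, h4⟩
        exact ⟨h1, fun i => by have := h3 i; omega, h4⟩
      · rintro ⟨h1, h2, h4⟩
        exact ⟨⟨h1, fun i => by have := h2 i; omega⟩, fun i => by have := h2 i; omega, h4⟩
    refine (if_congr hc rfl rfl).trans ?_
    rw [ENNReal.ofReal_mul (by positivity)]
    split_ifs <;> first | rfl | simp_all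
  rw [e1, ENNReal.tsum_prod']
  have hinj : Function.Injective (fun k : ℕ => (m + k).succPNat) := by
    intro k l h
    simpa using h
  refine (hinj.tsum_eq ?_).symm.trans ?_
  · intro k hk
    by_contra hn
    apply hk
    refine ENNReal.tsum_eq_zero.2 fun f => ?_
    refine if_neg fun h => hn ⟨(k : ℕ) - (m + 1), PNat.eq ?_⟩
    dsimp only at h
    simp only [Nat.succPNat_coe]
    omega
  · refine tsum_congr fun k => ?_
    rw [nestedE, ← ENNReal.tsum_mul_left]
    refine tsum_congr fun f => ?_
    simp only [Nat.succPNat_coe, Nat.succ_eq_add_one, Nat.add_sub_cancel]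
    rw [if_pos (by omega), add_right_comm]

theorem nestedE_anti (δ : ℕ) (s : List ℕ) {m m' : ℕ} (h : m ≤ m') :
    nestedE δ s m' ≤ nestedE δ s m := by
  refine ENNReal.tsum_le_tsum fun k => ?_
  by_cases h1 : (∀ i, m' < (k i : ℕ)) ∧ (∀ i j, i < j → (k i : ℕ) + δ ≤ k j)
  · rw [if_pos h1, if_pos ⟨fun i => h.trans_lt (h1.1 i), h1.2⟩]
  · rw [if_neg h1]; exact zero_le

/-- Every choice of `δ` and `m` restricts the summation of the case `δ = 0`, `m = 0`, which is the
convergent star series. -/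
theorem nestedE_ne_top (δ : ℕ) {s : List ℕ} (h : Admissible s) (m : ℕ) : nestedE δ s m ≠ ⊤ := by
  have h0 : nestedE 0 s 0 ≠ ⊤ := by
    have hs : (∑' k, Set.indicator {k : Fin s.length → ℕ+ | Monotone k}
        (fun k => ENNReal.ofReal (mzvTerm s k)) k) ≠ ⊤ := by
      rw [← tsum_subtype]
      exact (summable_mzvStar s h.1 h.2).tsum_ofReal_ne_top
    refine ne_top_of_le_ne_top hs (ENNReal.tsum_le_tsum fun k => ?_)
    rw [Set.indicator_apply]
    split_ifs with h1 h2 <;> try simp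
    exact (h2 fun i j hij => by
      rcases hij.eq_or_lt with rfl | hij
      · exact le_rfl
      have := h1.2 i j hij
      exact_mod_cast this).elim
  refine ne_top_of_le_ne_top h0 (ENNReal.tsum_le_tsum fun k => ?_)
  by_cases h1 : (∀ i, m < (k i : ℕ)) ∧ (∀ i j, i < j → (k i : ℕ) + δ ≤ k j)
  · rw [if_pos h1, if_pos ⟨fun i => (k i).pos, fun i j hij => by have := h1.2 i j hij; omega⟩]
  · rw [if_neg h1]; exact zero_le

theorem nested_nonneg (δ : ℕ) (s : List ℕ) (m : ℕ) : 0 ≤ nested δ s m := ENNReal.toReal_nonneg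

theorem nested_nil (δ m : ℕ) : nested δ [] m = 1 := by simp [nested, nestedE_nil]

theorem nested_anti (δ : ℕ) {s : List ℕ} (hs : Admissible s) {m m' : ℕ} (h : m ≤ m') :
    nested δ s m' ≤ nested δ s m :=
  ENNReal.toReal_mono (nestedE_ne_top δ hs m) (nestedE_anti δ s h)

theorem hasSum_nested_cons (δ a : ℕ) {s : List ℕ} (hs : Admissible (a :: s)) (m : ℕ) :
    HasSum (fun k : ℕ => (((m + 1 + k : ℕ) : ℝ) ^ a)⁻¹ * nested δ s (m + k + δ))
      (nested δ (a :: s) m) := by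
  have h1 := nestedE_ne_top δ hs m
  rw [nestedE_cons] at h1
  have h2 := ENNReal.hasSum_toReal h1
  rw [nested, nestedE_cons, ENNReal.tsum_toReal_eq (ENNReal.ne_top_of_tsum_ne_top h1)]
  refine HasSum.congr_fun h2 fun k => ?_
  rw [ENNReal.toReal_mul, ENNReal.toReal_ofReal (by positivity)]
  rfl

/-- The first summand collects the tuples starting at `m + 1`. Together with the limit zero in
`tendsto_nested_cons`, this difference equation determines the tails. -/
theorem nested_cons_succ (δ a : ℕ) {s : List ℕ} (hs : Admissible (a :: s)) (m : ℕ) :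
    nested δ (a :: s) m = (((m + 1 : ℕ) : ℝ) ^ a)⁻¹ * nested δ s (m + δ) +
      nested δ (a :: s) (m + 1) := by
  have h := hasSum_nested_cons δ a hs m
  rw [← h.tsum_eq, h.summable.tsum_eq_zero_add, ← (hasSum_nested_cons δ a hs (m + 1)).tsum_eq]
  simp only [add_zero]
  congr 1
  refine tsum_congr fun k => ?_
  rw [show m + 1 + (k + 1) = m + 1 + 1 + k by ring, show m + (k + 1) + δ = m + 1 + k + δ by ring]

theorem tendsto_nested_cons (δ a : ℕ) {s : List ℕ} (hs : Admissible (a :: s)) :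
    Filter.Tendsto (fun m => nested δ (a :: s) m) Filter.atTop (nhds 0) := by
  have h := hasSum_nested_cons δ a hs 0
  have h2 := tendsto_sum_nat_add (fun k : ℕ => (((0 + 1 + k : ℕ) : ℝ) ^ a)⁻¹ * nested δ s (0 + k + δ))
  refine h2.congr fun m => ?_
  rw [← (hasSum_nested_cons δ a hs m).tsum_eq]
  refine tsum_congr fun k => ?_
  rw [show 0 + 1 + (k + m) = m + 1 + k by ring, show 0 + (k + m) + δ = m + k + δ by ring]

theorem HasSum.replace {ι : Type*} {f g : ι → ℝ} {a b : ℝ} (h : HasSum g b) (hf : ∀ i, f i = g i)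
    (hab : b = a) : HasSum f a := by
  rw [funext hf, ← hab]; exact h

theorem HasSum.antidiagonal {f : ℕ × ℕ → ℝ} {a : ℝ} (h : HasSum f a) :
    HasSum (fun n => ∑ x ∈ Finset.HasAntidiagonal.antidiagonal n, f x) a := by
  have h1 := (Finset.HasAntidiagonal.sigmaAntidiagonalEquivProd (A := ℕ)).hasSum_iff.2 h
  have h2 := h1.sigma (fun n => hasSum_fintype _)
  refine HasSum.congr_fun h2 fun n => ?_
  rw [← Finset.sum_coe_sort]
  rfl

theorem SeriesRep.mul {r : ℝ} {c d : ℕ → ℝ} {f g : ℝ → ℝ}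
    (h1 : SeriesRep r c f) (h2 : SeriesRep r d g) :
    SeriesRep r (fun n => ∑ x ∈ Finset.HasAntidiagonal.antidiagonal n, c x.1 * d x.2)
      (fun x => f x * g x) := by
  intro x hx
  obtain ⟨s1, a1⟩ := h1 x hx
  obtain ⟨s2, a2⟩ := h2 x hx
  have n1 : Summable (fun n => ‖c n * x ^ n‖) :=
    s1.congr fun n => by rw [norm_mul, norm_pow, Real.norm_eq_abs, Real.norm_eq_abs]
  have n2 : Summable (fun n => ‖d n * x ^ n‖) :=
    s2.congr fun n => by rw [norm_mul, norm_pow, Real.norm_eq_abs, Real.norm_eq_abs]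
  have e : ∀ n, ∑ kl ∈ Finset.HasAntidiagonal.antidiagonal n, (c kl.1 * x ^ kl.1) *
      (d kl.2 * x ^ kl.2)
        = (∑ kl ∈ Finset.HasAntidiagonal.antidiagonal n, c kl.1 * d kl.2) * x ^ n := by
    intro n
    rw [Finset.sum_mul]
    refine Finset.sum_congr rfl fun kl hkl => ?_
    rw [← Finset.HasAntidiagonal.mem_antidiagonal.1 hkl, pow_add]; ring
  have n3 := summable_norm_sum_mul_antidiagonal_of_summable_norm n1 n2
  simp only [e] at n3
  refine ⟨n3.congr fun n => by
    rw [norm_mul, norm_pow, Real.norm_eq_abs, Real.norm_eq_abs], ?_⟩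
  have := tsum_mul_tsum_eq_tsum_sum_antidiagonal_of_summable_norm n1 n2
  simp only [e] at this
  rw [a1.tsum_eq, a2.tsum_eq] at this
  dsimp only
  rw [this]
  exact n3.of_norm.hasSum

theorem admissible_replicate (n : ℕ) : Admissible (rep 2 n) := by
  refine ⟨fun a ha => by rw [List.eq_of_mem_replicate ha]; omega, fun a ha => ?_⟩
  have := List.eq_of_mem_replicate (List.mem_of_getLast? ha)
  omega

theorem admissible_of_two_le {s : List ℕ} (h : ∀ a ∈ s, 2 ≤ a) : Admissible s :=
  ⟨fun a ha => by have := h a ha; omega, fun a ha => h a (List.mem_of_getLast? ha)⟩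

theorem admissible_concat {p a : ℕ} (ha : 2 ≤ a) : Admissible (rep 1 p ++ [a]) := by
  refine ⟨fun b hb => ?_, fun b hb => ?_⟩
  · rcases List.mem_append.1 hb with h | h
    · rw [List.eq_of_mem_replicate h]
    · rw [List.mem_singleton.1 h]; omega
  · simp at hb
    omega

theorem hasSum_nested_single (δ a m : ℕ) :
    HasSum (fun k : ℕ => (((m + 1 + k : ℕ) : ℝ) ^ (a + 2))⁻¹) (nested δ [a + 2] m) := by
  have h := hasSum_nested_cons δ (a + 2) (s := []) (admissible_of_two_le (by simp)) m
  simpa only [nested_nil, mul_one] using h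

theorem nested_single_eq (δ δ' a m : ℕ) : nested δ [a + 2] m = nested δ' [a + 2] m :=
  (hasSum_nested_single δ a m).unique (hasSum_nested_single δ' a m)

/-! ### Zeta-star values with a single entry 3 -/

/-- The sum over `a + b = n` of the tails of `ζ⋆({2}^a, 3, {2}^b)` factorises. -/
theorem sum_nested_two_three_two (n m : ℕ) :
    ∑ x ∈ Finset.HasAntidiagonal.antidiagonal n, nested 0 (rep 2 x.1 ++ [3] ++ rep 2 x.2) m =
      ∑ x ∈ Finset.HasAntidiagonal.antidiagonal n,
        nested 0 [2 * x.1 + 3] m * nested 0 (rep 2 x.2) m := by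
  have adm : ∀ a b, Admissible (rep 2 a ++ [3] ++ rep 2 b) := fun a b =>
    admissible_of_two_le fun c hc => by
      simp only [List.mem_append, List.mem_singleton, List.mem_replicate] at hc
      omega
  have hX0 : ∀ b m, nested 0 (rep 2 0 ++ [3] ++ rep 2 b) m =
      (((m + 1 : ℕ) : ℝ) ^ 3)⁻¹ * nested 0 (rep 2 b) m +
        nested 0 (rep 2 0 ++ [3] ++ rep 2 b) (m + 1) := fun b m =>
    nested_cons_succ 0 3 (adm 0 b) m
  have hXs : ∀ a b m, nested 0 (rep 2 (a + 1) ++ [3] ++ rep 2 b) m =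
      (((m + 1 : ℕ) : ℝ) ^ 2)⁻¹ * nested 0 (rep 2 a ++ [3] ++ rep 2 b) m +
        nested 0 (rep 2 (a + 1) ++ [3] ++ rep 2 b) (m + 1) := fun a b m =>
    nested_cons_succ 0 2 (adm (a + 1) b) m
  have hZ : ∀ c m, nested 0 [2 * c + 3] m =
      (((m + 1 : ℕ) : ℝ) ^ (2 * c + 3))⁻¹ + nested 0 [2 * c + 3] (m + 1) := fun c m => by
    have := nested_cons_succ 0 (2 * c + 3) (s := []) (admissible_of_two_le (by simp)) m
    rwa [nested_nil, mul_one] at this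
  have hH : ∀ d m, nested 0 (rep 2 (d + 1)) m =
      (((m + 1 : ℕ) : ℝ) ^ 2)⁻¹ * nested 0 (rep 2 d) m + nested 0 (rep 2 (d + 1)) (m + 1) :=
    fun d m => nested_cons_succ 0 2 (admissible_replicate (d + 1)) m
  have limX : ∀ n, Filter.Tendsto (fun m => ∑ x ∈ Finset.HasAntidiagonal.antidiagonal n,
      nested 0 (rep 2 x.1 ++ [3] ++ rep 2 x.2) m) Filter.atTop (nhds 0) := by
    intro n
    have := tendsto_finsetSum (Finset.HasAntidiagonal.antidiagonal n)
      (f := fun (x : ℕ × ℕ) m => nested 0 (rep 2 x.1 ++ [3] ++ rep 2 x.2) m)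
      (a := fun _ => (0:ℝ)) (x := Filter.atTop) (fun x _ => by
        obtain ⟨a, b⟩ := x
        cases a with
        | zero => exact tendsto_nested_cons 0 3 (adm 0 b)
        | succ a => exact tendsto_nested_cons 0 2 (adm (a + 1) b))
    simpa using this
  have limY : ∀ n, Filter.Tendsto (fun m => ∑ x ∈ Finset.HasAntidiagonal.antidiagonal n,
      nested 0 [2 * x.1 + 3] m * nested 0 (rep 2 x.2) m) Filter.atTop (nhds 0) := by
    intro n
    have := tendsto_finsetSum (Finset.HasAntidiagonal.antidiagonal n)
      (f := fun (x : ℕ × ℕ) m => nested 0 [2 * x.1 + 3] m * nested 0 (rep 2 x.2) m)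
      (a := fun _ => (0:ℝ)) (x := Filter.atTop) (fun x _ => by
        have h1 := (tendsto_nested_cons 0 (2 * x.1 + 3) (s := [])
          (admissible_of_two_le (by simp))).mul_const (nested 0 (rep 2 x.2) 0)
        rw [zero_mul] at h1
        refine squeeze_zero (fun m => mul_nonneg (nested_nonneg _ _ _) (nested_nonneg _ _ _))
          (fun m => ?_) h1
        exact mul_le_mul_of_nonneg_left (nested_anti 0 (admissible_replicate _) (Nat.zero_le m))
          (nested_nonneg _ _ _))
    simpa using this
  -- Two sequences with equal first differences and limit zero coincide. It is applied to both sides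
  -- as functions of `m`; the differences agree by induction on `n`.
  have eq_of_step : ∀ f g : ℕ → ℝ, (∀ m, f m + g (m + 1) = g m + f (m + 1)) →
      Filter.Tendsto f Filter.atTop (nhds 0) → Filter.Tendsto g Filter.atTop (nhds 0) →
      ∀ m, f m = g m := by
    intro f g hf h1 h2 m
    have h0 : ∀ m, f m - g m = f 0 - g 0 := fun m => by
      induction m with
      | zero => rfl
      | succ m ih => linarith [hf m]
    have h3 := h1.sub h2
    have h4 := tendsto_nhds_unique h3 (tendsto_const_nhds.congr fun m => (h0 m).symm)
    linarith [h0 m]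
  induction n generalizing m with
  | zero =>
    refine eq_of_step _ _ (fun m => ?_) (limX 0) (limY 0) m
    simp only [Finset.HasAntidiagonal.antidiagonal_zero, Finset.sum_singleton]
    rw [hX0, hZ 0 m]
    simp only [List.replicate_zero, nested_nil]
    ring
  | succ n ih =>
    refine eq_of_step _ _ (fun m => ?_) (limX (n + 1)) (limY (n + 1)) m
    have e1 : ∑ x ∈ Finset.HasAntidiagonal.antidiagonal (n + 1),
        nested 0 (rep 2 x.1 ++ [3] ++ rep 2 x.2) m
        = (((m + 1 : ℕ) : ℝ) ^ 3)⁻¹ * nested 0 (rep 2 (n + 1)) m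
          + (((m + 1 : ℕ) : ℝ) ^ 2)⁻¹ * ∑ x ∈ Finset.HasAntidiagonal.antidiagonal n,
              nested 0 (rep 2 x.1 ++ [3] ++ rep 2 x.2) m
          + ∑ x ∈ Finset.HasAntidiagonal.antidiagonal (n + 1),
              nested 0 (rep 2 x.1 ++ [3] ++ rep 2 x.2) (m + 1) := by
      rw [Finset.Nat.sum_antidiagonal_succ, Finset.Nat.sum_antidiagonal_succ, hX0, Finset.mul_sum]
      simp only [fun a b => hXs a b m, Finset.sum_add_distrib]
      ring
    have e2 : ∑ x ∈ Finset.HasAntidiagonal.antidiagonal (n + 1),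
        nested 0 [2 * x.1 + 3] m * nested 0 (rep 2 x.2) m
        = (((m + 1 : ℕ) : ℝ) ^ 3)⁻¹ * nested 0 (rep 2 (n + 1)) m
          + (((m + 1 : ℕ) : ℝ) ^ 2)⁻¹ * ∑ x ∈ Finset.HasAntidiagonal.antidiagonal n,
              nested 0 [2 * x.1 + 3] m * nested 0 (rep 2 x.2) m
          + ∑ x ∈ Finset.HasAntidiagonal.antidiagonal (n + 1),
              nested 0 [2 * x.1 + 3] (m + 1) * nested 0 (rep 2 x.2) (m + 1) := by
      -- Discrete Leibniz rule: the first factor is moved from `m` to `m + 1` here, the second one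
      -- in `a3`.
      have a1 : ∀ x : ℕ × ℕ, nested 0 [2 * x.1 + 3] m * nested 0 (rep 2 x.2) m
          = (((m + 1 : ℕ) : ℝ) ^ (2 * x.1 + 3))⁻¹ * nested 0 (rep 2 x.2) m
            + nested 0 [2 * x.1 + 3] (m + 1) * nested 0 (rep 2 x.2) m := fun x => by
        rw [hZ x.1 m]; ring
      have a2 : ∑ x ∈ Finset.HasAntidiagonal.antidiagonal (n + 1),
          (((m + 1 : ℕ) : ℝ) ^ (2 * x.1 + 3))⁻¹ * nested 0 (rep 2 x.2) m
          = (((m + 1 : ℕ) : ℝ) ^ 3)⁻¹ * nested 0 (rep 2 (n + 1)) m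
            + (((m + 1 : ℕ) : ℝ) ^ 2)⁻¹ * ∑ x ∈ Finset.HasAntidiagonal.antidiagonal n,
              (((m + 1 : ℕ) : ℝ) ^ (2 * x.1 + 3))⁻¹ * nested 0 (rep 2 x.2) m := by
        rw [Finset.Nat.sum_antidiagonal_succ, Finset.mul_sum]
        congr 1
        refine Finset.sum_congr rfl fun x _ => ?_
        rw [show 2 * (x.1 + 1) + 3 = 2 + (2 * x.1 + 3) by ring, pow_add, mul_inv, mul_assoc]
      have a3 : ∑ x ∈ Finset.HasAntidiagonal.antidiagonal (n + 1),
          nested 0 [2 * x.1 + 3] (m + 1) * nested 0 (rep 2 x.2) m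
          = (((m + 1 : ℕ) : ℝ) ^ 2)⁻¹ * ∑ x ∈ Finset.HasAntidiagonal.antidiagonal n,
              nested 0 [2 * x.1 + 3] (m + 1) * nested 0 (rep 2 x.2) m
            + ∑ x ∈ Finset.HasAntidiagonal.antidiagonal (n + 1),
              nested 0 [2 * x.1 + 3] (m + 1) * nested 0 (rep 2 x.2) (m + 1) := by
        rw [Finset.Nat.sum_antidiagonal_succ', Finset.Nat.sum_antidiagonal_succ', Finset.mul_sum]
        simp only [fun d => hH d m, List.replicate_zero, nested_nil, mul_add, Finset.sum_add_distrib]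
        have : ∀ x : ℕ × ℕ, nested 0 [2 * x.1 + 3] (m + 1) *
            ((((m + 1 : ℕ) : ℝ) ^ 2)⁻¹ * nested 0 (rep 2 x.2) m) = (((m + 1 : ℕ) : ℝ) ^ 2)⁻¹ *
            (nested 0 [2 * x.1 + 3] (m + 1) * nested 0 (rep 2 x.2) m) := fun x => by ring
        simp only [this]
        ring
      simp only [a1, Finset.sum_add_distrib]
      rw [a2, a3]
      ring
    rw [e1, e2, ih]
    ring

/-! ### Values at ({1}^p, q + 2) and elementary symmetric sums -/

/-- The elementary symmetric polynomial of degree `p` in `1 / (m + 1), …, 1 / (m + k)`. -/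
def esymmInv : ℕ → ℕ → ℕ → ℝ
  | 0, _, _ => 1
  | _ + 1, _, 0 => 0
  | p + 1, m, k + 1 => ∑ x ∈ Finset.HasAntidiagonal.antidiagonal k,
      (((m + 1 + x.1 : ℕ) : ℝ))⁻¹ * esymmInv p (m + x.1 + 1) x.2

theorem esymmInv_nonneg (p m k : ℕ) : 0 ≤ esymmInv p m k := by
  induction p generalizing m k with
  | zero => simp [esymmInv]
  | succ p ih =>
    cases k with
    | zero => simp [esymmInv]
    | succ k =>
      rw [esymmInv]
      exact Finset.sum_nonneg fun x _ => mul_nonneg (by positivity) (ih _ _)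

/-- Fixing the largest entry instead of the smallest one leaves an elementary symmetric sum of
reciprocals. The induction on `p` regroups a nonnegative double series along antidiagonals. -/
theorem hasSum_nested_concat (a p m : ℕ) :
    HasSum (fun k : ℕ => (((m + 1 + k : ℕ) : ℝ) ^ (a + 2))⁻¹ * esymmInv p m k)
      (nested 1 (rep 1 p ++ [a + 2]) m) := by
  induction p generalizing m with
  | zero => simpa [esymmInv] using hasSum_nested_single 1 a m
  | succ p ih =>
    have h := hasSum_nested_cons 1 1 (s := rep 1 p ++ [a + 2])
      (admissible_concat (p := p + 1) (by omega)) m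
    have hk : ∀ k, HasSum (fun l : ℕ => (((m + 1 + k : ℕ) : ℝ) ^ 1)⁻¹ *
        ((((m + k + 1 + 1 + l : ℕ) : ℝ) ^ (a + 2))⁻¹ * esymmInv p (m + k + 1) l))
        ((((m + 1 + k : ℕ) : ℝ) ^ 1)⁻¹ * nested 1 (rep 1 p ++ [a + 2]) (m + k + 1)) :=
      fun k => (ih (m + k + 1)).mul_left _
    have hs : Summable (fun x : ℕ × ℕ => (((m + 1 + x.1 : ℕ) : ℝ) ^ 1)⁻¹ *
        ((((m + x.1 + 1 + 1 + x.2 : ℕ) : ℝ) ^ (a + 2))⁻¹ * esymmInv p (m + x.1 + 1) x.2)) := by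
      refine (summable_prod_of_nonneg fun x => ?_).2 ⟨fun k => (hk k).summable, ?_⟩
      · have := esymmInv_nonneg p (m + x.1 + 1) x.2
        simp only [Pi.zero_apply]
        positivity
      · simp only [(hk _).tsum_eq]
        exact h.summable
    have h2 := hs.hasSum
    have e := h2.prod_fiberwise hk
    rw [e.unique h] at h2
    have h3 := h2.antidiagonal
    rw [show rep 1 (p + 1) ++ [a + 2] = 1 :: (rep 1 p ++ [a + 2]) from rfl]
    refine (hasSum_nat_add_iff' 1).1 ?_
    simp only [Finset.range_one, Finset.sum_singleton, esymmInv, mul_zero, sub_zero]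
    refine HasSum.congr_fun h3 fun n => ?_
    rw [Finset.mul_sum]
    refine Finset.sum_congr rfl fun x hx => ?_
    have := Finset.HasAntidiagonal.mem_antidiagonal.1 hx
    rw [show m + x.1 + 1 + 1 + x.2 = m + 1 + (n + 1) by omega, pow_one]
    ring

theorem esymmInv_succ_succ (p m k : ℕ) : esymmInv (p + 1) m (k + 1) =
    (((m + 1 : ℕ) : ℝ))⁻¹ * esymmInv p (m + 1) k + esymmInv (p + 1) (m + 1) k := by
  cases k with
  | zero => simp [esymmInv]
  | succ k =>
    rw [esymmInv, Finset.Nat.sum_antidiagonal_succ, esymmInv]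
    simp only [add_zero]
    congr 1
    refine Finset.sum_congr rfl fun x _ => ?_
    rw [show m + 1 + (x.1 + 1) = m + 1 + 1 + x.1 by ring, show m + (x.1 + 1) + 1 = m + 1 + x.1 + 1 by ring]

theorem esymmInv_eq_zero {p m k : ℕ} (h : k < p) : esymmInv p m k = 0 := by
  induction k generalizing p m with
  | zero => obtain ⟨p, rfl⟩ := Nat.exists_eq_succ_of_ne_zero (by omega : p ≠ 0); rfl
  | succ k ih =>
    obtain ⟨p, rfl⟩ := Nat.exists_eq_succ_of_ne_zero (by omega : p ≠ 0)
    rw [esymmInv_succ_succ, ih (by omega), ih (by omega)]; simp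

/-- Summed over `p`, the recursion `esymmInv_succ_succ` is multiplication by `1 + u / (m + 1)`. -/
theorem hasSum_esymmInv (u : ℝ) (m k : ℕ) :
    HasSum (fun p => esymmInv p m k * u ^ p)
      (∏ i ∈ Finset.range k, (1 + u / ((m + 1 + i : ℕ) : ℝ))) := by
  induction k generalizing m with
  | zero =>
    have := hasSum_single (f := fun p => esymmInv p m 0 * u ^ p) 0
      (fun p hp => by rw [esymmInv_eq_zero (Nat.pos_of_ne_zero hp), zero_mul])
    simpa [esymmInv] using this
  | succ k ih =>
    rw [Finset.prod_range_succ']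
    have h1 := (ih (m + 1)).mul_left (u / ((m + 1 : ℕ) : ℝ))
    have h2 := (hasSum_nat_add_iff' 1).2 (ih (m + 1))
    have h3 := h1.add h2
    refine (hasSum_nat_add_iff' 1).1 ?_
    have e : ∏ i ∈ Finset.range k, (1 + u / ((m + 1 + (i + 1) : ℕ) : ℝ))
        = ∏ i ∈ Finset.range k, (1 + u / ((m + 1 + 1 + i : ℕ) : ℝ)) :=
      Finset.prod_congr rfl fun i _ => by rw [show m + 1 + (i + 1) = m + 1 + 1 + i by ring]
    rw [e]
    refine h3.replace (fun p => by rw [esymmInv_succ_succ, pow_succ]; ring) ?_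
    simp only [Finset.range_one, Finset.sum_singleton, esymmInv, add_zero]
    ring

theorem sum_antidiagonalTuple_succ {M : Type*} [AddCommMonoid M] (j n : ℕ)
    (f : (Fin (j + 1) → ℕ) → M) :
    ∑ c ∈ Finset.Nat.antidiagonalTuple (j + 1) n, f c =
      ∑ x ∈ Finset.HasAntidiagonal.antidiagonal n,
        ∑ c ∈ Finset.Nat.antidiagonalTuple j x.2, f (Fin.cons x.1 c) := by
  rw [Finset.sum_sigma']
  refine Finset.sum_bij' (fun c _ => ⟨(c 0, ∑ i, c (Fin.succ i)), fun i => c i.succ⟩)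
    (fun y _ => Fin.cons y.1.1 y.2) ?_ ?_ ?_ ?_ ?_
  · intro c hc
    simp only [Finset.mem_sigma, Finset.HasAntidiagonal.mem_antidiagonal,
      Finset.Nat.mem_antidiagonalTuple, and_true]
    rw [← Fin.sum_univ_succ]
    exact Finset.Nat.mem_antidiagonalTuple.1 hc
  · rintro ⟨⟨a, b⟩, c⟩ hy
    simp only [Finset.mem_sigma, Finset.HasAntidiagonal.mem_antidiagonal,
      Finset.Nat.mem_antidiagonalTuple] at hy ⊢
    rw [Fin.sum_univ_succ]
    simp only [Fin.cons_zero, Fin.cons_succ]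
    rw [hy.2, hy.1]
  · intro c hc
    exact Fin.cons_self_tail c
  · rintro ⟨⟨a, b⟩, c⟩ hy
    simp only [Finset.mem_sigma, Finset.HasAntidiagonal.mem_antidiagonal,
      Finset.Nat.mem_antidiagonalTuple] at hy
    obtain ⟨h1, rfl⟩ := hy
    simp
  · intro c hc
    exact congrArg f (Fin.cons_self_tail c).symm

/-! ### Generating functions of ζ⋆({2}^n) and ζ⋆(4, {2}^n) -/

/-- The crude bound ζ(2) ≤ 2 behind the ranges `|x| ≤ 1 / 2` and `|x| < 1 / 8` used below. -/
theorem nested_two_le (m : ℕ) : nested 1 [2] m ≤ 2 := by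
  refine (nested_anti 1 (admissible_of_two_le (by simp)) (Nat.zero_le m)).trans ?_
  have h1 := hasSum_nested_single 1 0 0
  have h2 := (hasSum_nat_add_iff' 1).2 hasSum_zeta_two
  have h3 : nested 1 [0 + 2] 0 = Real.pi ^ 2 / 6 - ∑ i ∈ Finset.range 1, 1 / ((i : ℕ) : ℝ) ^ 2 := by
    refine h1.unique (h2.replace (fun k => ?_) rfl)
    rw [one_div]; congr 3; omega
  rw [show [2] = [0 + 2] from rfl, h3]
  have := Real.pi_lt_d2
  have := Real.pi_pos
  simp
  nlinarith

theorem nested_two_nonneg (m : ℕ) : 0 ≤ nested 1 [2] m := nested_nonneg _ _ _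

theorem tendsto_nested_two : Filter.Tendsto (fun m => nested 1 [2] m) Filter.atTop (nhds 0) :=
  tendsto_nested_cons 1 2 (admissible_of_two_le (by simp))

/-- The series is dominated by a geometric one with ratio `1 / 2`, uniformly in `m`; as `b m → 0`
only the term `j = 0` survives. This replaces the theory of infinite products for `starGen` and
`shiftGen`. -/
theorem tendsto_generating {g : ℕ → ℕ → ℝ} {b : ℕ → ℝ} {y : ℝ} (h0 : ∀ m, g 0 m = 1)
    (hb : ∀ j m, |g j m| ≤ b m ^ j) (hb0 : ∀ m, 0 ≤ b m) (hy : ∀ m, |y| * b m ≤ 1 / 2)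
    (hl : Filter.Tendsto b Filter.atTop (nhds 0)) :
    (∀ m, Summable (fun j => |y ^ j * g j m|)) ∧ (∀ m, |∑' j, y ^ j * g j m| ≤ 2) ∧
      Filter.Tendsto (fun m => ∑' j, y ^ j * g j m) Filter.atTop (nhds 1) := by
  have hbd : ∀ m j, |y ^ j * g j m| ≤ (1 / 2) ^ j := fun m j => by
    rw [abs_mul, abs_pow]
    calc |y| ^ j * |g j m| ≤ |y| ^ j * b m ^ j := by gcongr; exact hb j m
      _ = (|y| * b m) ^ j := (mul_pow _ _ _).symm
      _ ≤ _ := pow_le_pow_left₀ (mul_nonneg (abs_nonneg _) (hb0 m)) (hy m) j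
  have hg : Summable (fun j : ℕ => (1 / 2 : ℝ) ^ j) :=
    summable_geometric_of_lt_one (by norm_num) (by norm_num)
  have hS : ∀ m, Summable (fun j => |y ^ j * g j m|) := fun m =>
    Summable.of_nonneg_of_le (fun _ => abs_nonneg _) (hbd m) hg
  refine ⟨hS, fun m => ?_, ?_⟩
  · refine (abs_tsum_le (hS m)).trans ?_
    rw [← tsum_geometric_two]
    exact (hS m).tsum_le_tsum (hbd m) hg
  · have := tendsto_tsum_of_dominated_convergence (𝓕 := Filter.atTop)
      (f := fun m j => y ^ j * g j m) (g := fun j => if j = 0 then (1:ℝ) else 0) hg (fun j => ?_)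
      (Filter.Eventually.of_forall fun m j => hbd m j)
    · simpa using this
    · rcases j with _ | j
      · simp [h0]
      · rw [if_neg (by omega)]
        have h1 : Filter.Tendsto (fun m => |y| ^ (j + 1) * b m ^ (j + 1)) Filter.atTop (nhds 0) := by
          simpa using (hl.pow (j + 1)).const_mul (|y| ^ (j + 1))
        refine squeeze_zero_norm (fun m => ?_) h1
        rw [Real.norm_eq_abs, abs_mul, abs_pow]
        gcongr
        exact hb _ m

theorem abs_nested_replicate_le (n m : ℕ) :
    |nested 0 (rep 2 n) m| ≤ nested 1 [2] m ^ n := by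
  rw [abs_of_nonneg (nested_nonneg _ _ _)]
  induction n generalizing m with
  | zero => simp [nested_nil]
  | succ n ih =>
    have h := hasSum_nested_cons 0 2 (admissible_replicate (n + 1)) m
    have h2 := (hasSum_nested_single 1 0 m).mul_right (nested 1 [2] m ^ n)
    rw [pow_succ']
    refine hasSum_le (fun k => ?_) h h2
    refine mul_le_mul_of_nonneg_left ?_ (by positivity)
    refine (ih _).trans (pow_le_pow_left₀ (nested_two_nonneg _) ?_ n)
    exact nested_anti 1 (admissible_of_two_le (by simp)) (by omega)

/-- The generating function `∏_{k > m} (1 - x² / k²)⁻¹` of the tails of `ζ⋆({2}^n)`. -/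
def starGen (m : ℕ) (x : ℝ) : ℝ := ∑' n, (x ^ 2) ^ n * nested 0 (rep 2 n) m

theorem starGen_aux {x : ℝ} (hx : |x| ≤ 1 / 2) :
    (∀ m, Summable (fun j => |(x ^ 2) ^ j * nested 0 (rep 2 j) m|)) ∧
    (∀ m, |starGen m x| ≤ 2) ∧
      Filter.Tendsto (fun m => starGen m x) Filter.atTop (nhds 1) := by
  refine tendsto_generating (g := fun j m => nested 0 (rep 2 j) m) (b := fun m => nested 1 [2] m)
    (fun m => nested_nil 0 m) abs_nested_replicate_le nested_two_nonneg (fun m => ?_)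
    tendsto_nested_two
  rw [abs_pow]
  have h1 : |x| ^ 2 ≤ 1 / 4 := by nlinarith [abs_nonneg x]
  nlinarith [nested_two_le m, nested_two_nonneg m, abs_nonneg x]

/-- The difference equation of the tails, summed against powers of `x ^ 2`, says that the Euler
factor of `m + 1` can be removed. -/
theorem starGen_succ {x : ℝ} (hx : |x| ≤ 1 / 2) (m : ℕ) :
    (1 - x ^ 2 / ((m + 1 : ℕ) : ℝ) ^ 2) * starGen m x = starGen (m + 1) x := by
  have h1 := ((starGen_aux hx).1 m).of_abs
  have h2 := ((starGen_aux hx).1 (m + 1)).of_abs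
  have e : starGen m x = starGen (m + 1) x + x ^ 2 / ((m + 1 : ℕ) : ℝ) ^ 2 * starGen m x := by
    have hH : ∀ d, nested 0 (rep 2 (d + 1)) m =
      (((m + 1 : ℕ) : ℝ) ^ 2)⁻¹ * nested 0 (rep 2 d) m + nested 0 (rep 2 (d + 1)) (m + 1) :=
      fun d => nested_cons_succ 0 2 (admissible_replicate (d + 1)) m
    have h3 := (summable_nat_add_iff 1).2 h2
    conv_lhs => rw [starGen, h1.tsum_eq_zero_add]
    conv_rhs => rw [starGen, h2.tsum_eq_zero_add, starGen, ← tsum_mul_left]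
    rw [add_assoc, ← h3.tsum_add (h1.mul_left _)]
    congr 1
    refine tsum_congr fun n => ?_
    rw [hH, pow_succ]
    ring
  linarith

theorem one_le_starGen {x : ℝ} (hx : |x| ≤ 1 / 2) (m : ℕ) : 1 ≤ starGen m x := by
  have := ((starGen_aux hx).1 m).of_abs.le_tsum 0
    (fun n _ => mul_nonneg (by positivity) (nested_nonneg _ _ _))
  simp only [pow_zero, List.replicate_zero, nested_nil, mul_one] at this
  exact this

theorem prod_mul_starGen {x : ℝ} (hx : |x| ≤ 1 / 2) (m N : ℕ) :
    (∏ i ∈ Finset.range N, (1 - x ^ 2 / ((m + i + 1 : ℕ) : ℝ) ^ 2)) * starGen m x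
      = starGen (m + N) x := by
  induction N with
  | zero => simp
  | succ N ih =>
    rw [Finset.prod_range_succ, mul_right_comm, ih, mul_comm, starGen_succ hx]; rfl

theorem SeriesRep.tsum_of_nonneg {ι : Type*} {r : ℝ} {c : ι → ℕ → ℝ} {g : ι → ℝ → ℝ}
    (h : ∀ m, SeriesRep r (c m) (g m)) (hc : ∀ m n, 0 ≤ c m n)
    (hs : ∀ x, 0 ≤ x → x < r → Summable (fun m => g m x)) :
    SeriesRep r (fun n => ∑' m, c m n) (fun x => ∑' m, g m x) := by
  refine SeriesRep.tsum h fun x h0 hx => (hs x h0 hx).congr fun m => ?_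
  rw [← (h m x (by rwa [abs_of_nonneg h0])).2.tsum_eq]
  exact tsum_congr fun n => by rw [abs_of_nonneg (hc m n)]

theorem SeriesRep.const_mul {r : ℝ} {c : ℕ → ℝ} {g : ℝ → ℝ} (h : SeriesRep r c g) (a : ℝ) :
    SeriesRep r (fun n => a * c n) (fun x => a * g x) := fun x hx =>
  ⟨((h x hx).1.mul_left |a|).congr fun n => by rw [abs_mul, mul_assoc],
    ((h x hx).2.mul_left a).replace (fun n => by ring) rfl⟩

theorem seriesRep_starGen (m : ℕ) : SeriesRep (1 / 4) (fun n => nested 0 (rep 2 n) m)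
    (fun t => ∑' n, t ^ n * nested 0 (rep 2 n) m) := by
  have key : ∀ t, |t| < 1 / 4 → Summable (fun n => |nested 0 (rep 2 n) m| * |t| ^ n) := by
    intro t ht
    have h1 : |(Real.sqrt (|t|))| ≤ 1 / 2 := by
      rw [abs_of_nonneg (Real.sqrt_nonneg _)]
      exact Real.sqrt_le_iff.2 ⟨by norm_num, by linarith⟩
    refine ((starGen_aux h1).1 m).congr fun n => ?_
    rw [Real.sq_sqrt (abs_nonneg t), abs_mul, abs_pow, abs_abs, mul_comm]
  intro t ht
  refine ⟨key t ht, ?_⟩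
  have : Summable (fun n => t ^ n * nested 0 (rep 2 n) m) :=
    ((key t ht).congr fun n => by rw [abs_mul, abs_pow, mul_comm]).of_abs
  exact this.hasSum.replace (fun n => mul_comm _ _) rfl

theorem SeriesRep.evenRep {r ρ : ℝ} (hρ : ρ ^ 2 ≤ r) {c : ℕ → ℝ} {g : ℝ → ℝ}
    (h : SeriesRep r c g) : EvenRep ρ (PowerSeries.mk c) (fun x => g (x ^ 2)) := by
  intro x h0 hx
  have h1 : |x ^ 2| < r := by
    rw [abs_of_nonneg (by positivity)]
    exact (pow_lt_pow_left₀ hx h0.le (by norm_num)).trans_le hρ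
  have := h _ h1
  simpa using this

theorem evenRep_starGen :
    EvenRep (1 / 8) (PowerSeries.mk fun n => mzvStar (rep 2 n)) (fun x => starGen 0 x) := by
  simp only [mzvStar_eq_nested]
  exact (seriesRep_starGen 0).evenRep (by norm_num)

theorem summable_inv_sq : Summable (fun k : ℕ => (((k + 1 : ℕ) : ℝ) ^ 2)⁻¹) :=
  (hasSum_nested_single 1 0 0).summable.congr fun k => by
    rw [show 0 + 1 + k = k + 1 by ring]

/-- The generating function of `ζ⋆(4, {2}^n)`. -/
theorem evenRep_four : EvenRep (1 / 8) (PowerSeries.mk fun n => mzvStar ([4] ++ rep 2 n))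
    (fun x => ∑' k : ℕ, (((k + 1 : ℕ) : ℝ) ^ 4)⁻¹ * starGen k x) := by
  have key : ∀ n, nested 0 ([4] ++ rep 2 n) 0
      = ∑' k : ℕ, (((k + 1 : ℕ) : ℝ) ^ 4)⁻¹ * nested 0 (rep 2 n) k := fun n => by
    have := hasSum_nested_cons 0 4 (s := rep 2 n) (admissible_of_two_le (by
      intro a ha
      simp at ha
      omega)) 0
    rw [List.singleton_append, ← this.tsum_eq]
    refine tsum_congr fun k => ?_
    rw [show 0 + 1 + k = k + 1 by ring, show 0 + k + 0 = k by ring]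
  have h := SeriesRep.tsum_of_nonneg
    (fun k : ℕ => (seriesRep_starGen k).const_mul (((k + 1 : ℕ) : ℝ) ^ 4)⁻¹)
    (fun k n => mul_nonneg (by positivity) (nested_nonneg _ _ _)) (fun t h0 ht => ?_)
  · convert h.evenRep (ρ := 1 / 8) (by norm_num) using 1
    · congr 1
      funext n
      rw [mzvStar_eq_nested]
      exact key n
    · rfl
  · refine Summable.of_nonneg_of_le (fun k => mul_nonneg (by positivity)
      (tsum_nonneg fun n => mul_nonneg (by positivity) (nested_nonneg _ _ _))) (fun k => ?_)
      (summable_inv_sq.mul_right 2)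
    -- The bound for `starGen` is stated in `x`, so it is applied at `x = √t`.
    have h1 : |Real.sqrt t| ≤ 1 / 2 := by
      rw [abs_of_nonneg (Real.sqrt_nonneg _)]
      exact Real.sqrt_le_iff.2 ⟨by norm_num, by linarith⟩
    have h2 := le_of_abs_le ((starGen_aux h1).2.1 k)
    rw [starGen, Real.sq_sqrt h0] at h2
    have h3 : (1:ℝ) ≤ ((k + 1 : ℕ) : ℝ) := by push_cast; linarith [Nat.cast_nonneg (α := ℝ) k]
    have h4 : (((k + 1 : ℕ) : ℝ) ^ 4)⁻¹ ≤ (((k + 1 : ℕ) : ℝ) ^ 2)⁻¹ :=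
      inv_anti₀ (by positivity) (pow_le_pow_right₀ h3 (by norm_num))
    exact mul_le_mul h4 h2 (tsum_nonneg fun n => mul_nonneg (by positivity) (nested_nonneg _ _ _))
      (by positivity)

/-! ### The alternating sums over c_j -/

theorem seriesRep_inv_pow (k : ℕ) {N : ℝ} (hN : 1 ≤ N) :
    SeriesRep 1 (fun n => ((n + k).choose k : ℝ) * (N ^ (n + k + 1))⁻¹)
      (fun x => ((N - x) ^ (k + 1))⁻¹) := by
  have hN0 : 0 < N := by linarith
  have key : ∀ x : ℝ, |x| < 1 → HasSum (fun n => ((n + k).choose k : ℝ) * (N ^ (n + k + 1))⁻¹ * x ^ n)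
      ((N - x) ^ (k + 1))⁻¹ := by
    intro x hx
    have h1 : ‖x / N‖ < 1 := by
      rw [norm_div, Real.norm_eq_abs, Real.norm_eq_abs, abs_of_pos hN0, div_lt_one hN0]
      linarith
    have hne : N - x ≠ 0 := by
      have := (abs_lt.1 hx).2
      linarith
    refine ((hasSum_choose_mul_geometric_of_norm_lt_one k h1).mul_right (N ^ (k + 1))⁻¹).replace
      (fun n => ?_) ?_
    · rw [div_pow, add_assoc, pow_add]
      field_simp
    · rw [one_div, ← mul_inv, ← mul_pow]
      congr 2
      field_simp
  intro x hx
  refine ⟨?_, key x hx⟩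
  refine (key |x| (by rwa [abs_abs])).summable.congr fun n => ?_
  have h0 : 0 ≤ ((n + k).choose k : ℝ) * (N ^ (n + k + 1))⁻¹ := by positivity
  dsimp only
  rw [abs_of_nonneg h0]

/-- The symmetric functions of degree `j` in the numbers `(k - x)⁻²` for `k > m`. -/
def eTail : ℕ → ℕ → ℝ → ℝ
  | 0, _, _ => 1
  | j + 1, m, x => ∑' k : ℕ, ((((m + 1 + k : ℕ) : ℝ) - x) ^ 2)⁻¹ * eTail j (m + k + 1) x

theorem eTail_nonneg (j m : ℕ) (x : ℝ) : 0 ≤ eTail j m x := by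
  induction j generalizing m with
  | zero => simp [eTail]
  | succ j ih => exact tsum_nonneg fun k => mul_nonneg (by positivity) (ih _)

theorem half_le_sub {x : ℝ} (hx : |x| < 1 / 8) {N : ℝ} (hN : 1 ≤ N) : N / 2 ≤ N - x := by
  have := (abs_lt.1 hx).2
  linarith

theorem inv_sub_sq_le {x : ℝ} (hx : |x| < 1 / 8) {N : ℝ} (hN : 1 ≤ N) :
    ((N - x) ^ 2)⁻¹ ≤ 4 * (N ^ 2)⁻¹ := by
  have h := half_le_sub hx hN
  have : (N / 2) ^ 2 ≤ (N - x) ^ 2 := pow_le_pow_left₀ (by linarith) h 2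
  calc _ ≤ ((N / 2) ^ 2)⁻¹ := inv_anti₀ (by positivity) this
    _ = _ := by rw [div_pow, inv_div]; ring

/-- The factor 4 comes from `N - x ≥ N / 2`; the `j`-fold nested sum is then at most the `j`-th
power of the simple one. -/
theorem eTail_aux {x : ℝ} (hx : |x| < 1 / 8) (j : ℕ) : ∀ m,
    eTail j m x ≤ (4 * nested 1 [2] m) ^ j ∧
    Summable (fun k : ℕ => ((((m + 1 + k : ℕ) : ℝ) - x) ^ 2)⁻¹ * eTail j (m + k + 1) x) := by
  have step : ∀ j m, (∀ m, eTail j m x ≤ (4 * nested 1 [2] m) ^ j) → ∀ k : ℕ,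
      ((((m + 1 + k : ℕ) : ℝ) - x) ^ 2)⁻¹ * eTail j (m + k + 1) x
        ≤ (((m + 1 + k : ℕ) : ℝ) ^ 2)⁻¹ * (4 * (4 * nested 1 [2] m) ^ j) := by
    intro j m ih k
    have h1 : (1:ℝ) ≤ ((m + 1 + k : ℕ) : ℝ) := by exact_mod_cast (by omega)
    calc _ ≤ (4 * (((m + 1 + k : ℕ) : ℝ) ^ 2)⁻¹) * (4 * nested 1 [2] m) ^ j := by
          refine mul_le_mul (inv_sub_sq_le hx h1) ((ih _).trans ?_) (eTail_nonneg _ _ _)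
            (by positivity)
          refine pow_le_pow_left₀ (mul_nonneg (by norm_num) (nested_two_nonneg _)) ?_ j
          have := nested_anti 1 (s := [2]) (admissible_of_two_le (by simp))
            (show m ≤ m + k + 1 by omega)
          linarith
      _ = _ := by ring
  have summ : ∀ j m, (∀ m, eTail j m x ≤ (4 * nested 1 [2] m) ^ j) →
      Summable (fun k : ℕ => ((((m + 1 + k : ℕ) : ℝ) - x) ^ 2)⁻¹ * eTail j (m + k + 1) x) :=
    fun j m ih => Summable.of_nonneg_of_le
      (fun k => mul_nonneg (by positivity) (eTail_nonneg _ _ _)) (step j m ih)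
      ((hasSum_nested_single 1 0 m).summable.mul_right _)
  have bd : ∀ j m, eTail j m x ≤ (4 * nested 1 [2] m) ^ j := by
    intro j
    induction j with
    | zero => simp [eTail]
    | succ j ih =>
      intro m
      have := hasSum_le (step j m ih) (summ j m ih).hasSum
        ((hasSum_nested_single 1 0 m).mul_right (4 * (4 * nested 1 [2] m) ^ j))
      refine this.trans (le_of_eq ?_)
      rw [zero_add, pow_succ]
      ring
  exact fun m => ⟨bd j m, summ j m (bd j)⟩

theorem eTail_succ {x : ℝ} (hx : |x| < 1 / 8) (j m : ℕ) :
    eTail (j + 1) m x = ((((m + 1 : ℕ) : ℝ) - x) ^ 2)⁻¹ * eTail j (m + 1) x +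
      eTail (j + 1) (m + 1) x := by
  conv_lhs => rw [eTail, ((eTail_aux hx j m).2).tsum_eq_zero_add]
  rw [eTail]
  simp only [add_zero]
  congr 1
  refine tsum_congr fun k => ?_
  rw [show m + 1 + (k + 1) = m + 1 + 1 + k by ring, show m + (k + 1) + 1 = m + 1 + k + 1 by ring]

/-- The product `∏_{k > m} (1 - x² / (k - x)²)`. -/
def shiftGen (m : ℕ) (x : ℝ) : ℝ := ∑' j, (-x ^ 2) ^ j * eTail j m x

theorem shiftGen_aux {x : ℝ} (hx : |x| < 1 / 8) :
    (∀ m, Summable (fun j => |(-x ^ 2) ^ j * eTail j m x|)) ∧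
    (∀ m, |shiftGen m x| ≤ 2) ∧
      Filter.Tendsto (fun m => shiftGen m x) Filter.atTop (nhds 1) := by
  refine tendsto_generating (g := fun j m => eTail j m x) (b := fun m => 4 * nested 1 [2] m)
    (fun m => rfl) (fun j m => ?_) (fun m => mul_nonneg (by norm_num) (nested_two_nonneg m))
    (fun m => ?_) (by simpa using tendsto_nested_two.const_mul 4)
  · rw [abs_of_nonneg (eTail_nonneg _ _ _)]
    exact (eTail_aux hx j m).1
  · rw [abs_neg, abs_pow]
    have h1 : |x| ^ 2 ≤ 1 / 16 := by nlinarith [abs_nonneg x]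
    nlinarith [nested_two_le m, nested_two_nonneg m, abs_nonneg x]

theorem shiftGen_succ {x : ℝ} (hx : |x| < 1 / 8) (m : ℕ) :
    shiftGen m x = (1 - x ^ 2 / (((m + 1 : ℕ) : ℝ) - x) ^ 2) * shiftGen (m + 1) x := by
  have h1 := ((shiftGen_aux hx).1 m).of_abs
  have h2 := ((shiftGen_aux hx).1 (m + 1)).of_abs
  have e : shiftGen m x = shiftGen (m + 1) x +
      -x ^ 2 / (((m + 1 : ℕ) : ℝ) - x) ^ 2 * shiftGen (m + 1) x := by
    have h3 := (summable_nat_add_iff 1).2 h2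
    conv_lhs => rw [shiftGen, h1.tsum_eq_zero_add]
    have e2 : shiftGen (m + 1) x = _ := h2.tsum_eq_zero_add
    conv_rhs => rw [e2, ← e2]
    have e3 : -x ^ 2 / (((m + 1 : ℕ) : ℝ) - x) ^ 2 * shiftGen (m + 1) x =
      ∑' j, -x ^ 2 / (((m + 1 : ℕ) : ℝ) - x) ^ 2 * ((-x ^ 2) ^ j * eTail j (m + 1) x) := by
      rw [tsum_mul_left]; rfl
    rw [e3, e2, add_assoc, ← h3.tsum_add (h2.mul_left _)]
    congr 1
    refine tsum_congr fun n => ?_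
    rw [eTail_succ hx, pow_succ]
    ring
  rw [e]; ring

/-- The coefficients of `eTail j m`. -/
def tailCoeff (j n m : ℕ) : ℝ := ∑ c ∈ Finset.Nat.antidiagonalTuple j n,
  nested 1 (List.ofFn (fun i => c i + 2)) m * ((∏ i, (c i + 1) : ℕ) : ℝ)

theorem tailCoeff_nonneg (j n m : ℕ) : 0 ≤ tailCoeff j n m :=
  Finset.sum_nonneg fun _ _ => mul_nonneg (nested_nonneg _ _ _) (Nat.cast_nonneg _)

/-- The weights `c + 1` are the coefficients in (k - x)⁻² = ∑ (c + 1) k^(-c-2) x^c. -/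
theorem hasSum_tailCoeff (j n m : ℕ) :
    HasSum (fun k : ℕ => ∑ x ∈ Finset.HasAntidiagonal.antidiagonal n,
      (((x.1 + 1).choose 1 : ℝ) * (((m + 1 + k : ℕ) : ℝ) ^ (x.1 + 1 + 1))⁻¹) *
        tailCoeff j x.2 (m + k + 1)) (tailCoeff (j + 1) n m) := by
  rw [tailCoeff, sum_antidiagonalTuple_succ]
  refine hasSum_sum fun x _ => ?_
  simp only [tailCoeff, Finset.mul_sum]
  refine hasSum_sum fun c _ => ?_
  have h := hasSum_nested_cons 1 (x.1 + 2) (s := List.ofFn (fun i => c i + 2))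
    (admissible_of_two_le (by
      intro a ha
      rcases List.mem_cons.1 ha with rfl | ha
      · omega
      · obtain ⟨i, rfl⟩ := List.mem_ofFn.1 ha
        omega)) m
  refine (h.mul_right (((x.1 + 1) * ∏ i, (c i + 1) : ℕ) : ℝ)).replace (fun k => ?_) ?_
  · push_cast [Nat.choose_one_right]
    ring
  · rw [List.ofFn_succ, Fin.prod_univ_succ]
    simp

theorem seriesRep_eTail (j m : ℕ) : SeriesRep (1 / 8) (fun n => tailCoeff j n m) (eTail j m) := by
  induction j generalizing m with
  | zero =>
    have hz : ∀ n, n ≠ 0 → tailCoeff 0 n m = 0 := fun n hn => by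
      obtain ⟨n, rfl⟩ := Nat.exists_eq_succ_of_ne_zero hn
      simp [tailCoeff]
    have h0 : tailCoeff 0 0 m = 1 := by simp [tailCoeff, nested_nil]
    intro x hx
    constructor
    · refine summable_of_ne_finset_zero (s := {0}) fun n hn => ?_
      simp [hz n (by simpa using hn)]
    · have := hasSum_single (f := fun n => tailCoeff 0 n m * x ^ n) 0
        (fun n hn => by rw [hz n hn, zero_mul])
      simpa [h0, eTail] using this
  | succ j ih =>
    have h := SeriesRep.tsum_of_nonneg (fun k : ℕ =>
      ((seriesRep_inv_pow 1 (N := ((m + 1 + k : ℕ) : ℝ))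
        (by exact_mod_cast (by omega))).mono (r' := 1 / 8) (by norm_num)).mul (ih (m + k + 1)))
      (fun k n => Finset.sum_nonneg fun x _ => mul_nonneg (by positivity) (tailCoeff_nonneg _ _ _))
      (fun x h0 hx => (eTail_aux (by rwa [abs_of_nonneg h0]) j m).2)
    convert h using 1
    · funext n
      exact (hasSum_tailCoeff j n m).tsum_eq.symm
    · rfl

/-- The sum over `c` with fixed depth and weight in the theorem. -/
def depthCoeff (j n : ℕ) : ℝ :=
  ∑ c ∈ Finset.Nat.antidiagonalTuple (j + 1) n, mzv (cIndex c) * (cWeight c : ℝ)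

/-- The binomial coefficient comes from (k - x)⁻⁴ = ∑ binom(c + 3, 3) k^(-c-4) x^c, and the extra
factor `k` lowers the first exponent to `c + 3`. -/
theorem hasSum_depthCoeff (j n : ℕ) :
    HasSum (fun k : ℕ => ((k + 1 : ℕ) : ℝ) * ∑ x ∈ Finset.HasAntidiagonal.antidiagonal n,
      (((x.1 + 3).choose 3 : ℝ) * (((k + 1 : ℕ) : ℝ) ^ (x.1 + 3 + 1))⁻¹) *
        tailCoeff j x.2 (k + 1)) (depthCoeff j n) := by
  rw [depthCoeff, sum_antidiagonalTuple_succ]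
  simp only [Finset.mul_sum]
  refine hasSum_sum fun x _ => ?_
  simp only [tailCoeff, Finset.mul_sum]
  refine hasSum_sum fun c _ => ?_
  have h := hasSum_nested_cons 1 (x.1 + 3) (s := List.ofFn (fun i => c i + 2))
    (admissible_of_two_le (by
      intro a ha
      rcases List.mem_cons.1 ha with rfl | ha
      · omega
      · obtain ⟨i, rfl⟩ := List.mem_ofFn.1 ha
        omega)) 0
  refine (h.mul_right (((x.1 + 3).choose 3 * ∏ i, (c i + 1) : ℕ) : ℝ)).replace (fun k => ?_) ?_
  · rw [show 0 + 1 + k = k + 1 by ring, zero_add]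
    have : ((k + 1 : ℕ) : ℝ) ≠ 0 := by positivity
    rw [pow_succ _ (x.1 + 3)]
    push_cast at *
    field_simp
  · rw [mzv_eq_nested]
    simp [cIndex, cWeight]

theorem depth_term_le {x : ℝ} (hx : |x| < 1 / 8) (k : ℕ) :
    ((k + 1 : ℕ) : ℝ) * ((((k + 1 : ℕ) : ℝ) - x) ^ 4)⁻¹ ≤ 16 * (((k + 1 : ℕ) : ℝ) ^ 2)⁻¹ := by
  have h1 : (1:ℝ) ≤ ((k + 1 : ℕ) : ℝ) := by exact_mod_cast (by omega)
  set N : ℝ := ((k + 1 : ℕ) : ℝ)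
  have h := inv_sub_sq_le hx h1
  have h2 : ((N - x) ^ 4)⁻¹ ≤ 16 * (N ^ 4)⁻¹ := by
    calc ((N - x) ^ 4)⁻¹ = (((N - x) ^ 2)⁻¹) ^ 2 := by rw [inv_pow, ← pow_mul]
      _ ≤ (4 * (N ^ 2)⁻¹) ^ 2 := pow_le_pow_left₀ (by positivity) h 2
      _ = _ := by rw [mul_pow, ← inv_pow, ← inv_pow]; ring
  calc N * ((N - x) ^ 4)⁻¹ ≤ N * (16 * (N ^ 4)⁻¹) := by gcongr
    _ = 16 * (N ^ 3)⁻¹ := by field_simp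
    _ ≤ 16 * (N ^ 2)⁻¹ := by
      gcongr 16 * ?_
      exact inv_anti₀ (by positivity) (pow_le_pow_right₀ h1 (by norm_num))

theorem nested_two_mul_le (m : ℕ) : 4 * nested 1 [2] m ≤ 8 := by linarith [nested_two_le m]

theorem depth_term_bound {x : ℝ} (hx : |x| < 1 / 8) (j k : ℕ) :
    ((k + 1 : ℕ) : ℝ) * (((((k + 1 : ℕ) : ℝ) - x) ^ 4)⁻¹ * eTail j (k + 1) x)
      ≤ (16 * 8 ^ j) * (((k + 1 : ℕ) : ℝ) ^ 2)⁻¹ := by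
  rw [← mul_assoc]
  calc _ ≤ (16 * (((k + 1 : ℕ) : ℝ) ^ 2)⁻¹) * 8 ^ j := by
        refine mul_le_mul (depth_term_le hx k) ?_ (eTail_nonneg _ _ _) (by positivity)
        exact (eTail_aux hx j _).1.trans (pow_le_pow_left₀
          (mul_nonneg (by norm_num) (nested_two_nonneg _)) (nested_two_mul_le _) j)
    _ = _ := by ring

/-- The generating function of `depthCoeff j`. -/
def depthGen (j : ℕ) (x : ℝ) : ℝ :=
  ∑' k : ℕ, ((k + 1 : ℕ) : ℝ) * (((((k + 1 : ℕ) : ℝ) - x) ^ 4)⁻¹ * eTail j (k + 1) x)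

theorem summable_depthGen {x : ℝ} (hx : |x| < 1 / 8) (j : ℕ) : Summable (fun k : ℕ =>
    ((k + 1 : ℕ) : ℝ) * (((((k + 1 : ℕ) : ℝ) - x) ^ 4)⁻¹ * eTail j (k + 1) x)) :=
  Summable.of_nonneg_of_le (fun k => mul_nonneg (by positivity) (mul_nonneg
    (by positivity) (eTail_nonneg _ _ _))) (depth_term_bound hx j) (summable_inv_sq.mul_left _)

theorem depthGen_le {x : ℝ} (hx : |x| < 1 / 8) (j : ℕ) : depthGen j x ≤ 32 * 8 ^ j := by
  have h := (summable_depthGen hx j).tsum_le_tsum (depth_term_bound hx j)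
    (summable_inv_sq.mul_left _)
  rw [tsum_mul_left] at h
  have h2 : ∑' k : ℕ, (((k + 1 : ℕ) : ℝ) ^ 2)⁻¹ ≤ 2 := by
    have := nested_two_le 0
    rw [← (hasSum_nested_single 1 0 0).tsum_eq] at this
    simpa [add_comm] using this
  have h3 : (0:ℝ) < 16 * 8 ^ j := by positivity
  calc depthGen j x ≤ _ := h
    _ ≤ (16 * 8 ^ j) * 2 := by gcongr
    _ = _ := by ring

theorem depthGen_nonneg (j : ℕ) (x : ℝ) : 0 ≤ depthGen j x :=
  tsum_nonneg fun k => mul_nonneg (by positivity) (mul_nonneg (by positivity) (eTail_nonneg _ _ _))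

theorem seriesRep_depthGen (j : ℕ) : SeriesRep (1 / 8) (depthCoeff j) (depthGen j) := by
  have h := SeriesRep.tsum_of_nonneg (fun k : ℕ =>
      (((seriesRep_inv_pow 3 (N := ((k + 1 : ℕ) : ℝ))
        (by exact_mod_cast (by omega))).mono (r' := 1 / 8) (by norm_num)).mul
          (seriesRep_eTail j (k + 1))).const_mul ((k + 1 : ℕ) : ℝ))
      (fun k n => mul_nonneg (by positivity) (Finset.sum_nonneg fun x _ =>
        mul_nonneg (by positivity) (tailCoeff_nonneg _ _ _)))
      (fun x h0 hx => summable_depthGen (by rwa [abs_of_nonneg h0]) j)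
  convert h using 1
  · funext n
    exact (hasSum_depthCoeff j n).tsum_eq.symm
  · rfl

theorem depthCoeff_nonneg (j n : ℕ) : 0 ≤ depthCoeff j n :=
  Finset.sum_nonneg fun c _ => mul_nonneg (by rw [mzv_eq_nested]; exact nested_nonneg _ _ _)
    (Nat.cast_nonneg _)

theorem SeriesRep.pow_mul {r : ℝ} {c : ℕ → ℝ} {g : ℝ → ℝ} (h : SeriesRep r c g) (d : ℕ) :
    SeriesRep r (fun n => if d ≤ n then c (n - d) else 0) (fun x => x ^ d * g x) := by
  intro x hx
  obtain ⟨s, a⟩ := h x hx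
  constructor
  · refine (summable_nat_add_iff d).1 ((s.mul_left (|x| ^ d)).congr fun n => ?_)
    simp only [le_add_iff_nonneg_left, Nat.zero_le, if_true, Nat.add_sub_cancel]
    rw [pow_add]; ring
  · refine (hasSum_nat_add_iff' d).1 ((a.mul_left (x ^ d)).replace (fun n => ?_) ?_)
    · simp only [le_add_iff_nonneg_left, Nat.zero_le, if_true, Nat.add_sub_cancel]
      rw [pow_add]; ring
    · rw [Finset.sum_eq_zero, sub_zero]
      intro i hi
      dsimp only
      rw [if_neg (by simpa using hi), zero_mul]

/-- The generating function of the alternating sums of `depthCoeff`. -/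
def altGen (x : ℝ) : ℝ := ∑' k : ℕ,
  ((k + 1 : ℕ) : ℝ) * ((((k + 1 : ℕ) : ℝ) - x) ^ 4)⁻¹ * shiftGen (k + 1) x

/-- Expanding `shiftGen` creates the signs `(-1) ^ j`. The interchange is legitimate since `|x| ^ 2
≤ 1 / 64` beats the growth `8 ^ j` of the inner sums. -/
theorem altGen_eq {x : ℝ} (hx : |x| < 1 / 8) :
    altGen x = ∑' j, (-1) ^ j * (x ^ (2 * j) * depthGen j x) := by
  have hx2 : |x| ^ 2 ≤ 1 / 64 := by nlinarith [abs_nonneg x]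
  have hS : Summable (fun p : ℕ × ℕ => (((-x ^ 2) ^ p.1) *
      (((p.2 + 1 : ℕ) : ℝ) * (((((p.2 + 1 : ℕ) : ℝ) - x) ^ 4)⁻¹ * eTail p.1 (p.2 + 1) x)))) := by
    have hg : Summable (fun j : ℕ => 16 * (1 / 8 : ℝ) ^ j) :=
      (summable_geometric_of_lt_one (by norm_num) (by norm_num)).mul_left _
    refine Summable.of_norm_bounded (hg.mul_of_nonneg summable_inv_sq (fun _ => by positivity)
      (fun _ => by positivity)) fun p => ?_
    rw [Real.norm_eq_abs, abs_mul, abs_pow, abs_neg, abs_pow,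
      abs_of_nonneg (mul_nonneg (Nat.cast_nonneg _) (mul_nonneg (by positivity)
        (eTail_nonneg _ _ _)))]
    calc (|x| ^ 2) ^ p.1 * _ ≤ (1 / 64) ^ p.1 * ((16 * 8 ^ p.1) * (((p.2 + 1 : ℕ) : ℝ) ^ 2)⁻¹) :=
          mul_le_mul (pow_le_pow_left₀ (by positivity) hx2 _) (depth_term_bound hx p.1 p.2)
            (mul_nonneg (Nat.cast_nonneg _) (mul_nonneg (by positivity) (eTail_nonneg _ _ _)))
            (by positivity)
      _ = _ := by
        rw [show (1 / 64 : ℝ) = 1 / 8 * (1 / 8) by norm_num, mul_pow]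
        have : (1 / 8 : ℝ) ^ p.1 * 8 ^ p.1 = 1 := by rw [← mul_pow]; norm_num
        linear_combination (16 * (1 / 8) ^ p.1 * (((p.2 + 1 : ℕ) : ℝ) ^ 2)⁻¹) * this
  have h := hS.tsum_comm (f := fun j k => (((-x ^ 2) ^ j) *
      (((k + 1 : ℕ) : ℝ) * (((((k + 1 : ℕ) : ℝ) - x) ^ 4)⁻¹ * eTail j (k + 1) x))))
  have e1 : altGen x = ∑' k : ℕ, ∑' j : ℕ, (((-x ^ 2) ^ j) *
      (((k + 1 : ℕ) : ℝ) * (((((k + 1 : ℕ) : ℝ) - x) ^ 4)⁻¹ * eTail j (k + 1) x))) := by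
    refine tsum_congr fun k => ?_
    rw [shiftGen, ← tsum_mul_left]
    exact tsum_congr fun j => by ring
  rw [e1, h]
  refine tsum_congr fun j => ?_
  rw [tsum_mul_left, neg_pow, pow_mul, mul_assoc]
  rfl

theorem seriesRep_altGen : SeriesRep (1 / 8)
    (fun n => ∑' j, (-1) ^ j * (if 2 * j ≤ n then depthCoeff j (n - 2 * j) else 0)) altGen := by
  have h := SeriesRep.tsum (fun j => ((seriesRep_depthGen j).pow_mul (2 * j)).const_mul ((-1) ^ j))
    (fun x h0 hx => ?_)
  · exact h.congr fun x hx => (altGen_eq hx).symm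
  · have hx' : |x| < 1 / 8 := by rwa [abs_of_nonneg h0]
    have e : ∀ j : ℕ, ∑' n, |(-1 : ℝ) ^ j * (if 2 * j ≤ n then depthCoeff j (n - 2 * j) else 0)| * x ^ n
        = x ^ (2 * j) * depthGen j x := by
      intro j
      refine Eq.trans ?_ (((seriesRep_depthGen j).pow_mul (2 * j)) x hx').2.tsum_eq
      refine tsum_congr fun n => ?_
      rw [abs_mul, abs_pow, abs_neg, abs_one, one_pow, one_mul, abs_of_nonneg]
      split_ifs
      · exact depthCoeff_nonneg _ _
      · exact le_rfl
    simp only [e]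
    have hg : Summable (fun j : ℕ => 32 * (1 / 8 : ℝ) ^ j) :=
      (summable_geometric_of_lt_one (by norm_num) (by norm_num)).mul_left _
    refine Summable.of_nonneg_of_le (fun j => mul_nonneg (by positivity) (depthGen_nonneg _ _))
      (fun j => ?_) hg
    have hx2 : x ^ 2 ≤ 1 / 64 := by nlinarith
    calc x ^ (2 * j) * depthGen j x ≤ (1 / 64) ^ j * (32 * 8 ^ j) := by
          rw [pow_mul]
          exact mul_le_mul (pow_le_pow_left₀ (by positivity) hx2 _) (depthGen_le hx' j)
            (depthGen_nonneg _ _) (by positivity)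
      _ = _ := by
        rw [show (1 / 64 : ℝ) = 1 / 8 * (1 / 8) by norm_num, mul_pow]
        have : (1 / 8 : ℝ) ^ j * 8 ^ j = 1 := by rw [← mul_pow]; norm_num
        linear_combination (32 * (1 / 8) ^ j) * this

/-- The odd coefficient of degree `2 * n + 1` only involves the depths with `2 * j ≤ 2 * n + 1`, so
the sum over `j` becomes finite. -/
theorem evenRep_altGen : EvenRep (1 / 8) (PowerSeries.mk fun n =>
    ∑ j ∈ Finset.range (n + 1), (-1) ^ j * depthCoeff j (2 * n + 1 - 2 * j))
    (fun x => (altGen x - altGen (-x)) / (2 * x)) := by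
  convert seriesRep_altGen.odd using 2
  funext n
  rw [tsum_eq_sum (s := Finset.range (n + 1)) (fun j hj => by
    rw [if_neg (by simp at hj; omega), mul_zero])]
  refine Finset.sum_congr rfl fun j hj => ?_
  rw [if_pos (by simp at hj; omega)]

/-- Depth `j = 0` is the source of the first term, binom(2n+4, 3) ζ(2n+4), of the theorem. -/
theorem depthCoeff_zero (n : ℕ) : depthCoeff 0 n = ((n + 3).choose 3 : ℝ) * mzv [n + 3] := by
  rw [depthCoeff, Finset.Nat.antidiagonalTuple_one]
  simp [cIndex, cWeight, mul_comm]

/-! ### Sine, cotangent and the shifted product -/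

/-- Euler's product for the sine: the partial products times `starGen 0 x` equal `starGen N x`,
which tends to 1. -/
theorem starGen_eq_sin {x : ℝ} (hx : |x| ≤ 1 / 2) :
    starGen 0 x * Real.sin (Real.pi * x) = Real.pi * x := by
  have h1 := Real.tendsto_euler_sin_prod x
  have h2 := (h1.mul_const (starGen 0 x))
  have h3 := ((starGen_aux hx).2.2).const_mul (Real.pi * x)
  rw [mul_one] at h3
  rw [mul_comm]
  refine tendsto_nhds_unique (h2.congr fun n => ?_) h3
  rw [mul_assoc]
  have := prod_mul_starGen hx 0 n
  rw [zero_add] at this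
  rw [← this]
  congr 2
  refine Finset.prod_congr rfl fun i _ => ?_
  push_cast; ring

/-- The even part of `∑ 1 / (k (k - x))`, that is `∑ 1 / (k² - x²)`. -/
def zetaEven (x : ℝ) : ℝ := ∑' k : ℕ, (((k + 1 : ℕ) : ℝ) ^ 2 - x ^ 2)⁻¹

theorem summable_zetaEven {x : ℝ} (hx : |x| < 1 / 2) :
    Summable (fun k : ℕ => (((k + 1 : ℕ) : ℝ) ^ 2 - x ^ 2)⁻¹) := by
  have hx2 : x ^ 2 ≤ 1 / 4 := by rw [← sq_abs]; nlinarith [abs_nonneg x]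
  have h1 : ∀ k : ℕ, (1:ℝ) ≤ ((k + 1 : ℕ) : ℝ) := fun k => by exact_mod_cast (by omega)
  have h2 : ∀ k : ℕ, ((k + 1 : ℕ) : ℝ) ^ 2 / 2 ≤ ((k + 1 : ℕ) : ℝ) ^ 2 - x ^ 2 := fun k => by
    nlinarith [h1 k]
  refine Summable.of_nonneg_of_le (fun k => ?_) (fun k => ?_) (summable_inv_sq.mul_left 2)
  · have := h2 k
    have : (0:ℝ) ≤ ((k + 1 : ℕ) : ℝ) ^ 2 := by positivity
    exact inv_nonneg.2 (by linarith)
  · have := inv_anti₀ (by positivity) (h2 k)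
    rw [inv_div] at this
    simpa [div_eq_mul_inv] using this

/-- The function `π cot (π x)`, as a series. -/
def cotGen (x : ℝ) : ℝ := 1 / x - 2 * x * zetaEven x

/-- The Mittag-Leffler expansion of the complex cotangent, restricted to real arguments and with the
terms at `n + 1` and `-(n + 1)` paired. -/
theorem cotGen_mul_sin {x : ℝ} (hx0 : x ≠ 0) (hx : |x| < 1 / 2) :
    cotGen x * Real.sin (Real.pi * x) = Real.pi * Real.cos (Real.pi * x) := by
  have hmem : (x : ℂ) ∈ Complex.integerComplement := by
    rw [Complex.mem_integerComplement_iff]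
    rintro ⟨n, hn⟩
    have hn' : (n : ℝ) = x := by exact_mod_cast hn
    rw [← hn'] at hx
    have : |n| < 1 := by
      have h : |(n : ℝ)| < 1 := by linarith
      exact_mod_cast h
    rw [Int.abs_lt_one_iff] at this
    rw [this] at hn'
    exact hx0 (by simpa using hn'.symm)
  have h := cot_series_rep' hmem
  have h2 : ∑' n : ℕ, (1 / ((x : ℂ) - (n + 1)) + 1 / ((x : ℂ) + (n + 1)))
      = ((-(2 * x * zetaEven x) : ℝ) : ℂ) := by
    rw [zetaEven, ← tsum_mul_left, ← tsum_neg, Complex.ofReal_tsum]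
    refine tsum_congr fun n => ?_
    have a1 : x - (n + 1) ≠ 0 := by
      have := (abs_lt.1 hx).2
      have := Nat.cast_nonneg (α := ℝ) n
      intro h; linarith
    have a2 : x + (n + 1) ≠ 0 := by
      have := (abs_lt.1 hx).1
      have := Nat.cast_nonneg (α := ℝ) n
      intro h; linarith
    have a3 : ((n + 1 : ℕ) : ℝ) ^ 2 - x ^ 2 ≠ 0 := by
      have e : ((n + 1 : ℕ) : ℝ) ^ 2 - x ^ 2 = -((x - (n + 1)) * (x + (n + 1))) := by
        push_cast; ring
      rw [e]
      exact neg_ne_zero.2 (mul_ne_zero a1 a2)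
    have : 1 / (x - ((n : ℝ) + 1)) + 1 / (x + ((n : ℝ) + 1))
        = -(2 * x * (((n + 1 : ℕ) : ℝ) ^ 2 - x ^ 2)⁻¹) := by
      field_simp
      push_cast
      ring
    rw [← this]
    push_cast
    rfl
  rw [h2] at h
  have hs : Real.sin (Real.pi * x) ≠ 0 := by
    intro h0
    have := starGen_eq_sin hx.le
    rw [h0, mul_zero] at this
    exact mul_ne_zero Real.pi_ne_zero hx0 this.symm
  have h3 : (Real.pi : ℂ) * Complex.cot (Real.pi * x)
      = ((Real.pi * (Real.cos (Real.pi * x) / Real.sin (Real.pi * x)) : ℝ) : ℂ) := by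
    rw [Complex.cot]
    push_cast
    rfl
  rw [h3] at h
  have h4 : Real.pi * (Real.cos (Real.pi * x) / Real.sin (Real.pi * x)) - 1 / x
      = -(2 * x * zetaEven x) := by
    exact_mod_cast h
  rw [cotGen, show 1 / x - 2 * x * zetaEven x = 1 / x + -(2 * x * zetaEven x) by ring, ← h4]
  generalize Real.sin (Real.pi * x) = s at hs ⊢
  generalize Real.cos (Real.pi * x) = c
  field_simp
  ring

theorem shift_factor_cancel {a x : ℝ} (q : ℝ) (h1 : a - x ≠ 0) (h2 : a ≠ 0) (h3 : a - 2 * x ≠ 0) :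
    (1 - x ^ 2 / (a - x) ^ 2) * q * ((a - x) ^ 2 / (a * (a - 2 * x))) = q := by
  rw [one_sub_div (pow_ne_zero 2 h1), show (a - x) ^ 2 - x ^ 2 = a * (a - 2 * x) by ring]
  have h4 : a * (a - 2 * x) ≠ 0 := mul_ne_zero h2 h3
  have h5 : (a - x) ^ 2 ≠ 0 := pow_ne_zero 2 h1
  generalize a * (a - 2 * x) = b at h4 ⊢
  generalize (a - x) ^ 2 = c at h5 ⊢
  field_simp

/-- The quotient `shiftGen k / shiftGen 0` as a finite product. -/
def shiftProd (k : ℕ) (x : ℝ) : ℝ :=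
  ∏ i ∈ Finset.range k, ((i : ℝ) + 1 - x) ^ 2 / (((i : ℝ) + 1) * ((i : ℝ) + 1 - 2 * x))

theorem shiftProd_mul {x : ℝ} (hx : |x| < 1 / 8) (k : ℕ) :
    shiftProd k x * shiftGen 0 x = shiftGen k x := by
  have hx' := abs_lt.1 hx
  induction k with
  | zero => simp [shiftProd]
  | succ k ih =>
    rw [shiftProd, Finset.prod_range_succ, mul_right_comm]
    rw [shiftProd] at ih
    rw [ih, shiftGen_succ hx]
    have h0 := Nat.cast_nonneg (α := ℝ) k
    have h1 : (k : ℝ) + 1 - x ≠ 0 := by intro h; linarith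
    have h2 : (k : ℝ) + 1 ≠ 0 := by positivity
    have h3 : (k : ℝ) + 1 - 2 * x ≠ 0 := by intro h; linarith
    push_cast
    exact shift_factor_cancel _ h1 h2 h3

theorem shiftGen_zero_ne_zero {x : ℝ} (hx : |x| < 1 / 8) : shiftGen 0 x ≠ 0 := by
  intro h
  have h1 := (shiftGen_aux hx).2.2
  have h2 : (fun m => shiftGen m x) = fun _ => 0 := by
    funext m
    rw [← shiftProd_mul hx, h, mul_zero]
  rw [h2] at h1
  exact zero_ne_one (tendsto_nhds_unique tendsto_const_nhds h1)

theorem shiftProd_eq {x : ℝ} (hx : |x| < 1 / 8) (k : ℕ) :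
    shiftProd k x = shiftGen k x / shiftGen 0 x := by
  rw [← shiftProd_mul hx, mul_div_cancel_right₀ _ (shiftGen_zero_ne_zero hx)]

/-- Since 1 - x²/(k-x)² = k(k-2x)/(k-x)², the two products multiply to ∏ (1 - 4x²/k²)(1 - x²/k²)⁻²,
that is S(x)²/S(2x). By the sine formula this is πx cos πx / sin πx. Its role is to cancel the
cotangent in the limit of the residue sums. -/
theorem shiftGen_mul_shiftGen_neg {x : ℝ} (hx0 : x ≠ 0) (hx : |x| < 1 / 8) :
    shiftGen 0 x * shiftGen 0 (-x) = x * cotGen x := by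
  have hxn : |-x| < 1 / 8 := by rwa [abs_neg]
  have hx2 : |2 * x| ≤ 1 / 2 := by rw [abs_mul, abs_two]; linarith
  have hx1 : |x| ≤ 1 / 2 := by linarith
  have hx' := abs_lt.1 hx
  have hprod : ∀ k, shiftProd k x * shiftProd k (-x) *
      ∏ i ∈ Finset.range k, (1 - (2 * x) ^ 2 / ((0 + i + 1 : ℕ) : ℝ) ^ 2)
      = (∏ i ∈ Finset.range k, (1 - x ^ 2 / ((0 + i + 1 : ℕ) : ℝ) ^ 2)) ^ 2 := by
    intro k
    rw [shiftProd, shiftProd, ← Finset.prod_mul_distrib, ← Finset.prod_mul_distrib,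
      ← Finset.prod_pow]
    refine Finset.prod_congr rfl fun i _ => ?_
    have h0 := Nat.cast_nonneg (α := ℝ) i
    have h2 : (i : ℝ) + 1 ≠ 0 := by positivity
    have h3 : (i : ℝ) + 1 - 2 * x ≠ 0 := by intro h; linarith
    have h4 : (i : ℝ) + 1 - 2 * -x ≠ 0 := by intro h; linarith
    push_cast
    rw [zero_add]
    have h5 : ((i : ℝ) + 1 - 2 * x) * ((i : ℝ) + 1 - 2 * -x) ≠ 0 := mul_ne_zero h3 h4
    generalize (i : ℝ) + 1 = a at *
    rw [one_sub_div (pow_ne_zero 2 h2), one_sub_div (pow_ne_zero 2 h2),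
      show a ^ 2 - (2 * x) ^ 2 = (a - 2 * x) * (a - 2 * -x) by ring,
      show a ^ 2 - x ^ 2 = (a - x) * (a - -x) by ring]
    generalize a - 2 * x = b at *
    generalize a - 2 * -x = c at *
    field_simp
  have hk : ∀ k, shiftGen k x * shiftGen k (-x) * starGen 0 x ^ 2 * starGen k (2 * x)
      = shiftGen 0 x * shiftGen 0 (-x) * starGen 0 (2 * x) * starGen k x ^ 2 := by
    intro k
    have e1 := prod_mul_starGen hx1 0 k
    have e2 := prod_mul_starGen hx2 0 k
    have e3 := hprod k
    rw [← shiftProd_mul hx, ← shiftProd_mul hxn]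
    rw [zero_add] at e1 e2
    rw [← e1, ← e2, mul_pow (∏ i ∈ Finset.range k, (1 - x ^ 2 / ((0 + i + 1 : ℕ) : ℝ) ^ 2)), ← e3]
    ring
  have l1 := ((((shiftGen_aux hx).2.2.mul (shiftGen_aux hxn).2.2).mul_const
    (starGen 0 x ^ 2)).mul (starGen_aux hx2).2.2)
  have l2 := ((starGen_aux hx1).2.2.pow 2).const_mul
    (shiftGen 0 x * shiftGen 0 (-x) * starGen 0 (2 * x))
  have h := tendsto_nhds_unique (l1.congr hk) l2
  simp only [one_mul, mul_one, one_pow] at h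
  have s1 := starGen_eq_sin hx1
  have s2 := starGen_eq_sin hx2
  have s3 := cotGen_mul_sin hx0 (by linarith)
  have hs : Real.sin (Real.pi * x) ≠ 0 := by
    intro h0
    rw [h0, mul_zero] at s1
    exact mul_ne_zero Real.pi_ne_zero hx0 s1.symm
  have hs2 : starGen 0 (2 * x) ≠ 0 := by
    have := one_le_starGen hx2 0
    intro h0; linarith
  rw [show Real.pi * (2 * x) = 2 * (Real.pi * x) by ring, Real.sin_two_mul] at s2
  set s := Real.sin (Real.pi * x)
  set c := Real.cos (Real.pi * x)
  set S1 := starGen 0 x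
  set S2 := starGen 0 (2 * x)
  set K := shiftGen 0 x * shiftGen 0 (-x)
  have h5 : S2 * c = S1 := by
    apply mul_left_cancel₀ hs
    linear_combination s2 / 2 - s1
  apply mul_right_cancel₀ (mul_ne_zero hs2 hs)
  rw [← mul_assoc, ← h]
  linear_combination S1 * s1 - x * S2 * s3 - x * Real.pi * h5

/-! ### Partial fractions of the kernel -/

/-- The rational function `∏_{1 ≤ j ≤ N} (s + j)² / ∏_{0 ≤ j ≤ N} ((s + j)² - x²)`. -/
def resKernel (N : ℕ) (x s : ℝ) : ℝ :=
  (∏ j ∈ Finset.range N, (s + (j + 1)) ^ 2) / ∏ j ∈ Finset.range (N + 1), ((s + j) ^ 2 - x ^ 2)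

/-- The residue of `resKernel N y` at `y - k`. -/
def resWeight (N k : ℕ) (y : ℝ) : ℝ :=
  y / 2 * (((k : ℝ) - y) ^ 2)⁻¹ * (shiftProd k y * shiftProd (N - k) (-y))

theorem prod_range_split {M : Type*} [CommMonoid M] (F : ℕ → M) (k l : ℕ) :
    ∏ j ∈ Finset.range (k + l + 1), F j =
      (∏ i ∈ Finset.range k, F (k - 1 - i)) * F k * ∏ i ∈ Finset.range l, F (k + (i + 1)) := by
  rw [add_assoc, Finset.prod_range_add, Finset.prod_range_succ', Finset.prod_range_reflect]
  rw [add_zero, mul_assoc, mul_comm (F k)]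

theorem natCast_sub_two_mul_ne {x : ℝ} (hx0 : x ≠ 0) (hx : |x| < 1 / 8) (z : ℤ) :
    (z : ℝ) + 2 * x ≠ 0 := by
  intro h
  have hx' := abs_lt.1 hx
  have h1 : |z| < 1 := by
    rw [abs_lt]
    constructor
    · have : (-1 : ℝ) < z := by linarith
      exact_mod_cast this
    · have : (z : ℝ) < 1 := by linarith
      exact_mod_cast this
  rw [Int.abs_lt_one_iff] at h1
  rw [h1] at h
  apply hx0
  simpa using h

theorem natCast_sub_ne {x : ℝ} (hx0 : x ≠ 0) (hx : |x| < 1 / 8) (z : ℤ) :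
    (z : ℝ) + x ≠ 0 := by
  intro h
  apply natCast_sub_two_mul_ne hx0 hx (2 * z)
  push_cast
  linear_combination 2 * h

/-- The factors with `j < k` give `shiftProd k y`, those with `j > k` give `shiftProd (N - k) (-y)`,
and `j = k` gives `1 / (2 * y)`. Multiplying by `(y - k) ^ 2` completes the numerator to the same
index range. -/
theorem resWeight_eq {N k : ℕ} (hk : k ≤ N) {y : ℝ} (hy0 : y ≠ 0) (hy : |y| < 1 / 8) :
    (∏ j ∈ Finset.range (N + 1), ((if j = k then 1 else ((j : ℝ) - k)⁻¹) * (2 * y + (j - k))⁻¹)) *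
      ∏ j ∈ Finset.range N, (y - k + (j + 1)) ^ 2 = resWeight N k y := by
  have hky : y - k ≠ 0 := by
    have := natCast_sub_ne hy0 hy (-k)
    push_cast at this
    intro h; apply this; linarith
  obtain ⟨l, rfl⟩ := Nat.exists_eq_add_of_le hk
  have e1 : (∏ j ∈ Finset.range (k + l), (y - k + (j + 1)) ^ 2) * (y - k) ^ 2
      = ∏ j ∈ Finset.range (k + l + 1), (y - k + j) ^ 2 := by
    rw [Finset.prod_range_succ']
    simp
  have hky2 : (y - k) ^ 2 ≠ 0 := pow_ne_zero 2 hky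
  apply mul_right_cancel₀ hky2
  rw [mul_assoc, e1, ← Finset.prod_mul_distrib, prod_range_split, resWeight, Nat.add_sub_cancel_left]
  have a1 : ∀ i ∈ Finset.range k,
      (if k - 1 - i = k then 1 else (((k - 1 - i : ℕ) : ℝ) - k)⁻¹) *
        (2 * y + (((k - 1 - i : ℕ) : ℝ) - k))⁻¹ * (y - k + ((k - 1 - i : ℕ) : ℝ)) ^ 2
      = ((i : ℝ) + 1 - y) ^ 2 / (((i : ℝ) + 1) * ((i : ℝ) + 1 - 2 * y)) := by
    intro i hi
    have hi' := Finset.mem_range.1 hi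
    have hc : ((k - 1 - i : ℕ) : ℝ) = k - 1 - i := by
      rw [Nat.cast_sub (by omega), Nat.cast_sub (by omega)]; simp
    rw [if_neg (by omega), hc]
    rw [div_eq_mul_inv, mul_inv,
      show (k : ℝ) - 1 - i - k = -(i + 1) by ring,
      show 2 * y + -((i : ℝ) + 1) = -(i + 1 - 2 * y) by ring, inv_neg, inv_neg]
    ring
  have a2 : ∀ i ∈ Finset.range l,
      (if k + (i + 1) = k then 1 else (((k + (i + 1) : ℕ) : ℝ) - k)⁻¹) *
        (2 * y + (((k + (i + 1) : ℕ) : ℝ) - k))⁻¹ * (y - k + ((k + (i + 1) : ℕ) : ℝ)) ^ 2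
      = ((i : ℝ) + 1 - -y) ^ 2 / (((i : ℝ) + 1) * ((i : ℝ) + 1 - 2 * -y)) := by
    intro i hi
    rw [if_neg (by omega)]
    push_cast
    rw [div_eq_mul_inv, mul_inv, show (k : ℝ) + (i + 1) - k = i + 1 by ring,
      show 2 * y + ((i : ℝ) + 1) = i + 1 - 2 * -y by ring]
    ring
  rw [Finset.prod_congr rfl a1, Finset.prod_congr rfl a2, if_pos rfl, shiftProd, shiftProd]
  have h3 : ((k : ℝ) - y) ^ 2 = (y - k) ^ 2 := by ring
  rw [h3, sub_self, add_zero, sub_add_cancel]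
  field_simp

/-- Lagrange interpolation of the numerator, of degree `2 * N`, at the `2 * N + 2` zeros of the
denominator. -/
theorem resKernel_eq_sum {N : ℕ} {x s : ℝ} (hx0 : x ≠ 0) (hx : |x| < 1 / 8)
    (h1 : ∀ k : ℕ, s + (k - x) ≠ 0) (h2 : ∀ k : ℕ, s + (k + x) ≠ 0) :
    resKernel N x s = ∑ k ∈ Finset.range (N + 1),
      (resWeight N k x * (s + (k - x))⁻¹ + resWeight N k (-x) * (s + (k + x))⁻¹) := by
  classical
  have hxn0 : -x ≠ 0 := neg_ne_zero.2 hx0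
  have hxn : |-x| < 1 / 8 := by rwa [abs_neg]
  let v : ℕ × Bool → ℝ := fun p => (if p.2 then x else -x) - p.1
  let S : Finset (ℕ × Bool) := Finset.range (N + 1) ×ˢ Finset.univ
  have hinj : Function.Injective v := by
    -- Nodes from the two families could only collide if `2 * x` were an integer.
    have key := natCast_sub_two_mul_ne hx0 hx
    rintro ⟨k, b⟩ ⟨l, b'⟩ h
    simp only [v] at h
    cases b <;> cases b' <;> simp only [Bool.false_eq_true, if_true, if_false] at h
    · have : (k : ℝ) = l := by linarith
      simpa using this
    · exfalso
      apply key (k - l); push_cast; linarith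
    · exfalso
      apply key (l - k); push_cast; linarith
    · have : (k : ℝ) = l := by linarith
      simpa using this
  let P : Polynomial ℝ := ∏ j ∈ Finset.range N, (Polynomial.X + Polynomial.C ((j : ℝ) + 1)) ^ 2
  have hPdeg : P.degree < S.card := by
    have h : P.degree ≤ (2 * N : ℕ) := by
      refine (Polynomial.degree_prod_le _ _).trans ?_
      calc ∑ j ∈ Finset.range N, ((Polynomial.X + Polynomial.C ((j : ℝ) + 1)) ^ 2).degree
          = ∑ j ∈ Finset.range N, (2 : WithBot ℕ) := by
            refine Finset.sum_congr rfl fun j _ => ?_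
            rw [Polynomial.degree_pow, Polynomial.degree_X_add_C]; rfl
        _ ≤ _ := by
          rw [Finset.sum_const, Finset.card_range]
          refine le_of_eq ?_
          rw [nsmul_eq_mul, mul_comm]
          norm_cast
    refine h.trans_lt ?_
    have : S.card = 2 * N + 2 := by simp [S, mul_comm]; ring
    rw [this]
    exact_mod_cast (by omega)
  have hPe : ∀ z, P.eval z = ∏ j ∈ Finset.range N, (z + ((j : ℝ) + 1)) ^ 2 := fun z => by
    simp [P, Polynomial.eval_prod]
  have hL := Lagrange.eq_interpolate (s := S) (v := v) hinj.injOn hPdeg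
  have hs : ∀ i ∈ S, s ≠ v i := by
    rintro ⟨k, b⟩ _ h
    cases b <;> simp only [v, Bool.false_eq_true, if_true, if_false] at h
    · exact h2 k (by linarith)
    · exact h1 k (by linarith)
  have hE := Lagrange.eval_interpolate_not_at_node (s := S) (v := v)
    (fun i => P.eval (v i)) (x := s) hs
  rw [← hL, hPe] at hE
  have hnod : Polynomial.eval s (Lagrange.nodal S v)
      = ∏ j ∈ Finset.range (N + 1), ((s + j) ^ 2 - x ^ 2) := by
    rw [Lagrange.eval_nodal, Finset.prod_product]
    refine Finset.prod_congr rfl fun j _ => ?_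
    simp only [Fintype.prod_bool, v, if_true, Bool.false_eq_true, if_false]
    ring
  have hnod0 : ∏ j ∈ Finset.range (N + 1), ((s + j) ^ 2 - x ^ 2) ≠ 0 := by
    refine Finset.prod_ne_zero_iff.2 fun j _ => ?_
    rw [show (s + j) ^ 2 - x ^ 2 = (s + (j - x)) * (s + (j + x)) by ring]
    exact mul_ne_zero (h1 j) (h2 j)
  rw [hnod] at hE
  rw [resKernel, hE, mul_comm, mul_div_assoc, div_self hnod0, mul_one, Finset.sum_product]
  have hw : ∀ i ∈ S, Lagrange.nodalWeight S v i
      = ∏ p ∈ S, (if p = i then 1 else (v i - v p)⁻¹) := by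
    intro i hi
    rw [Lagrange.nodalWeight, ← Finset.mul_prod_erase S _ hi, if_pos rfl, one_mul]
    refine Finset.prod_congr rfl fun p hp => ?_
    rw [if_neg (Finset.ne_of_mem_erase hp)]
  refine Finset.sum_congr rfl fun k hk => ?_
  have hk' : k ≤ N := by simpa [Nat.lt_succ_iff] using hk
  rw [Fintype.sum_bool, hw _ (by simpa [S] using hk'), hw _ (by simpa [S] using hk'), hPe, hPe,
    Finset.prod_product, Finset.prod_product, ← resWeight_eq hk' hx0 hx, ← resWeight_eq hk' hxn0 hxn]
  simp only [Fintype.prod_bool, v, if_true, Bool.false_eq_true, if_false, Prod.mk.injEq, and_true,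
    and_false, reduceCtorEq]
  have b1 : ∀ j : ℕ, x - k - (x - j) = (j : ℝ) - k := fun j => by ring
  have b2 : ∀ j : ℕ, x - k - (-x - j) = 2 * x + ((j : ℝ) - k) := fun j => by ring
  have b3 : ∀ j : ℕ, -x - k - (x - j) = 2 * -x + ((j : ℝ) - k) := fun j => by ring
  have b4 : ∀ j : ℕ, -x - k - (-x - j) = (j : ℝ) - k := fun j => by ring
  have b5 : s - (x - k) = s + (k - x) := by ring
  have b6 : s - (-x - k) = s + (k + x) := by ring
  simp only [b1, b2, b3, b4, b5, b6]
  have b7 : ∏ j ∈ Finset.range (N + 1), ((2 * -x + ((j : ℝ) - k))⁻¹ *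
      if j = k then 1 else ((j : ℝ) - k)⁻¹) = ∏ j ∈ Finset.range (N + 1),
      ((if j = k then 1 else ((j : ℝ) - k)⁻¹) * (2 * -x + ((j : ℝ) - k))⁻¹) :=
    Finset.prod_congr rfl fun j _ => mul_comm _ _
  rw [b7]
  ring

theorem starGen_ne_zero {x : ℝ} (hx : |x| ≤ 1 / 2) (m : ℕ) : starGen m x ≠ 0 := by
  have := one_le_starGen hx m
  intro h; linarith

theorem resKernel_zero {x : ℝ} (hx : |x| < 1 / 8) (N : ℕ) :
    resKernel N x 0 = -(1 / x ^ 2) * (starGen 0 x / starGen N x) := by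
  have hx1 : |x| ≤ 1 / 2 := by linarith
  have e := prod_mul_starGen hx1 0 N
  have e2 : ∏ j ∈ Finset.range N, ((0 + ((j + 1 : ℕ) : ℝ)) ^ 2 - x ^ 2) =
      (∏ i ∈ Finset.range N, (1 - x ^ 2 / ((0 + i + 1 : ℕ) : ℝ) ^ 2)) *
        ∏ j ∈ Finset.range N, (0 + ((j : ℝ) + 1)) ^ 2 := by
    rw [← Finset.prod_mul_distrib]
    refine Finset.prod_congr rfl fun i _ => ?_
    have : (i : ℝ) + 1 ≠ 0 := by positivity
    push_cast
    field_simp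
    ring
  have h0 : ∏ j ∈ Finset.range N, (0 + ((j : ℝ) + 1)) ^ 2 ≠ 0 :=
    Finset.prod_ne_zero_iff.2 fun i _ => by positivity
  rw [resKernel, Finset.prod_range_succ', e2]
  rw [zero_add] at e
  have hs := starGen_ne_zero hx1 N
  rw [← e] at hs ⊢
  have hs1 := left_ne_zero_of_mul hs
  have hs2 := right_ne_zero_of_mul hs
  -- At `x = 0` both sides are zero by the convention for division by zero.
  rcases eq_or_ne x 0 with rfl | hx0
  · simp
  generalize (∏ i ∈ Finset.range N, (1 - x ^ 2 / ((0 + i + 1 : ℕ) : ℝ) ^ 2)) = A at *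
  generalize ∏ j ∈ Finset.range N, (0 + ((j : ℝ) + 1)) ^ 2 = B at *
  push_cast
  field_simp
  ring

/-- These zeros make it free to add the values at negative integers, which turns one-sided sums into
symmetric ones. -/
theorem resKernel_neg {x : ℝ} {N i : ℕ} (hi : i < N) : resKernel N x (-((i : ℝ) + 1)) = 0 := by
  rw [resKernel, Finset.prod_eq_zero (Finset.mem_range.2 hi) (by ring), zero_div]

/-- After multiplication by (i+1)⁻² this is the summand of the generating function of ζ⋆(4, {2}^n),
up to a denominator that tends to 1. -/
theorem resKernel_natCast {x : ℝ} (hx : |x| < 1 / 8) (N i : ℕ) :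
    resKernel N x ((i : ℝ) + 1) = (((i : ℝ) + 1) ^ 2)⁻¹ * (starGen i x / starGen (i + (N + 1)) x) := by
  have hx1 : |x| ≤ 1 / 2 := by linarith
  have e := prod_mul_starGen hx1 i (N + 1)
  have hi : ((i : ℝ) + 1) ^ 2 ≠ 0 := by positivity
  have e2 : ∏ j ∈ Finset.range (N + 1), ((i : ℝ) + 1 + j) ^ 2
      = (∏ j ∈ Finset.range N, ((i : ℝ) + 1 + (j + 1)) ^ 2) * ((i : ℝ) + 1) ^ 2 := by
    rw [Finset.prod_range_succ']; simp
  have e3 : ∏ j ∈ Finset.range (N + 1), (((i : ℝ) + 1 + j) ^ 2 - x ^ 2) =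
      (∏ j ∈ Finset.range (N + 1), (1 - x ^ 2 / ((i + j + 1 : ℕ) : ℝ) ^ 2)) *
        ∏ j ∈ Finset.range (N + 1), ((i : ℝ) + 1 + j) ^ 2 := by
    rw [← Finset.prod_mul_distrib]
    refine Finset.prod_congr rfl fun j _ => ?_
    have : (i : ℝ) + 1 + j ≠ 0 := by positivity
    have h2 : (((i + j + 1 : ℕ)) : ℝ) = (i : ℝ) + 1 + j := by push_cast; ring
    rw [h2]
    field_simp
  have h0 : ∏ j ∈ Finset.range N, ((i : ℝ) + 1 + (j + 1)) ^ 2 ≠ 0 :=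
    Finset.prod_ne_zero_iff.2 fun j _ => by positivity
  have hs := starGen_ne_zero hx1 (i + (N + 1))
  rw [resKernel, e3, e2]
  rw [← e] at hs ⊢
  have hs1 := left_ne_zero_of_mul hs
  have hs2 := right_ne_zero_of_mul hs
  generalize (∏ j ∈ Finset.range (N + 1), (1 - x ^ 2 / ((i + j + 1 : ℕ) : ℝ) ^ 2)) = A at *
  generalize ∏ j ∈ Finset.range N, ((i : ℝ) + 1 + (j + 1)) ^ 2 = B at *
  field_simp

/-- The symmetric partial sums of `π cot (π a) = ∑ 1 / (a + l)`. -/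
def cotSum (N : ℕ) (a : ℝ) : ℝ :=
  a⁻¹ + ∑ i ∈ Finset.range N, ((a + ((i : ℝ) + 1))⁻¹ + (a - ((i : ℝ) + 1))⁻¹)

/-- With l = i + 1 one has l⁻² · 2a/(a² - l²) = (2/a) l⁻² + a⁻² · 2a/(a² - l²). The last summand `(a
^ 3)⁻¹` compensates the central term `a⁻¹` of `cotSum`. -/
theorem sum_inv_sq_mul {N : ℕ} {a : ℝ} (ha : a ≠ 0) (h1 : ∀ i : ℕ, (i : ℝ) + 1 + a ≠ 0)
    (h2 : ∀ i : ℕ, -((i : ℝ) + 1) + a ≠ 0) :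
    ∑ i ∈ Finset.range N, (((i : ℝ) + 1) ^ 2)⁻¹ * (((i : ℝ) + 1 + a)⁻¹ + (-((i : ℝ) + 1) + a)⁻¹)
      = 2 * a⁻¹ * ∑ i ∈ Finset.range N, (((i : ℝ) + 1) ^ 2)⁻¹ + (a ^ 2)⁻¹ * cotSum N a - (a ^ 3)⁻¹ := by
  have e : ∀ i : ℕ, (((i : ℝ) + 1) ^ 2)⁻¹ * (((i : ℝ) + 1 + a)⁻¹ + (-((i : ℝ) + 1) + a)⁻¹)
      = 2 * a⁻¹ * (((i : ℝ) + 1) ^ 2)⁻¹ +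
        (a ^ 2)⁻¹ * ((a + ((i : ℝ) + 1))⁻¹ + (a - ((i : ℝ) + 1))⁻¹) := by
    intro i
    have hi : (i : ℝ) + 1 ≠ 0 := by positivity
    have h1 := h1 i
    have h2 := h2 i
    rw [show a + ((i : ℝ) + 1) = (i : ℝ) + 1 + a by ring,
      show a - ((i : ℝ) + 1) = -((i : ℝ) + 1) + a by ring]
    generalize (i : ℝ) + 1 = l at *
    rw [inv_add_inv h1 h2]
    have h3 : (l + a) * (-l + a) ≠ 0 := mul_ne_zero h1 h2
    have h4 : (l + a) * (-l + a) = a ^ 2 - l ^ 2 := by ring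
    rw [h4] at h3 ⊢
    rw [show l + a + (-l + a) = 2 * a by ring]
    generalize hc : a ^ 2 - l ^ 2 = c at *
    field_simp
    linear_combination hc
  simp only [e, Finset.sum_add_distrib, ← Finset.mul_sum, cotSum]
  field_simp
  ring

/-- Symmetrise by `resKernel_neg`, insert the partial fractions, and sum over `i` first. The weights
of the poles against `1 / a` reassemble to `resKernel N x 0`. -/
theorem sum_resKernel {N : ℕ} {x : ℝ} (hx0 : x ≠ 0) (hx : |x| < 1 / 8) :
    ∑ i ∈ Finset.range N, (((i : ℝ) + 1) ^ 2)⁻¹ * resKernel N x ((i : ℝ) + 1) =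
      2 * (∑ i ∈ Finset.range N, (((i : ℝ) + 1) ^ 2)⁻¹) * resKernel N x 0 +
      ∑ k ∈ Finset.range (N + 1),
        (resWeight N k x * ((((k : ℝ) - x) ^ 2)⁻¹ * cotSum N (k - x)) +
          resWeight N k (-x) * ((((k : ℝ) + x) ^ 2)⁻¹ * cotSum N (k + x))) -
      ∑ k ∈ Finset.range (N + 1),
        (resWeight N k x * (((k : ℝ) - x) ^ 3)⁻¹ + resWeight N k (-x) * (((k : ℝ) + x) ^ 3)⁻¹) := by
  have hxn0 : -x ≠ 0 := neg_ne_zero.2 hx0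
  have hxn : |-x| < 1 / 8 := by rwa [abs_neg]
  have g1 : ∀ z : ℤ, (z : ℝ) + x ≠ 0 := natCast_sub_ne hx0 hx
  have g2 : ∀ z : ℤ, (z : ℝ) + -x ≠ 0 := natCast_sub_ne hxn0 hxn
  have p0 : resKernel N x 0 = _ := resKernel_eq_sum hx0 hx
    (fun k => by have := g2 k; push_cast at this; rwa [zero_add])
    (fun k => by have := g1 k; push_cast at this; rwa [zero_add])
  have p1 : ∀ i : ℕ, resKernel N x ((i : ℝ) + 1) = _ := fun i => resKernel_eq_sum hx0 hx
    (fun k => by have := g2 (i + 1 + k); push_cast at this; intro h; apply this; linarith)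
    (fun k => by have := g1 (i + 1 + k); push_cast at this; intro h; apply this; linarith)
  have p2 : ∀ i : ℕ, resKernel N x (-((i : ℝ) + 1)) = _ := fun i => resKernel_eq_sum hx0 hx
    (fun k => by have := g2 (-(i + 1) + k); push_cast at this; intro h; apply this; linarith)
    (fun k => by have := g1 (-(i + 1) + k); push_cast at this; intro h; apply this; linarith)
  have q : ∀ i ∈ Finset.range N, (((i : ℝ) + 1) ^ 2)⁻¹ * resKernel N x ((i : ℝ) + 1) =
      ∑ k ∈ Finset.range (N + 1),
      (resWeight N k x * ((((i : ℝ) + 1) ^ 2)⁻¹ *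
        (((i : ℝ) + 1 + (k - x))⁻¹ + (-((i : ℝ) + 1) + (k - x))⁻¹)) +
       resWeight N k (-x) * ((((i : ℝ) + 1) ^ 2)⁻¹ *
        (((i : ℝ) + 1 + (k + x))⁻¹ + (-((i : ℝ) + 1) + (k + x))⁻¹))) := by
    intro i hi
    have : resKernel N x ((i : ℝ) + 1) = resKernel N x ((i : ℝ) + 1) + resKernel N x (-((i : ℝ) + 1)) := by
      rw [resKernel_neg (Finset.mem_range.1 hi), add_zero]
    rw [this, p1, p2, ← Finset.sum_add_distrib, Finset.mul_sum]
    refine Finset.sum_congr rfl fun k _ => ?_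
    ring
  rw [Finset.sum_congr rfl q, Finset.sum_comm, p0, Finset.mul_sum, ← Finset.sum_add_distrib,
    ← Finset.sum_sub_distrib]
  refine Finset.sum_congr rfl fun k _ => ?_
  rw [Finset.sum_add_distrib, ← Finset.mul_sum, ← Finset.mul_sum, sum_inv_sq_mul, sum_inv_sq_mul]
  · rw [zero_add, zero_add]
    ring
  · have := g1 k; push_cast at this; exact this
  · intro i; have := g1 (i + 1 + k); push_cast at this; intro h; apply this; linarith
  · intro i; have := g1 (-(i + 1) + k); push_cast at this; intro h; apply this; linarith
  · have := g2 k; push_cast at this; exact this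
  · intro i; have := g2 (i + 1 + k); push_cast at this; intro h; apply this; linarith
  · intro i; have := g2 (-(i + 1) + k); push_cast at this; intro h; apply this; linarith

/-- The logarithmic derivative of `resKernel N x`. -/
def resLogDeriv (N : ℕ) (x s : ℝ) : ℝ :=
  ∑ j ∈ Finset.range N, (2 * (s + (j + 1))⁻¹ - (s + (j + 1 - x))⁻¹ - (s + (j + 1 + x))⁻¹)
    - ((s - x)⁻¹ + (s + x)⁻¹)

theorem hasDerivAt_inv_add (a s : ℝ) (h : s + a ≠ 0) :
    HasDerivAt (fun s => (s + a)⁻¹) (-((s + a) ^ 2)⁻¹) s := by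
  refine (((hasDerivAt_id s).add_const a).fun_inv h).congr_deriv ?_
  simp [div_eq_mul_inv]

theorem ne_of_abs_lt_abs {x s : ℝ} (hs : |s| < |x|) (hx : |x| < 1 / 8) (j : ℕ) :
    s + (j + 1) ≠ 0 ∧ s + ((j : ℝ) + 1 - x) ≠ 0 ∧ s + ((j : ℝ) + 1 + x) ≠ 0 ∧ s - x ≠ 0 ∧ s + x ≠ 0 := by
  have h1 := abs_lt.1 hx
  have h2 := abs_lt.1 (hs.trans hx)
  have h3 := Nat.cast_nonneg (α := ℝ) j
  refine ⟨fun h => by linarith, fun h => by linarith, fun h => by linarith, fun h => ?_, fun h => ?_⟩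
  · rw [sub_eq_zero.1 h] at hs; exact lt_irrefl _ hs
  · rw [eq_neg_of_add_eq_zero_left h, abs_neg] at hs; exact lt_irrefl _ hs

theorem hasDerivAt_resKernel {x s : ℝ} (hs : |s| < |x|) (hx : |x| < 1 / 8) (N : ℕ) :
    HasDerivAt (resKernel N x) (resKernel N x s * resLogDeriv N x s) s := by
  induction N with
  | zero =>
    obtain ⟨-, -, -, h4, h5⟩ := ne_of_abs_lt_abs hs hx 0
    have e : resKernel 0 x = fun s => (s + -x)⁻¹ * (s + x)⁻¹ := by
      funext s
      simp only [resKernel, Finset.prod_range_zero, zero_add, Finset.prod_range_one]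
      rw [← mul_inv, one_div]
      congr 1
      push_cast; ring
    have h4' : s + -x ≠ 0 := h4
    rw [e]
    refine ((hasDerivAt_inv_add (-x) s h4').mul (hasDerivAt_inv_add x s h5)).congr_deriv ?_
    simp only [resLogDeriv, Finset.sum_range_zero, sub_eq_add_neg]
    field_simp
    ring
  | succ N ih =>
    obtain ⟨h1, h2, h3, -, -⟩ := ne_of_abs_lt_abs hs hx N
    have e : resKernel (N + 1) x = fun s => resKernel N x s *
        ((s + ((N : ℝ) + 1)) ^ 2 * ((s + ((N : ℝ) + 1 - x))⁻¹ * (s + ((N : ℝ) + 1 + x))⁻¹)) := by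
      funext s
      rw [resKernel, Finset.prod_range_succ, Finset.prod_range_succ _ (N + 1), resKernel,
        mul_div_mul_comm, ← mul_inv]
      congr 1
      rw [div_eq_mul_inv]
      congr 2
      push_cast
      ring
    rw [e]
    have d := ih.mul ((((hasDerivAt_id s).add_const ((N : ℝ) + 1)).pow 2).mul
      ((hasDerivAt_inv_add ((N : ℝ) + 1 - x) s h2).mul (hasDerivAt_inv_add ((N : ℝ) + 1 + x) s h3)))
    refine d.congr_deriv ?_
    have hl : resLogDeriv (N + 1) x s = resLogDeriv N x s +
        (2 * (s + (N + 1))⁻¹ - (s + (N + 1 - x))⁻¹ - (s + (N + 1 + x))⁻¹) := by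
      rw [resLogDeriv, Finset.sum_range_succ, resLogDeriv]; ring
    rw [hl]
    simp only [id, Pi.mul_apply, Pi.pow_apply]
    generalize s + ((N : ℝ) + 1) = a at *
    generalize s + ((N : ℝ) + 1 - x) = b at *
    generalize s + ((N : ℝ) + 1 + x) = c at *
    field_simp
    ring

/-- The derivative of `resLogDeriv N x` at `0`. -/
def resLogDeriv' (N : ℕ) (x : ℝ) : ℝ :=
  ∑ j ∈ Finset.range N, ((((j : ℝ) + 1 - x) ^ 2)⁻¹ + (((j : ℝ) + 1 + x) ^ 2)⁻¹
    - 2 * (((j : ℝ) + 1) ^ 2)⁻¹) + 2 * (x ^ 2)⁻¹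

theorem hasDerivAt_resLogDeriv {x : ℝ} (hx0 : x ≠ 0) (hx : |x| < 1 / 8) (N : ℕ) :
    HasDerivAt (resLogDeriv N x) (resLogDeriv' N x) 0 := by
  have hs : |(0:ℝ)| < |x| := by rw [abs_zero]; exact abs_pos.2 hx0
  have key := ne_of_abs_lt_abs hs hx
  have d := (HasDerivAt.fun_sum (u := Finset.range N) (x := (0:ℝ)) (fun j _ =>
    (((hasDerivAt_inv_add ((j : ℝ) + 1) 0 (key j).1).const_mul 2).sub
      (hasDerivAt_inv_add ((j : ℝ) + 1 - x) 0 (key j).2.1)).sub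
      (hasDerivAt_inv_add ((j : ℝ) + 1 + x) 0 (key j).2.2.1))).sub
    ((hasDerivAt_inv_add (-x) 0 (key 0).2.2.2.1).add (hasDerivAt_inv_add x 0 (key 0).2.2.2.2))
  refine d.congr_deriv ?_
  rw [resLogDeriv']
  simp only [zero_add, neg_sq]
  rw [sub_eq_add_neg]
  congr 1
  · exact Finset.sum_congr rfl fun j _ => by ring
  · ring

/-- Both sides are the second derivative of the kernel at `0`: once from the partial fractions, once
from R' = RL, which gives R'' = R(L² + L'). -/
theorem sum_resWeight_cube {N : ℕ} {x : ℝ} (hx0 : x ≠ 0) (hx : |x| < 1 / 8) :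
    2 * ∑ k ∈ Finset.range (N + 1),
      (resWeight N k x * (((k : ℝ) - x) ^ 3)⁻¹ + resWeight N k (-x) * (((k : ℝ) + x) ^ 3)⁻¹)
      = resKernel N x 0 * (resLogDeriv N x 0 ^ 2 + resLogDeriv' N x) := by
  have g0 : |(0:ℝ)| < |x| := by rw [abs_zero]; exact abs_pos.2 hx0
  have ne : ∀ s, |s| < |x| → ∀ k : ℕ, s + (k - x) ≠ 0 ∧ s + (k + x) ≠ 0 := by
    intro s hs k
    cases k with
    | zero =>
      have := (ne_of_abs_lt_abs hs hx 0).2.2.2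
      simpa [sub_eq_add_neg] using this
    | succ k =>
      have := (ne_of_abs_lt_abs hs hx k).2
      push_cast
      exact ⟨this.1, this.2.1⟩
  have hnhds : ∀ s, |s| < |x| → {s : ℝ | |s| < |x|} ∈ nhds s := fun s hs =>
    (isOpen_lt continuous_abs continuous_const).mem_nhds hs
  have d1 : ∀ s, |s| < |x| → resKernel N x s * resLogDeriv N x s =
      ∑ k ∈ Finset.range (N + 1), (resWeight N k x * -((s + (k - x)) ^ 2)⁻¹ +
        resWeight N k (-x) * -((s + (k + x)) ^ 2)⁻¹) := by
    intro s hs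
    have d := HasDerivAt.fun_sum (u := Finset.range (N + 1)) (x := s) (fun k _ =>
      ((hasDerivAt_inv_add ((k : ℝ) - x) s (ne s hs k).1).const_mul (resWeight N k x)).add
      ((hasDerivAt_inv_add ((k : ℝ) + x) s (ne s hs k).2).const_mul (resWeight N k (-x))))
    refine (hasDerivAt_resKernel hs hx N).unique (d.congr_of_eventuallyEq ?_)
    filter_upwards [hnhds s hs] with t ht
    exact resKernel_eq_sum hx0 hx (fun k => (ne t ht k).1) (fun k => (ne t ht k).2)
  have inv2 : ∀ a : ℝ, a ≠ 0 → HasDerivAt (fun s => -((s + a) ^ 2)⁻¹) (2 * (a ^ 3)⁻¹) 0 := by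
    intro a ha
    have := ((((hasDerivAt_id (0:ℝ)).add_const a).pow 2).inv (by simpa using ha)).neg
    refine this.congr_deriv ?_
    simp only [id, zero_add, Pi.pow_apply]
    field_simp
    simp [mul_comm]
  have d2 := HasDerivAt.fun_sum (u := Finset.range (N + 1)) (x := (0:ℝ)) (fun k _ =>
      ((inv2 ((k : ℝ) - x) (by simpa using (ne 0 g0 k).1)).const_mul (resWeight N k x)).add
      ((inv2 ((k : ℝ) + x) (by simpa using (ne 0 g0 k).2)).const_mul (resWeight N k (-x))))
  have d3 := (hasDerivAt_resKernel g0 hx N).mul (hasDerivAt_resLogDeriv hx0 hx N)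
  have := d3.unique (d2.congr_of_eventuallyEq (by
    filter_upwards [hnhds 0 g0] with t ht
    exact d1 t ht))
  rw [Finset.mul_sum]
  have e2 : ∀ k ∈ Finset.range (N + 1),
      2 * (resWeight N k x * (((k : ℝ) - x) ^ 3)⁻¹ + resWeight N k (-x) * (((k : ℝ) + x) ^ 3)⁻¹)
      = resWeight N k x * (2 * (((k : ℝ) - x) ^ 3)⁻¹) +
        resWeight N k (-x) * (2 * (((k : ℝ) + x) ^ 3)⁻¹) := fun k _ => by ring
  rw [Finset.sum_congr rfl e2, ← this]
  ring

/-! ### Limits of the residue sums -/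

/-- The finite form of the periodicity of the cotangent; for fixed `a` the two boundary terms vanish
as `N → ∞`. -/
theorem cotSum_add_one (N : ℕ) (a : ℝ) :
    cotSum N (a + 1) = cotSum N a + (a + 1 + N)⁻¹ - (a - N)⁻¹ := by
  induction N with
  | zero => simp [cotSum]
  | succ N ih =>
    have e : ∀ b, cotSum (N + 1) b = cotSum N b + ((b + ((N : ℝ) + 1))⁻¹ + (b - ((N : ℝ) + 1))⁻¹) := by
      intro b
      rw [cotSum, Finset.sum_range_succ, cotSum]; ring
    rw [e, e, ih]
    push_cast
    rw [show a + 1 - ((N : ℝ) + 1) = a - N by ring, show a + ((N : ℝ) + 1) = a + 1 + N by ring]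
    ring

theorem tendsto_cotSum_neg {y : ℝ} (hy : |y| < 1 / 8) :
    Filter.Tendsto (fun N => cotSum N (-y)) Filter.atTop (nhds (-cotGen y)) := by
  have h := ((summable_zetaEven (x := y) (by linarith)).hasSum.tendsto_sum_nat.const_mul (2 * y)).const_add
    (-y⁻¹)
  have e : -cotGen y = -y⁻¹ + 2 * y * zetaEven y := by rw [cotGen, one_div]; ring
  rw [e]
  refine h.congr fun N => ?_
  rw [cotSum, inv_neg, Finset.mul_sum]
  congr 1
  refine Finset.sum_congr rfl fun i _ => ?_
  have hy' := abs_lt.1 hy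
  have hi := Nat.cast_nonneg (α := ℝ) i
  have h1 : -y + ((i : ℝ) + 1) ≠ 0 := fun h => by linarith
  have h2 : -y - ((i : ℝ) + 1) ≠ 0 := fun h => by linarith
  have h3 : ((i + 1 : ℕ) : ℝ) ^ 2 - y ^ 2 = -((-y + ((i : ℝ) + 1)) * (-y - ((i : ℝ) + 1))) := by
    push_cast; ring
  rw [inv_add_inv h1 h2, h3, inv_neg]
  ring

theorem tendsto_cotSum {y : ℝ} (hy : |y| < 1 / 8) (k : ℕ) :
    Filter.Tendsto (fun N => cotSum N (k - y)) Filter.atTop (nhds (-cotGen y)) := by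
  induction k with
  | zero => simpa using tendsto_cotSum_neg hy
  | succ k ih =>
    have t1 : Filter.Tendsto (fun N : ℕ => ((k : ℝ) - y + 1 + N)⁻¹) Filter.atTop (nhds 0) :=
      tendsto_inv_atTop_zero.comp
        (Filter.tendsto_atTop_add_const_left _ _ tendsto_natCast_atTop_atTop)
    have t2 : Filter.Tendsto (fun N : ℕ => ((k : ℝ) - y - N)⁻¹) Filter.atTop (nhds 0) :=
      tendsto_inv_atBot_zero.comp (Filter.tendsto_atBot_add_const_left _ _
        (Filter.tendsto_neg_atTop_atBot.comp tendsto_natCast_atTop_atTop))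
    have h := (ih.add t1).sub t2
    rw [add_zero, sub_zero] at h
    refine h.congr fun N => ?_
    rw [← cotSum_add_one]
    push_cast
    congr 1; ring

/-- Each unit shift adds two boundary terms, of size at most 2 because their denominators stay at
least `1 / 2` in absolute value as long as `k ≤ N`. Linear growth in `k` is harmless against (k -
y)⁻². -/
theorem abs_cotSum_le {y : ℝ} (hy : |y| < 1 / 8) {k N : ℕ} (hk : k ≤ N) :
    |cotSum N (k - y)| ≤ |cotSum N (-y)| + 4 * k := by
  induction k with
  | zero => simp
  | succ k ih =>
    have hy' := abs_lt.1 hy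
    have hkN : (k : ℝ) + 1 ≤ N := by exact_mod_cast hk
    have h0 := Nat.cast_nonneg (α := ℝ) k
    have e : ((k + 1 : ℕ) : ℝ) - y = k - y + 1 := by push_cast; ring
    have b1 : |((k : ℝ) - y + 1 + N)⁻¹| ≤ 2 := by
      rw [abs_inv, abs_of_pos (by linarith)]
      calc _ ≤ ((1:ℝ)/2)⁻¹ := inv_anti₀ (by norm_num) (by linarith)
        _ = 2 := by norm_num
    have b2 : |((k : ℝ) - y - N)⁻¹| ≤ 2 := by
      rw [abs_inv, abs_of_neg (by linarith)]
      calc _ ≤ ((1:ℝ)/2)⁻¹ := inv_anti₀ (by norm_num) (by linarith)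
        _ = 2 := by norm_num
    rw [e, cotSum_add_one]
    have := ih (by omega)
    push_cast
    calc _ ≤ |cotSum N (k - y)| + |((k : ℝ) - y + 1 + N)⁻¹| + |((k : ℝ) - y - N)⁻¹| :=
          (abs_sub _ _).trans (add_le_add_left (abs_add_le _ _) _)
      _ ≤ _ := by linarith

theorem inv_natCast_succ_sub_sq_le {y : ℝ} (hy : |y| < 1 / 8) (k : ℕ) :
    ((((k + 1 : ℕ) : ℝ) - y) ^ 2)⁻¹ ≤ 4 * (((k + 1 : ℕ) : ℝ) ^ 2)⁻¹ :=
  inv_sub_sq_le hy (by exact_mod_cast (by omega))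

theorem summable_inv_sub_sq {y : ℝ} (hy : |y| < 1 / 8) :
    Summable (fun k : ℕ => (((k : ℝ) - y) ^ 2)⁻¹) := by
  refine (summable_nat_add_iff 1).1 (Summable.of_nonneg_of_le (fun k => by positivity)
    (inv_natCast_succ_sub_sq_le hy) (summable_inv_sq.mul_left 4))

theorem abs_shiftProd_le {y : ℝ} (hy : |y| < 1 / 8) (k : ℕ) :
    |shiftProd k y| ≤ 2 / |shiftGen 0 y| := by
  rw [shiftProd_eq hy, abs_div]
  gcongr
  exact (shiftGen_aux hy).2.1 k

theorem tendsto_shiftProd {y : ℝ} (hy : |y| < 1 / 8) :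
    Filter.Tendsto (fun k => shiftProd k y) Filter.atTop (nhds (shiftGen 0 y)⁻¹) := by
  have := (shiftGen_aux hy).2.2.div_const (shiftGen 0 y)
  rw [one_div] at this
  exact this.congr fun k => (shiftProd_eq hy k).symm

/-- The limit of the sums of the residues of `resKernel`, weighted by `g`. -/
def resSum (g : ℕ → ℝ) (y : ℝ) : ℝ := ∑' k : ℕ, (((k : ℝ) - y) ^ 2)⁻¹ * shiftGen k y * g k

/-- Tannery's theorem: `shiftProd (N - k) (-y)` tends to `(shiftGen 0 (-y))⁻¹`, and both products
are bounded, so (k - y)⁻² dominates. -/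
theorem tendsto_sum_resWeight {y C : ℝ} (hy : |y| < 1 / 8) {f : ℕ → ℕ → ℝ} {g : ℕ → ℝ}
    (hf : ∀ N k, k ≤ N → |f N k| ≤ C)
    (hg : ∀ k, Filter.Tendsto (fun N => f N k) Filter.atTop (nhds (g k))) :
    Filter.Tendsto (fun N => ∑ k ∈ Finset.range (N + 1), resWeight N k y * f N k) Filter.atTop
      (nhds (y / 2 * (shiftGen 0 y * shiftGen 0 (-y))⁻¹ * resSum g y)) := by
  have hyn : |-y| < 1 / 8 := by rwa [abs_neg]
  set F : ℕ → ℕ → ℝ := fun N k => if k ≤ N then resWeight N k y * f N k else 0 with hF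
  have e : ∀ N, ∑ k ∈ Finset.range (N + 1), resWeight N k y * f N k = ∑' k, F N k := by
    intro N
    rw [tsum_eq_sum (s := Finset.range (N + 1)) (fun k hk => by
      rw [hF]; dsimp only; rw [if_neg (by simpa using hk)])]
    refine Finset.sum_congr rfl fun k hk => ?_
    rw [hF]; dsimp only; rw [if_pos (by simpa [Nat.lt_succ_iff] using hk)]
  simp only [e, resSum]
  rw [← tsum_mul_left]
  have hC0 : 0 ≤ C := (abs_nonneg _).trans (hf 0 0 le_rfl)
  refine tendsto_tsum_of_dominated_convergence
    (bound := fun k => (((k : ℝ) - y) ^ 2)⁻¹ *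
      (|y / 2| * (2 / |shiftGen 0 y|) * (2 / |shiftGen 0 (-y)|) * C))
    ((summable_inv_sub_sq hy).mul_right _) (fun k => ?_) (Filter.Eventually.of_forall fun N k => ?_)
  · have h1 : Filter.Tendsto (fun N => resWeight N k y) Filter.atTop
        (nhds (y / 2 * (((k : ℝ) - y) ^ 2)⁻¹ * (shiftProd k y * (shiftGen 0 (-y))⁻¹))) :=
      (((tendsto_shiftProd hyn).comp (Filter.tendsto_sub_atTop_nat k)).const_mul _).const_mul _
    have h2 := h1.mul (hg k)
    rw [shiftProd_eq hy] at h2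
    refine Filter.Tendsto.congr' ?_ (h2.trans (le_of_eq ?_))
    · filter_upwards [Filter.eventually_ge_atTop k] with N hN
      rw [hF]; dsimp only; rw [if_pos hN]
    · congr 1
      rw [mul_inv, div_eq_mul_inv]
      ring
  · rw [hF]; dsimp only
    split_ifs with hk
    · rw [Real.norm_eq_abs, resWeight, abs_mul, abs_mul, abs_mul, abs_mul,
        abs_of_nonneg (show 0 ≤ (((k : ℝ) - y) ^ 2)⁻¹ by positivity)]
      have b1 := abs_shiftProd_le hy k
      have b2 := abs_shiftProd_le hyn (N - k)
      have b3 := hf N k hk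
      calc _ ≤ |y / 2| * (((k : ℝ) - y) ^ 2)⁻¹ * ((2 / |shiftGen 0 y|) * (2 / |shiftGen 0 (-y)|)) * C := by
            gcongr
        _ = _ := by ring
    · rw [norm_zero]; positivity

theorem abs_inv_natCast_sub_le {y : ℝ} (hy : |y| < 1 / 8) (k : ℕ) :
    |((k : ℝ) - y)⁻¹| ≤ |y|⁻¹ + 2 := by
  cases k with
  | zero => simp [abs_inv]
  | succ k =>
    have hy' := abs_lt.1 hy
    have h0 := Nat.cast_nonneg (α := ℝ) k
    push_cast
    rw [abs_inv, abs_of_pos (by linarith)]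
    have : ((k : ℝ) + 1 - y)⁻¹ ≤ ((1:ℝ)/2)⁻¹ := inv_anti₀ (by norm_num) (by linarith)
    have h2 : 0 ≤ |y|⁻¹ := by positivity
    norm_num at this
    linarith

theorem tendsto_sum_resWeight_inv {y : ℝ} (hy : |y| < 1 / 8) :
    Filter.Tendsto (fun N => ∑ k ∈ Finset.range (N + 1), resWeight N k y * ((k : ℝ) - y)⁻¹)
      Filter.atTop (nhds (y / 2 * (shiftGen 0 y * shiftGen 0 (-y))⁻¹ *
        resSum (fun k => ((k : ℝ) - y)⁻¹) y)) :=
  tendsto_sum_resWeight hy (f := fun _ k => ((k : ℝ) - y)⁻¹)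
    (fun _ k _ => abs_inv_natCast_sub_le hy k) (fun _ => tendsto_const_nhds)

/-- The limit `-cotGen y` of the cotangent sums cancels against the factor `(y * cotGen y)⁻¹` of the
residues, leaving the constant `-(1 / 2)`. -/
theorem tendsto_sum_resWeight_cot {y : ℝ} (hy0 : y ≠ 0) (hy : |y| < 1 / 8) :
    Filter.Tendsto (fun N => ∑ k ∈ Finset.range (N + 1),
        resWeight N k y * ((((k : ℝ) - y) ^ 2)⁻¹ * cotSum N (k - y)))
      Filter.atTop (nhds (-(1 / 2) * resSum (fun k => (((k : ℝ) - y) ^ 2)⁻¹) y)) := by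
  obtain ⟨B, hB⟩ := (tendsto_cotSum_neg hy).abs.bddAbove_range
  have hB' : ∀ N, |cotSum N (-y)| ≤ B := fun N => hB ⟨N, rfl⟩
  have hB0 : 0 ≤ B := (abs_nonneg _).trans (hB' 0)
  have h := tendsto_sum_resWeight hy (C := (y ^ 2)⁻¹ * B + 4 * B + 16)
    (f := fun N k => (((k : ℝ) - y) ^ 2)⁻¹ * cotSum N (k - y))
    (g := fun k => (((k : ℝ) - y) ^ 2)⁻¹ * -cotGen y) (fun N k hk => ?_)
    (fun k => (tendsto_cotSum hy k).const_mul _)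
  · refine h.trans (le_of_eq ?_)
    congr 1
    -- The cotangent does not vanish, being a product of two nonvanishing infinite products divided
    -- by `y`.
    have hne : y * cotGen y ≠ 0 := by
      rw [← shiftGen_mul_shiftGen_neg hy0 hy]
      exact mul_ne_zero (shiftGen_zero_ne_zero hy) (shiftGen_zero_ne_zero (by rwa [abs_neg]))
    have hc := right_ne_zero_of_mul hne
    rw [shiftGen_mul_shiftGen_neg hy0 hy]
    simp only [resSum, ← mul_assoc, tsum_mul_right]
    field_simp
  · have h1 := (abs_cotSum_le hy hk).trans (add_le_add_left (hB' N) _)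
    rw [abs_mul, abs_of_nonneg (show 0 ≤ (((k : ℝ) - y) ^ 2)⁻¹ by positivity)]
    refine (mul_le_mul_of_nonneg_left h1 (by positivity)).trans ?_
    cases k with
    | zero =>
      have : 0 ≤ (y ^ 2)⁻¹ * B := by positivity
      simp
      linarith
    | succ k =>
      have h2 := inv_natCast_succ_sub_sq_le hy k
      have h3 : (1:ℝ) ≤ ((k + 1 : ℕ) : ℝ) := by exact_mod_cast (by omega)
      set n : ℝ := ((k + 1 : ℕ) : ℝ)
      have h4 : (n ^ 2)⁻¹ * n ≤ 1 := by
        rw [pow_two, mul_inv, mul_assoc, inv_mul_cancel₀ (by positivity), mul_one]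
        exact inv_le_one_of_one_le₀ h3
      have h5 : (n ^ 2)⁻¹ ≤ 1 := inv_le_one_of_one_le₀ (one_le_pow₀ h3)
      have h6 : 0 ≤ (y ^ 2)⁻¹ * B := by positivity
      calc _ ≤ 4 * (n ^ 2)⁻¹ * (B + 4 * n) := by gcongr
        _ = 4 * ((n ^ 2)⁻¹ * B) + 16 * ((n ^ 2)⁻¹ * n) := by ring
        _ ≤ 4 * (1 * B) + 16 * 1 := by gcongr
        _ ≤ _ := by linarith

/-- The series `∑ 1 / (k (k - x))`. -/
def zetaShift (x : ℝ) : ℝ := ∑' k : ℕ, (((k + 1 : ℕ) : ℝ) * (((k + 1 : ℕ) : ℝ) - x))⁻¹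

theorem zetaShift_term_le {x : ℝ} (hx : |x| < 1 / 8) (k : ℕ) :
    0 ≤ (((k + 1 : ℕ) : ℝ) * (((k + 1 : ℕ) : ℝ) - x))⁻¹ ∧
    (((k + 1 : ℕ) : ℝ) * (((k + 1 : ℕ) : ℝ) - x))⁻¹ ≤ 2 * (((k + 1 : ℕ) : ℝ) ^ 2)⁻¹ := by
  have h1 : (1:ℝ) ≤ ((k + 1 : ℕ) : ℝ) := by exact_mod_cast (by omega)
  have h := half_le_sub hx h1
  set n : ℝ := ((k + 1 : ℕ) : ℝ)
  have h2 : n ^ 2 / 2 ≤ n * (n - x) := by nlinarith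
  have h3 : 0 < n ^ 2 / 2 := by positivity
  refine ⟨inv_nonneg.2 (h3.le.trans h2), ?_⟩
  calc _ ≤ (n ^ 2 / 2)⁻¹ := inv_anti₀ h3 h2
    _ = _ := by rw [inv_div]; ring

theorem summable_zetaShift {x : ℝ} (hx : |x| < 1 / 8) :
    Summable (fun k : ℕ => (((k + 1 : ℕ) : ℝ) * (((k + 1 : ℕ) : ℝ) - x))⁻¹) :=
  Summable.of_nonneg_of_le (fun k => (zetaShift_term_le hx k).1)
    (fun k => (zetaShift_term_le hx k).2) (summable_inv_sq.mul_left 2)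

/-- The series `∑ 1 / (k - x)²`. -/
def zetaSq (x : ℝ) : ℝ := ∑' k : ℕ, ((((k + 1 : ℕ) : ℝ) - x) ^ 2)⁻¹

theorem summable_zetaSq {x : ℝ} (hx : |x| < 1 / 8) :
    Summable (fun k : ℕ => ((((k + 1 : ℕ) : ℝ) - x) ^ 2)⁻¹) :=
  (summable_nat_add_iff 1).2 (summable_inv_sub_sq hx)

theorem tendsto_resLogDeriv {x : ℝ} (hx : |x| < 1 / 8) :
    Filter.Tendsto (fun N => resLogDeriv N x 0) Filter.atTop
      (nhds (-(x * (zetaShift x - zetaShift (-x))))) := by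
  have hxn : |-x| < 1 / 8 := by rwa [abs_neg]
  have h := (((summable_zetaShift hx).hasSum.sub (summable_zetaShift hxn).hasSum).mul_left
    (-x)).tendsto_sum_nat
  rw [← neg_mul]
  refine h.congr fun N => ?_
  rw [resLogDeriv]
  have : (0 - x)⁻¹ + (0 + x)⁻¹ = 0 := by rw [zero_sub, zero_add, inv_neg]; ring
  rw [this, sub_zero]
  refine Finset.sum_congr rfl fun k _ => ?_
  have hx' := abs_lt.1 hx
  have h0 := Nat.cast_nonneg (α := ℝ) k
  have h1 : (k : ℝ) + 1 ≠ 0 := by positivity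
  have h2 : (k : ℝ) + 1 - x ≠ 0 := fun h => by linarith
  have h3 : (k : ℝ) + 1 + x ≠ 0 := fun h => by linarith
  push_cast
  rw [zero_add, zero_add, zero_add, sub_neg_eq_add]
  field_simp
  ring

theorem tendsto_resLogDeriv' {x : ℝ} (hx : |x| < 1 / 8) :
    Filter.Tendsto (fun N => resLogDeriv' N x) Filter.atTop
      (nhds (zetaSq x + zetaSq (-x) - 2 * zetaSq 0 + 2 * (x ^ 2)⁻¹)) := by
  have hxn : |-x| < 1 / 8 := by rwa [abs_neg]
  have h := ((((summable_zetaSq hx).hasSum.add (summable_zetaSq hxn).hasSum).sub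
    ((summable_zetaSq (x := 0) (by norm_num)).hasSum.mul_left 2)).tendsto_sum_nat).add_const
    (2 * (x ^ 2)⁻¹)
  refine h.congr fun N => ?_
  rw [resLogDeriv']
  congr 1
  refine Finset.sum_congr rfl fun k _ => ?_
  push_cast
  rw [sub_neg_eq_add, sub_zero]

/-! ### Evaluation of the generating function of ζ⋆(4, {2}^n) -/

/-- The generating function of `ζ⋆(4, 2, …, 2)`. -/
def fourGen (x : ℝ) : ℝ := ∑' k : ℕ, (((k + 1 : ℕ) : ℝ) ^ 4)⁻¹ * starGen k x

theorem tendsto_fourGen {x : ℝ} (hx : |x| < 1 / 8) :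
    Filter.Tendsto (fun N => ∑ i ∈ Finset.range N,
      (((i : ℝ) + 1) ^ 2)⁻¹ * resKernel N x ((i : ℝ) + 1)) Filter.atTop (nhds (fourGen x)) := by
  have hx1 : |x| ≤ 1 / 2 := by linarith
  set F : ℕ → ℕ → ℝ := fun N i => if i < N then
    (((i + 1 : ℕ) : ℝ) ^ 4)⁻¹ * (starGen i x / starGen (i + (N + 1)) x) else 0 with hF
  have e : ∀ N, ∑ i ∈ Finset.range N, (((i : ℝ) + 1) ^ 2)⁻¹ * resKernel N x ((i : ℝ) + 1)
      = ∑' i, F N i := by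
    intro N
    rw [tsum_eq_sum (s := Finset.range N) (fun k hk => by
      rw [hF]; dsimp only; rw [if_neg (by simpa using hk)])]
    refine Finset.sum_congr rfl fun k hk => ?_
    rw [hF]; dsimp only; rw [if_pos (by simpa using hk), resKernel_natCast hx, ← mul_assoc,
      ← mul_inv, ← pow_add]
    push_cast
    rfl
  simp only [e, fourGen]
  refine tendsto_tsum_of_dominated_convergence (bound := fun k => (((k + 1 : ℕ) : ℝ) ^ 2)⁻¹ * 2)
    (summable_inv_sq.mul_right 2) (fun k => ?_) (Filter.Eventually.of_forall fun N k => ?_)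
  · have h1 : Filter.Tendsto (fun N => starGen (k + (N + 1)) x) Filter.atTop (nhds 1) :=
      (starGen_aux hx1).2.2.comp (Filter.tendsto_atTop_mono
        (fun N => show N ≤ k + (N + 1) by omega) Filter.tendsto_id)
    have h2 := ((tendsto_const_nhds (x := starGen k x)).div h1 one_ne_zero).const_mul
      ((((k + 1 : ℕ) : ℝ) ^ 4)⁻¹)
    rw [div_one] at h2
    refine h2.congr' ?_
    filter_upwards [Filter.eventually_gt_atTop k] with N hN
    rw [hF]; dsimp only; rw [if_pos hN]; rfl
  · rw [hF]; dsimp only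
    split_ifs
    · have h1 := one_le_starGen hx1 (k + (N + 1))
      have h2 := (le_abs_self _).trans ((starGen_aux hx1).2.1 k)
      have h3 := one_le_starGen hx1 k
      have hk : (1:ℝ) ≤ ((k + 1 : ℕ) : ℝ) := by exact_mod_cast (by omega)
      rw [Real.norm_eq_abs, abs_of_nonneg (by positivity)]
      have a1 : starGen k x / starGen (k + (N + 1)) x ≤ 2 := by
        rw [div_le_iff₀ (by linarith)]; linarith
      have a2 : (((k + 1 : ℕ) : ℝ) ^ 4)⁻¹ ≤ (((k + 1 : ℕ) : ℝ) ^ 2)⁻¹ :=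
        inv_anti₀ (by positivity) (pow_le_pow_right₀ hk (by norm_num))
      gcongr
    · rw [norm_zero]; positivity

/-- From k (k-x)⁻⁴ = (k-x)⁻³ + x (k-x)⁻⁴. The index `k = 0`, present in `resSum` but not in
`altGen`, contributes -x⁻³ + x·x⁻⁴ = 0. -/
theorem altGen_eq_resSum {x : ℝ} (hx0 : x ≠ 0) (hx : |x| < 1 / 8) :
    altGen x = resSum (fun k => ((k : ℝ) - x)⁻¹) x + x * resSum (fun k => (((k : ℝ) - x) ^ 2)⁻¹) x := by
  have hsum : ∀ (g : ℕ → ℝ) (C : ℝ), (∀ k, |g k| ≤ C) →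
      Summable (fun k : ℕ => (((k : ℝ) - x) ^ 2)⁻¹ * shiftGen k x * g k) := by
    intro g C hg
    refine Summable.of_norm_bounded ((summable_inv_sub_sq hx).mul_right (2 * C)) fun k => ?_
    rw [Real.norm_eq_abs, abs_mul, abs_mul,
      abs_of_nonneg (show 0 ≤ (((k : ℝ) - x) ^ 2)⁻¹ by positivity), mul_assoc]
    have := (shiftGen_aux hx).2.1 k
    have := hg k
    gcongr
  have s1 := hsum _ _ (abs_inv_natCast_sub_le hx)
  have s2 := hsum (fun k => (((k : ℝ) - x) ^ 2)⁻¹) ((|x|⁻¹ + 2) ^ 2) (fun k => by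
    rw [← inv_pow, abs_pow]
    exact pow_le_pow_left₀ (abs_nonneg _) (abs_inv_natCast_sub_le hx k) 2)
  rw [resSum, resSum, ← tsum_mul_left, ← s1.tsum_add (s2.mul_left x),
    (s1.add (s2.mul_left x)).tsum_eq_zero_add]
  have hz : (((0 : ℕ) : ℝ) - x) ≠ 0 := by simpa using hx0
  have e0 : ((((0 : ℕ) : ℝ) - x) ^ 2)⁻¹ * shiftGen 0 x * (((0 : ℕ) : ℝ) - x)⁻¹ +
      x * (((((0 : ℕ) : ℝ) - x) ^ 2)⁻¹ * shiftGen 0 x * ((((0 : ℕ) : ℝ) - x) ^ 2)⁻¹) = 0 := by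
    rw [Nat.cast_zero, zero_sub]
    field_simp
    ring
  rw [e0, zero_add, altGen]
  refine tsum_congr fun k => ?_
  have h2 : ((k + 1 : ℕ) : ℝ) - x ≠ 0 := by
    have := half_le_sub hx (N := ((k + 1 : ℕ) : ℝ)) (by exact_mod_cast (by omega))
    have h1 : (0:ℝ) < ((k + 1 : ℕ) : ℝ) := by positivity
    intro h; linarith
  field_simp
  ring

/-- The limit of `sum_resKernel`. The cubic sums of the odd part of `altGen` are not produced
directly; they are recovered from `resKernel N x 0`, whose two evaluations are compared in `l1`. -/
theorem fourGen_eq {x : ℝ} (hx0 : x ≠ 0) (hx : |x| < 1 / 8) :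
    fourGen x = -((altGen x - altGen (-x)) / (2 * x)) + starGen 0 x / x ^ 2 *
      (2 * zetaEven x - 3 * zetaSq 0 + x ^ 2 * (zetaShift x - zetaShift (-x)) ^ 2 / 2 +
        (zetaSq x + zetaSq (-x)) / 2) := by
  have hx1 : |x| ≤ 1 / 2 := by linarith
  have hxn0 : -x ≠ 0 := neg_ne_zero.2 hx0
  have hxn : |-x| < 1 / 8 := by rwa [abs_neg]
  have hcot := shiftGen_mul_shiftGen_neg hx0 hx
  have hne : x * cotGen x ≠ 0 := by
    rw [← hcot]
    exact mul_ne_zero (shiftGen_zero_ne_zero hx) (shiftGen_zero_ne_zero hxn)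
  have hc := right_ne_zero_of_mul hne
  have hr : Filter.Tendsto (fun N => resKernel N x 0) Filter.atTop
      (nhds (-(1 / x ^ 2) * starGen 0 x)) := by
    have h2 := ((tendsto_const_nhds (x := starGen 0 x)).div (starGen_aux hx1).2.2
      one_ne_zero).const_mul (-(1 / x ^ 2))
    rw [div_one] at h2
    exact h2.congr fun N => (resKernel_zero hx N).symm
  have l1 : -(1 / x ^ 2) * starGen 0 x = x / 2 * (x * cotGen x)⁻¹ *
      (resSum (fun k => ((k : ℝ) - x)⁻¹) x - resSum (fun k => ((k : ℝ) - -x)⁻¹) (-x)) := by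
    have h := (tendsto_sum_resWeight_inv hx).add (tendsto_sum_resWeight_inv hxn)
    rw [neg_neg, mul_comm (shiftGen 0 (-x)), hcot] at h
    refine tendsto_nhds_unique hr (Filter.Tendsto.congr (fun N => ?_) (h.trans (le_of_eq ?_)))
    · have g1 : ∀ z : ℤ, (z : ℝ) + x ≠ 0 := natCast_sub_ne hx0 hx
      have g2 : ∀ z : ℤ, (z : ℝ) + -x ≠ 0 := natCast_sub_ne hxn0 hxn
      rw [resKernel_eq_sum hx0 hx
        (fun k => by have := g2 k; push_cast at this; rwa [zero_add])
        (fun k => by have := g1 k; push_cast at this; rwa [zero_add]), ← Finset.sum_add_distrib]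
      refine Finset.sum_congr rfl fun k _ => ?_
      rw [zero_add, zero_add, sub_neg_eq_add]
    · congr 1; ring
  have hz : Filter.Tendsto (fun N => ∑ i ∈ Finset.range N, (((i : ℝ) + 1) ^ 2)⁻¹) Filter.atTop
      (nhds (zetaSq 0)) := by
    refine (summable_zetaSq (x := 0) (by norm_num)).hasSum.tendsto_sum_nat.congr fun N => ?_
    refine Finset.sum_congr rfl fun k _ => ?_
    push_cast
    rw [sub_zero]
  have l2 := tendsto_nhds_unique (tendsto_fourGen hx) (Filter.Tendsto.congr (fun N => ?_)
    ((((hz.const_mul 2).mul hr).add ((tendsto_sum_resWeight_cot hx0 hx).add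
      (tendsto_sum_resWeight_cot hxn0 hxn))).sub
      ((hr.mul (((tendsto_resLogDeriv hx).pow 2).add (tendsto_resLogDeriv' hx))).div_const 2)))
  · rw [l2, altGen_eq_resSum hx0 hx, altGen_eq_resSum hxn0 hxn]
    generalize resSum (fun k => ((k : ℝ) - x)⁻¹) x = P at *
    generalize resSum (fun k => ((k : ℝ) - -x)⁻¹) (-x) = P' at *
    generalize resSum (fun k => (((k : ℝ) - x) ^ 2)⁻¹) x = Q at *
    generalize resSum (fun k => (((k : ℝ) - -x) ^ 2)⁻¹) (-x) = Q' at *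
    -- The partial fraction expansion at `s = 0`, solved for the difference of the cubic sums.
    have l3 : P - P' = -(2 * cotGen x * starGen 0 x / x ^ 2) := by
      field_simp at l1 ⊢
      linear_combination -l1
    have l4 : cotGen x = 1 / x - 2 * x * zetaEven x := rfl
    rw [l4] at l3
    have l5 : (P + x * Q - (P' + -x * Q')) / (2 * x) = (P - P') / (2 * x) + (Q + Q') / 2 := by
      field_simp
      ring
    rw [l5, l3]
    field_simp
    ring
  · rw [sum_resKernel hx0 hx, ← sum_resWeight_cube hx0 hx, ← Finset.sum_add_distrib]
    simp only [sub_neg_eq_add]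
    ring

/-! ### Single zeta values and relations from the cotangent -/

theorem hasSum_mzv_single (n : ℕ) :
    HasSum (fun k : ℕ => (((k + 1 : ℕ) : ℝ) ^ (n + 2))⁻¹) (mzv [n + 2]) := by
  rw [mzv_eq_nested]
  exact (hasSum_nested_single 1 n 0).replace (fun k => by rw [show 0 + 1 + k = k + 1 by ring]) rfl

theorem seriesRep_zetaShift : SeriesRep (1 / 8) (fun n => mzv [n + 2]) zetaShift := by
  have h := SeriesRep.tsum_of_nonneg (fun k : ℕ =>
      ((seriesRep_inv_pow 0 (N := ((k + 1 : ℕ) : ℝ))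
        (by exact_mod_cast (by omega))).mono (r' := 1 / 8) (by norm_num)).const_mul
          (((k + 1 : ℕ) : ℝ))⁻¹)
      (fun k n => by positivity)
      (fun x h0 hx => (summable_zetaShift (x := x) (by rwa [abs_of_nonneg h0])).congr fun k => by
        rw [mul_inv, zero_add, pow_one])
  convert h using 1
  · funext n
    rw [← (hasSum_mzv_single n).tsum_eq]
    refine tsum_congr fun k => ?_
    rw [Nat.choose_zero_right, Nat.cast_one, one_mul, ← mul_inv, pow_succ' _ (n + 1), add_zero]
  · funext x
    refine tsum_congr fun k => ?_
    rw [mul_inv, zero_add, pow_one]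

theorem seriesRep_zetaSq : SeriesRep (1 / 8) (fun n => ((n : ℝ) + 1) * mzv [n + 2]) zetaSq := by
  have h := SeriesRep.tsum_of_nonneg (fun k : ℕ =>
      (seriesRep_inv_pow 1 (N := ((k + 1 : ℕ) : ℝ))
        (by exact_mod_cast (by omega))).mono (r' := 1 / 8) (by norm_num))
      (fun k n => by positivity)
      (fun x h0 hx => summable_zetaSq (x := x) (by rwa [abs_of_nonneg h0]))
  convert h using 1
  · funext n
    rw [← (hasSum_mzv_single n).tsum_eq, ← tsum_mul_left]
    refine tsum_congr fun k => ?_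
    rw [Nat.choose_one_right]
    push_cast
    rfl
  · rfl

theorem hasDerivAt_mul_zetaShift {x : ℝ} (hx : |x| < 1 / 8) :
    HasDerivAt (fun u => u * zetaShift u) (zetaSq x) x := by
  have h : SeriesRep (1 / 8) _ (fun u => u * zetaShift u) :=
    (seriesRep_zetaShift.pow_mul 1).congr fun x _ => by rw [pow_one]
  have h2 := (h.hasDerivAt hx).differentiableAt.hasDerivAt
  refine h2.congr_deriv ((h.deriv.hasSum hx).unique
    ((seriesRep_zetaSq.hasSum hx).replace (fun n => ?_) rfl))
  rw [if_pos (by omega), Nat.add_sub_cancel]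

theorem zetaEven_eq {x : ℝ} (hx : |x| < 1 / 8) :
    zetaEven x = (zetaShift x + zetaShift (-x)) / 2 := by
  have hxn : |-x| < 1 / 8 := by rwa [abs_neg]
  rw [zetaShift, zetaShift, ← (summable_zetaShift hx).tsum_add (summable_zetaShift hxn),
    ← tsum_div_const, zetaEven]
  refine tsum_congr fun k => ?_
  have h1 : (1:ℝ) ≤ ((k + 1 : ℕ) : ℝ) := by exact_mod_cast (by omega)
  have h2 := half_le_sub hx h1
  have h3 := half_le_sub hxn h1
  generalize ((k + 1 : ℕ) : ℝ) = n at *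
  have h4 : n - x ≠ 0 := fun h => by linarith
  have h5 : n - -x ≠ 0 := fun h => by linarith
  have h6 : n ^ 2 - x ^ 2 = (n - x) * (n - -x) := by ring
  have h7 : n ≠ 0 := by positivity
  rw [h6]
  field_simp
  ring

theorem real_sin_pi_mul_ne_zero {x : ℝ} (hx0 : x ≠ 0) (hx : |x| ≤ 1 / 2) : Real.sin (Real.pi * x) ≠ 0 := by
  intro h0
  have h := starGen_eq_sin hx
  rw [h0, mul_zero] at h
  exact mul_ne_zero Real.pi_ne_zero hx0 h.symm

theorem zetaSq_zero : zetaSq 0 = Real.pi ^ 2 / 6 := by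
  have h := (hasSum_nat_add_iff' 1).2 hasSum_zeta_two
  simp only [Finset.sum_range_one, Nat.cast_zero] at h
  rw [zero_pow (by norm_num), div_zero, sub_zero] at h
  rw [← h.tsum_eq, zetaSq]
  exact tsum_congr fun k => by rw [sub_zero, one_div]

theorem eventually_abs_lt {x r : ℝ} (hx : |x| < r) : ∀ᶠ y in nhds x, |y| < r :=
  (isOpen_lt continuous_abs continuous_const).mem_nhds hx

theorem hasDerivAt_cotGen {x : ℝ} (hx0 : x ≠ 0) (hx : |x| < 1 / 8) :
    HasDerivAt cotGen (-(x ^ 2)⁻¹ - zetaSq x - zetaSq (-x)) x := by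
  have hxn : |-x| < 1 / 8 := by rwa [abs_neg]
  have h := ((hasDerivAt_inv hx0).sub (hasDerivAt_mul_zetaShift hx)).add
    (HasDerivAt.scomp x (hasDerivAt_mul_zetaShift hxn) (hasDerivAt_neg x))
  refine (h.congr_of_eventuallyEq ?_).congr_deriv ?_
  · filter_upwards [eventually_abs_lt hx] with y hy
    rw [cotGen, zetaEven_eq hy]
    simp only [Pi.add_apply, Pi.sub_apply, Function.comp_apply]
    rw [one_div]
    ring
  · simp only [smul_eq_mul]
    ring

theorem hasDerivAt_sin_pi (x : ℝ) : HasDerivAt (fun x => Real.sin (Real.pi * x))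
    (Real.cos (Real.pi * x) * Real.pi) x := by
  have h := (Real.hasDerivAt_sin (Real.pi * x)).comp x ((hasDerivAt_id x).const_mul Real.pi)
  rw [mul_one] at h
  exact h

theorem hasDerivAt_cos_pi (x : ℝ) : HasDerivAt (fun x => Real.cos (Real.pi * x))
    (-Real.sin (Real.pi * x) * Real.pi) x := by
  have h := (Real.hasDerivAt_cos (Real.pi * x)).comp x ((hasDerivAt_id x).const_mul Real.pi)
  rw [mul_one] at h
  exact h

theorem eventually_ne_zero {x : ℝ} (hx : x ≠ 0) : ∀ᶠ y in nhds x, y ≠ 0 :=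
  isOpen_ne.mem_nhds hx

/-- The differential equation of c(x) = π cot πx, namely c' + c² + π² = 0, written through c = 1/x -
2xZ and c' = -x⁻² - ∑ (k-x)⁻² - ∑ (k+x)⁻². The number π² enters as `6 * zetaSq 0`. -/
theorem zetaEven_sq {x : ℝ} (hx0 : x ≠ 0) (hx : |x| < 1 / 8) :
    2 * x ^ 2 * zetaEven x ^ 2 = 2 * zetaEven x + (zetaSq x + zetaSq (-x)) / 2 - 3 * zetaSq 0 := by
  have hs := real_sin_pi_mul_ne_zero hx0 (by linarith : |x| ≤ 1 / 2)
  have d1 := (hasDerivAt_cotGen hx0 hx).mul (hasDerivAt_sin_pi x)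
  have d2 := (hasDerivAt_cos_pi x).const_mul Real.pi
  have h := d1.unique (d2.congr_of_eventuallyEq (by
    filter_upwards [eventually_abs_lt hx, eventually_ne_zero hx0] with y hy hy0
    exact cotGen_mul_sin hy0 (by linarith)))
  have h1 := cotGen_mul_sin hx0 (by linarith : |x| < 1 / 2)
  have h2 : -(x ^ 2)⁻¹ - zetaSq x - zetaSq (-x) + cotGen x ^ 2 + Real.pi ^ 2 = 0 := by
    apply mul_right_cancel₀ hs
    linear_combination h + cotGen x * h1
  have h3 : cotGen x ^ 2 = (x ^ 2)⁻¹ - 4 * zetaEven x + 4 * x ^ 2 * zetaEven x ^ 2 := by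
    rw [cotGen]
    field_simp
    ring
  rw [h3] at h2
  rw [zetaSq_zero]
  linear_combination h2 / 2

/-- From 1/sin θ = cot(θ/2) - cot θ at θ = πx. -/
theorem starGen_eq_cot {x : ℝ} (hx0 : x ≠ 0) (hx : |x| < 1 / 8) :
    starGen 0 x = 1 + 2 * x ^ 2 * zetaEven x - x ^ 2 * zetaEven (x / 2) := by
  have hx2 : |x / 2| < 1 / 2 := by rw [abs_div, abs_two]; linarith
  have hx20 : x / 2 ≠ 0 := div_ne_zero hx0 two_ne_zero
  have hs := real_sin_pi_mul_ne_zero hx0 (by linarith : |x| ≤ 1 / 2)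
  have hs2 := real_sin_pi_mul_ne_zero hx20 hx2.le
  have e := starGen_eq_sin (by linarith : |x| ≤ 1 / 2)
  have c1 := cotGen_mul_sin hx0 (by linarith : |x| < 1 / 2)
  have c2 := cotGen_mul_sin hx20 hx2
  have t1 : Real.sin (Real.pi * x) = 2 * Real.sin (Real.pi * (x / 2)) * Real.cos (Real.pi * (x / 2)) := by
    rw [← Real.sin_two_mul]; congr 1; ring
  have t2 : Real.cos (Real.pi * x) = 2 * Real.cos (Real.pi * (x / 2)) ^ 2 - 1 := by
    rw [← Real.cos_two_mul]; congr 1; ring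
  have h : starGen 0 x = x * (cotGen (x / 2) - cotGen x) := by
    apply mul_right_cancel₀ hs
    rw [t1, t2] at c1
    rw [e, t1]
    linear_combination x * c1 - 2 * x * Real.cos (Real.pi * (x / 2)) * c2
  rw [h, cotGen, cotGen]
  field_simp
  ring

theorem hasDerivAt_starGen {x : ℝ} (hx0 : x ≠ 0) (hx : |x| < 1 / 8) :
    HasDerivAt (starGen 0) (2 * x * zetaEven x * starGen 0 x) x := by
  have hs := real_sin_pi_mul_ne_zero hx0 (by linarith : |x| ≤ 1 / 2)
  have e := starGen_eq_sin (by linarith : |x| ≤ 1 / 2)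
  have c1 := cotGen_mul_sin hx0 (by linarith : |x| < 1 / 2)
  have d := ((hasDerivAt_id x).const_mul Real.pi).div (hasDerivAt_sin_pi x) hs
  refine (d.congr_of_eventuallyEq ?_).congr_deriv ?_
  · filter_upwards [eventually_abs_lt hx, eventually_ne_zero hx0] with y hy hy0
    have := starGen_eq_sin (by linarith : |y| ≤ 1 / 2)
    rw [Pi.div_apply, eq_div_iff (real_sin_pi_mul_ne_zero hy0 (by linarith)), this]
    rfl
  · have hz : 2 * x * zetaEven x = 1 / x - cotGen x := by rw [cotGen]; ring
    rw [hz, div_eq_iff (pow_ne_zero 2 hs)]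
    simp only [id]
    field_simp
    linear_combination (Real.sin (Real.pi * x) * (x * cotGen x - 1)) * e + Real.pi * x ^ 2 * c1

/-- The logarithmic derivative of S in `x` is `2 * x * zetaEven x`, so its derivative in the
variable `x ^ 2` is `zetaEven x * starGen 0 x`; differentiating termwise brings down `n + 1`. -/
theorem evenRep_starGen_deriv : EvenRep (1 / 8)
    (PowerSeries.mk fun n => ((n : ℝ) + 1) * mzvStar (rep 2 (n + 1)))
    (fun x => zetaEven x * starGen 0 x) := by
  have h := (seriesRep_starGen 0).deriv.evenRep (ρ := 1 / 8) (by norm_num)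
  simp only [mzvStar_eq_nested]
  refine h.congr fun x h0 hx => ?_
  have hx' : |x| < 1 / 8 := by rwa [abs_of_pos h0]
  have hx2 : |x ^ 2| < 1 / 4 := by rw [abs_of_pos (by positivity)]; nlinarith
  have d := ((seriesRep_starGen 0).hasDerivAt hx2).differentiableAt.hasDerivAt
  have d2 := HasDerivAt.comp (h := fun x => x ^ 2) x d (hasDerivAt_pow 2 x)
  have := d2.unique (hasDerivAt_starGen h0.ne' hx')
  apply mul_left_cancel₀ (show 2 * x ≠ 0 by positivity)
  rw [← mul_assoc, ← this]
  push_cast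
  ring

theorem evenRep_zetaEven : EvenRep (1 / 8) (PowerSeries.mk fun n => mzv [2 * n + 2]) zetaEven :=
  seriesRep_zetaShift.even.congr fun x h0 hx => (zetaEven_eq (by rwa [abs_of_pos h0])).symm

theorem evenRep_zetaEven_half : EvenRep (1 / 8)
    (PowerSeries.mk fun n => mzv [2 * n + 2] / 4 ^ n) (fun x => zetaEven (x / 2)) := by
  intro x h0 hx
  have e : ∀ n : ℕ, ((x / 2) ^ 2) ^ n = (x ^ 2) ^ n / 4 ^ n := fun n => by
    rw [div_pow, div_pow, show (2:ℝ) ^ 2 = 4 by norm_num]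
  obtain ⟨h1, h2⟩ := evenRep_zetaEven (x / 2) (by linarith) (by linarith)
  refine ⟨h1.congr fun n => ?_, h2.replace (fun n => ?_) rfl⟩
  · rw [PowerSeries.coeff_mk, PowerSeries.coeff_mk, abs_div, e,
      abs_of_nonneg (show (0:ℝ) ≤ 4 ^ n by positivity)]
    ring
  · rw [PowerSeries.coeff_mk, PowerSeries.coeff_mk, e]
    ring

/-! ### A finite Gauss summation and its limit -/

/-- The product `∏_{1 ≤ i ≤ k} (1 + u / i)`. -/
def upProd (u : ℝ) (k : ℕ) : ℝ := ∏ i ∈ Finset.range k, (1 + u / ((i + 1 : ℕ) : ℝ))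

/-- Lagrange interpolation of ∏ (z + j + 1 - u), of degree `N` in `z`, at the nodes 0, -1, …, -N,
evaluated at z = -v. The node 0 gives `upProd (-u) N`, and the node -(j+1) gives the `j`-th summand.
-/
theorem prod_sub_eq_sum (u : ℝ) {v : ℝ} (hv0 : v ≠ 0) (hv : |v| < 1 / 8) (N : ℕ) :
    ∏ m ∈ Finset.range N, (((m + 1 : ℕ) : ℝ) - (u + v)) =
      (∏ m ∈ Finset.range N, (((m + 1 : ℕ) : ℝ) - v)) * (upProd (-u) N -
        v * ∑ j ∈ Finset.range N, u * (((j + 1 : ℕ) : ℝ) * (((j + 1 : ℕ) : ℝ) - v))⁻¹ *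
          (upProd u j * upProd (-u) (N - 1 - j))) := by
  classical
  let w : ℕ → ℝ := fun k => -k
  let S : Finset ℕ := Finset.range (N + 1)
  have hinj : Function.Injective w := fun a b h => by
    simpa [w] using h
  let P : Polynomial ℝ := ∏ j ∈ Finset.range N, (Polynomial.X + Polynomial.C ((j : ℝ) + 1 - u))
  have hPe : ∀ z, P.eval z = ∏ j ∈ Finset.range N, (z + ((j : ℝ) + 1 - u)) := fun z => by
    simp [P, Polynomial.eval_prod]
  have hPdeg : P.degree < S.card := by
    have h : P.degree ≤ (N : ℕ) := by
      refine (Polynomial.degree_prod_le _ _).trans ?_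
      calc ∑ j ∈ Finset.range N, (Polynomial.X + Polynomial.C ((j : ℝ) + 1 - u)).degree
          = ∑ j ∈ Finset.range N, (1 : WithBot ℕ) := by
            exact Finset.sum_congr rfl fun j _ => Polynomial.degree_X_add_C _
        _ ≤ _ := by
          rw [Finset.sum_const, Finset.card_range]
          simp
    refine h.trans_lt ?_
    have : S.card = N + 1 := by simp [S]
    rw [this]
    exact_mod_cast (by omega)
  have hL := Lagrange.eq_interpolate (s := S) (v := w) hinj.injOn hPdeg
  have hvk : ∀ k : ℕ, ((k + 1 : ℕ) : ℝ) - v ≠ 0 := fun k => by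
    have := half_le_sub hv (N := ((k + 1 : ℕ) : ℝ)) (by exact_mod_cast (by omega))
    have h1 : (0:ℝ) < ((k + 1 : ℕ) : ℝ) := by positivity
    intro h; linarith
  have hs : ∀ i ∈ S, -v ≠ w i := by
    intro i _ h
    cases i with
    | zero => simp [w] at h; exact hv0 h
    | succ k => exact hvk k (by simp only [w] at h; linarith)
  have hE := Lagrange.eval_interpolate_not_at_node (s := S) (v := w)
    (fun i => P.eval (w i)) (x := -v) hs
  rw [← hL, hPe, Lagrange.eval_nodal, Finset.prod_range_succ', Finset.sum_range_succ'] at hE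
  have hw : ∀ i ∈ S, Lagrange.nodalWeight S w i
      = ∏ p ∈ S, (if p = i then 1 else ((p : ℝ) - i)⁻¹) := by
    intro i hi
    rw [Lagrange.nodalWeight, ← Finset.mul_prod_erase S _ hi, if_pos rfl, one_mul]
    refine Finset.prod_congr rfl fun p hp => ?_
    rw [if_neg (Finset.ne_of_mem_erase hp)]
    congr 1
    simp only [w]; ring
  have e0 : Lagrange.nodalWeight S w 0 * P.eval (w 0) = upProd (-u) N := by
    rw [hw 0 (by simp [S]), hPe, Finset.prod_range_succ']
    simp only [if_true, mul_one]
    rw [← Finset.prod_mul_distrib, upProd]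
    refine Finset.prod_congr rfl fun i _ => ?_
    rw [if_neg (by omega)]
    simp only [w]
    push_cast
    have : (i : ℝ) + 1 ≠ 0 := by positivity
    field_simp
    ring
  have ej : ∀ j ∈ Finset.range N, Lagrange.nodalWeight S w (j + 1) * P.eval (w (j + 1)) =
      u * (((j + 1 : ℕ) : ℝ))⁻¹ * (upProd u j * upProd (-u) (N - 1 - j)) := by
    intro j hj
    have hj' := Finset.mem_range.1 hj
    obtain ⟨l, rfl⟩ : ∃ l, N = j + l + 1 := ⟨N - 1 - j, by omega⟩
    have e1 : S = Finset.range ((j + 1) + l + 1) := by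
      simp only [S]; congr 1; ring
    have e2 : j + l + 1 - 1 - j = l := by omega
    rw [hw _ (Finset.mem_range.2 (by omega)), hPe, e1, prod_range_split _ (j + 1) l,
      prod_range_split _ j l, if_pos rfl, mul_one, e2, Finset.prod_range_succ (fun i =>
      if j + 1 - 1 - i = j + 1 then (1:ℝ) else (((j + 1 - 1 - i : ℕ) : ℝ) - ((j + 1 : ℕ) : ℝ))⁻¹)]
    have a1 : (∏ i ∈ Finset.range j, (if j + 1 - 1 - i = j + 1 then (1:ℝ) else
        (((j + 1 - 1 - i : ℕ) : ℝ) - ((j + 1 : ℕ) : ℝ))⁻¹)) *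
        ∏ i ∈ Finset.range j, (w (j + 1) + (((j - 1 - i : ℕ) : ℝ) + 1 - u)) = upProd u j := by
      rw [← Finset.prod_mul_distrib, upProd]
      refine Finset.prod_congr rfl fun i hi => ?_
      have hi' := Finset.mem_range.1 hi
      have c1 : ((j + 1 - 1 - i : ℕ) : ℝ) = j - i := by
        rw [Nat.add_sub_cancel, Nat.cast_sub hi'.le]
      have c2 : ((j - 1 - i : ℕ) : ℝ) = j - 1 - i := by
        rw [Nat.cast_sub (by omega), Nat.cast_sub (by omega)]; simp
      rw [if_neg (by omega), c1, c2]
      simp only [w]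
      push_cast
      have : (i : ℝ) + 1 ≠ 0 := by positivity
      rw [show (j : ℝ) - i - (j + 1) = -(i + 1) by ring, inv_neg]
      field_simp
      ring
    have a2 : (∏ i ∈ Finset.range l, (if j + 1 + (i + 1) = j + 1 then (1:ℝ) else
        (((j + 1 + (i + 1) : ℕ) : ℝ) - ((j + 1 : ℕ) : ℝ))⁻¹)) *
        ∏ i ∈ Finset.range l, (w (j + 1) + (((j + (i + 1) : ℕ) : ℝ) + 1 - u)) = upProd (-u) l := by
      rw [← Finset.prod_mul_distrib, upProd]
      refine Finset.prod_congr rfl fun i hi => ?_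
      rw [if_neg (by omega)]
      simp only [w]
      push_cast
      have : (i : ℝ) + 1 ≠ 0 := by positivity
      rw [show (j : ℝ) + 1 + (i + 1) - (j + 1) = i + 1 by ring]
      field_simp
      ring
    have a3 : (if j + 1 - 1 - j = j + 1 then (1:ℝ) else
        (((j + 1 - 1 - j : ℕ) : ℝ) - ((j + 1 : ℕ) : ℝ))⁻¹) * (w (j + 1) + ((j : ℝ) + 1 - u))
        = u * (((j + 1 : ℕ) : ℝ))⁻¹ := by
      rw [if_neg (by omega), Nat.add_sub_cancel, Nat.sub_self]
      simp only [w]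
      push_cast
      rw [zero_sub, inv_neg]
      ring
    rw [← a1, ← a2, ← a3]
    ring
  have h1 : ∏ m ∈ Finset.range N, (-v - w (m + 1)) = ∏ m ∈ Finset.range N, (((m + 1 : ℕ) : ℝ) - v) :=
    Finset.prod_congr rfl fun m _ => by simp only [w]; ring
  have h2 : ∏ m ∈ Finset.range N, (-v + ((m : ℝ) + 1 - u)) =
      ∏ m ∈ Finset.range N, (((m + 1 : ℕ) : ℝ) - (u + v)) :=
    Finset.prod_congr rfl fun m _ => by push_cast; ring
  have h3 : ∀ i, Lagrange.nodalWeight S w i * (-v - w i)⁻¹ * P.eval (w i) =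
      (-v - w i)⁻¹ * (Lagrange.nodalWeight S w i * P.eval (w i)) := fun i => by ring
  rw [h1, h2] at hE
  rw [hE]
  simp only [h3]
  rw [e0, Finset.sum_congr rfl fun j hj => by rw [ej j hj], mul_assoc]
  congr 1
  have h4 : -v - w 0 = -v := by simp [w]
  rw [h4, mul_add, ← mul_assoc (-v), mul_inv_cancel₀ (neg_ne_zero.2 hv0), one_mul, add_comm,
    neg_mul, ← sub_eq_add_neg]
  congr 2
  refine Finset.sum_congr rfl fun j _ => ?_
  rw [mul_inv, show -v - w (j + 1) = ((j + 1 : ℕ) : ℝ) - v by simp only [w]; ring]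
  ring

/-- The quotient of `upProd (-u) l` by `upProd (-u) (l + j + 1)`. -/
def upQuot (u : ℝ) (j l : ℕ) : ℝ := ∏ i ∈ Finset.range (j + 1), (1 + -u / ((l + i + 1 : ℕ) : ℝ))⁻¹

theorem one_add_div_pos {u : ℝ} (hu : |u| < 1 / 8) (n : ℕ) : 0 < 1 + u / ((n + 1 : ℕ) : ℝ) := by
  have h1 : (1:ℝ) ≤ ((n + 1 : ℕ) : ℝ) := by exact_mod_cast (by omega)
  have h2 := (abs_lt.1 hu).1
  have : -1 < u / ((n + 1 : ℕ) : ℝ) := by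
    rw [lt_div_iff₀ (by linarith)]
    linarith
  linarith

theorem upProd_ne_zero {u : ℝ} (hu : |u| < 1 / 8) (n : ℕ) : upProd u n ≠ 0 :=
  Finset.prod_ne_zero_iff.2 fun i _ => (one_add_div_pos hu i).ne'

theorem upProd_eq_mul_upQuot {u : ℝ} (hu : |u| < 1 / 8) {j N : ℕ} (hj : j < N) :
    upProd (-u) (N - 1 - j) = upProd (-u) N * upQuot u j (N - 1 - j) := by
  have hun : |-u| < 1 / 8 := by rwa [abs_neg]
  obtain ⟨l, rfl⟩ : ∃ l, N = l + (j + 1) := ⟨N - 1 - j, by omega⟩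
  rw [show l + (j + 1) - 1 - j = l by omega, upQuot, Finset.prod_inv_distrib,
    eq_mul_inv_iff_mul_eq₀ (Finset.prod_ne_zero_iff.2 fun i _ => (one_add_div_pos hun _).ne'),
    upProd, upProd, ← Finset.prod_range_add]

theorem prod_div_eq_sum {u v : ℝ} (hv0 : v ≠ 0) (hu : |u| < 1 / 8) (hv : |v| < 1 / 8) (N : ℕ) :
    ∏ m ∈ Finset.range N, ((1 - (u + v) / ((m + 1 : ℕ) : ℝ)) /
      ((1 - u / ((m + 1 : ℕ) : ℝ)) * (1 - v / ((m + 1 : ℕ) : ℝ)))) =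
      1 - u * v * ∑ j ∈ Finset.range N, (((j + 1 : ℕ) : ℝ) * (((j + 1 : ℕ) : ℝ) - v))⁻¹ *
          (upProd u j * upQuot u j (N - 1 - j)) := by
  have hun : |-u| < 1 / 8 := by rwa [abs_neg]
  have hU := upProd_ne_zero hun N
  have hvk : ∀ k : ℕ, ((k + 1 : ℕ) : ℝ) - v ≠ 0 := fun k => by
    have := half_le_sub hv (N := ((k + 1 : ℕ) : ℝ)) (by exact_mod_cast (by omega))
    have h1 : (0:ℝ) < ((k + 1 : ℕ) : ℝ) := by positivity
    intro h; linarith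
  have hV : ∏ m ∈ Finset.range N, (((m + 1 : ℕ) : ℝ) - v) ≠ 0 :=
    Finset.prod_ne_zero_iff.2 fun i _ => hvk i
  have h := prod_sub_eq_sum u hv0 hv N
  have e1 : ∏ m ∈ Finset.range N, ((1 - (u + v) / ((m + 1 : ℕ) : ℝ)) /
      ((1 - u / ((m + 1 : ℕ) : ℝ)) * (1 - v / ((m + 1 : ℕ) : ℝ)))) =
      (∏ m ∈ Finset.range N, (((m + 1 : ℕ) : ℝ) - (u + v))) /
      (upProd (-u) N * ∏ m ∈ Finset.range N, (((m + 1 : ℕ) : ℝ) - v)) := by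
    rw [upProd, ← Finset.prod_mul_distrib, ← Finset.prod_div_distrib]
    refine Finset.prod_congr rfl fun m _ => ?_
    have hm : ((m + 1 : ℕ) : ℝ) ≠ 0 := by positivity
    have h1 := (one_add_div_pos hun m).ne'
    have h2 := hvk m
    rw [neg_div, ← sub_eq_add_neg] at h1 ⊢
    generalize ((m + 1 : ℕ) : ℝ) = n at *
    have h3 : 1 - v / n ≠ 0 := by
      rw [one_sub_div hm]; exact div_ne_zero h2 hm
    rw [div_eq_div_iff (mul_ne_zero h1 h3) (mul_ne_zero h1 h2)]
    field_simp
  rw [e1, h, div_eq_iff (mul_ne_zero hU hV)]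
  have e2 : ∑ j ∈ Finset.range N, u * (((j + 1 : ℕ) : ℝ) * (((j + 1 : ℕ) : ℝ) - v))⁻¹ *
          (upProd u j * upProd (-u) (N - 1 - j)) = u * upProd (-u) N *
      ∑ j ∈ Finset.range N, (((j + 1 : ℕ) : ℝ) * (((j + 1 : ℕ) : ℝ) - v))⁻¹ *
          (upProd u j * upQuot u j (N - 1 - j)) := by
    rw [Finset.mul_sum]
    refine Finset.sum_congr rfl fun j hj => ?_
    rw [upProd_eq_mul_upQuot hu (Finset.mem_range.1 hj)]
    ring
  rw [e2]
  ring

/-- A bound for `upProd` and `upQuot`. -/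
def upBound (k : ℕ) : ℝ := ∏ i ∈ Finset.range k, (1 + 1 / (7 * ((i + 1 : ℕ) : ℝ)))

theorem one_le_upBound (k : ℕ) : 1 ≤ upBound k := by
  induction k with
  | zero => simp [upBound]
  | succ k ih =>
    rw [upBound, Finset.prod_range_succ]
    have : (0:ℝ) ≤ 1 / (7 * ((k + 1 : ℕ) : ℝ)) := by positivity
    rw [upBound] at ih
    nlinarith

/-- From (1 + t/7)⁴ ≤ 1 + t on [0, 1]. A fourth power suffices: it makes `upBound j ^ 2` at most the
square root of `j + 1`, and ∑ j^(-2+1/2) converges. -/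
theorem upBound_pow_le (k : ℕ) : upBound k ^ 4 ≤ ((k + 1 : ℕ) : ℝ) := by
  induction k with
  | zero => simp [upBound]
  | succ k ih =>
    have e : upBound (k + 1) = upBound k * (1 + 1 / (7 * ((k + 1 : ℕ) : ℝ))) := by
      rw [upBound, Finset.prod_range_succ, upBound]
    have h1 : (1:ℝ) ≤ ((k + 1 : ℕ) : ℝ) := by exact_mod_cast (by omega)
    rw [e, mul_pow]
    have e2 : ((k + 1 + 1 : ℕ) : ℝ) = ((k + 1 : ℕ) : ℝ) * (1 + 1 / ((k + 1 : ℕ) : ℝ)) := by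
      push_cast
      field_simp
    rw [e2]
    refine mul_le_mul ih ?_ (by positivity) (by positivity)
    generalize ((k + 1 : ℕ) : ℝ) = n at *
    have h2 : 0 < 1 / n := by positivity
    have h3 : 1 / n ≤ 1 := by rw [div_le_one (by linarith)]; exact h1
    have h4 : 1 / (7 * n) = (1 / n) / 7 := by field_simp
    rw [h4]
    generalize 1 / n = t at *
    have h5 : t ^ 2 ≤ t := by nlinarith
    have h6 : t ^ 3 ≤ t := by nlinarith
    have h7 : t ^ 4 ≤ t := by nlinarith
    nlinarith

theorem upBound_sq_le (k : ℕ) : upBound k ^ 2 ≤ ((k + 1 : ℕ) : ℝ) ^ (1 / 2 : ℝ) := by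
  rw [← Real.sqrt_eq_rpow]
  refine Real.le_sqrt_of_sq_le ?_
  rw [← pow_mul]
  exact upBound_pow_le k

theorem abs_upProd_le {u : ℝ} (hu : |u| < 1 / 8) (k : ℕ) : |upProd u k| ≤ upBound k := by
  rw [upProd, Finset.abs_prod, upBound]
  refine Finset.prod_le_prod (fun i _ => abs_nonneg _) fun i _ => ?_
  refine (abs_add_le _ _).trans ?_
  rw [abs_one, abs_div, Nat.abs_cast]
  have h1 : (0:ℝ) < ((i + 1 : ℕ) : ℝ) := by positivity
  gcongr 1 + ?_
  rw [div_le_div_iff₀ h1 (by positivity)]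
  nlinarith

/-- The constant 7 is chosen so that 1/(1 - 1/(8n)) ≤ 1 + 1/(7n) for n ≥ 1. The last of the `j + 1`
factors is at most 2. -/
theorem abs_upQuot_le {u : ℝ} (hu : |u| < 1 / 8) (j l : ℕ) : |upQuot u j l| ≤ 2 * upBound j := by
  have hun : |-u| < 1 / 8 := by rwa [abs_neg]
  have h : |upQuot u j l| ≤ upBound (j + 1) := by
    rw [upQuot, Finset.abs_prod, upBound]
    refine Finset.prod_le_prod (fun i _ => abs_nonneg _) fun i _ => ?_
    have h0 := one_add_div_pos hun (l + i)
    rw [abs_inv, abs_of_pos h0]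
    have h1 : (1:ℝ) ≤ ((i + 1 : ℕ) : ℝ) := by exact_mod_cast (by omega)
    have h2 : ((i + 1 : ℕ) : ℝ) ≤ ((l + i + 1 : ℕ) : ℝ) := by exact_mod_cast (by omega)
    have h3 := (abs_lt.1 hu).2
    generalize ((l + i + 1 : ℕ) : ℝ) = n at *
    have h4 : (1 + -u / n)⁻¹ ≤ 1 + 1 / (7 * n) := by
      rw [inv_le_iff_one_le_mul₀ h0]
      have hn : 1 ≤ n := h1.trans h2
      have h5 : -(1 / 8) / n ≤ -u / n := by gcongr
      have h6 : (1 + 1 / (7 * n)) * (1 + -(1 / 8) / n) ≤ (1 + 1 / (7 * n)) * (1 + -u / n) := by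
        gcongr
      refine le_trans ?_ h6
      have h7 : (1 + 1 / (7 * n)) * (1 + -(1 / 8) / n) = 1 + (n - 1) / (56 * n ^ 2) := by
        field_simp
        ring
      rw [h7]
      have : 0 ≤ (n - 1) / (56 * n ^ 2) := div_nonneg (by linarith) (by positivity)
      linarith
    refine h4.trans ?_
    gcongr
  refine h.trans ?_
  rw [upBound, Finset.prod_range_succ, mul_comm, ← upBound]
  have h1 : (1:ℝ) ≤ ((j + 1 : ℕ) : ℝ) := by exact_mod_cast (by omega)
  have h2 := one_le_upBound j
  gcongr
  have : 1 / (7 * ((j + 1 : ℕ) : ℝ)) ≤ 1 := by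
    rw [div_le_one (by positivity)]
    linarith
  linarith

theorem tendsto_upQuot (u : ℝ) (j : ℕ) :
    Filter.Tendsto (fun l => upQuot u j l) Filter.atTop (nhds 1) := by
  have h : Filter.Tendsto (fun l => upQuot u j l) Filter.atTop
      (nhds (∏ _i ∈ Finset.range (j + 1), (1 + (0:ℝ))⁻¹)) := by
    refine tendsto_finsetProd _ fun i _ => ?_
    refine Filter.Tendsto.inv₀ (Filter.Tendsto.const_add _ ?_) (by norm_num)
    have t : Filter.Tendsto (fun l : ℕ => ((l + i + 1 : ℕ) : ℝ)) Filter.atTop Filter.atTop :=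
      tendsto_natCast_atTop_atTop.comp (Filter.tendsto_atTop_mono
        (fun l => show l ≤ l + i + 1 by omega) Filter.tendsto_id)
    exact t.const_div_atTop (-u)
  simpa using h

/-- The generating function of the values `ζ(1, …, 1, q + 2)`. -/
def eulerGen (u v : ℝ) : ℝ :=
  ∑' j : ℕ, (((j + 1 : ℕ) : ℝ) * (((j + 1 : ℕ) : ℝ) - v))⁻¹ * upProd u j

theorem summable_upBound :
    Summable (fun j : ℕ => 2 * (((j + 1 : ℕ) : ℝ) ^ 2)⁻¹ * (2 * upBound j ^ 2)) := by
  have h := (summable_nat_add_iff 1).2 (Real.summable_nat_rpow.2 (show (-(3 / 2) : ℝ) < -1 by norm_num))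
  refine Summable.of_nonneg_of_le (fun j => by positivity) (fun j => ?_) (h.mul_left 4)
  have h1 : (0:ℝ) < ((j + 1 : ℕ) : ℝ) := by positivity
  have h2 := upBound_sq_le j
  have h3 : (((j + 1 : ℕ) : ℝ) ^ 2)⁻¹ = ((j + 1 : ℕ) : ℝ) ^ (-2 : ℝ) := by
    rw [Real.rpow_neg h1.le]
    norm_num
  calc 2 * (((j + 1 : ℕ) : ℝ) ^ 2)⁻¹ * (2 * upBound j ^ 2)
      ≤ 2 * (((j + 1 : ℕ) : ℝ) ^ 2)⁻¹ * (2 * ((j + 1 : ℕ) : ℝ) ^ (1 / 2 : ℝ)) := by gcongr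
    _ = 4 * (((j + 1 : ℕ) : ℝ) ^ (-2 : ℝ) * ((j + 1 : ℕ) : ℝ) ^ (1 / 2 : ℝ)) := by rw [h3]; ring
    _ = 4 * ((j + 1 : ℕ) : ℝ) ^ (-(3 / 2) : ℝ) := by rw [← Real.rpow_add h1]; norm_num

theorem abs_euler_term_le {u v : ℝ} (hu : |u| < 1 / 8) (hv : |v| < 1 / 8) {j : ℕ} {q : ℝ}
    (hq : |q| ≤ 2 * upBound j) :
    |(((j + 1 : ℕ) : ℝ) * (((j + 1 : ℕ) : ℝ) - v))⁻¹ * (upProd u j * q)| ≤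
      2 * (((j + 1 : ℕ) : ℝ) ^ 2)⁻¹ * (2 * upBound j ^ 2) := by
  obtain ⟨h1, h2⟩ := zetaShift_term_le hv j
  have h3 := abs_upProd_le hu j
  have h4 := one_le_upBound j
  rw [abs_mul, abs_of_nonneg h1, abs_mul]
  refine mul_le_mul h2 ?_ (by positivity) (by positivity)
  calc _ ≤ upBound j * (2 * upBound j) := by gcongr
    _ = _ := by ring

theorem summable_eulerGen {u v : ℝ} (hu : |u| < 1 / 8) (hv : |v| < 1 / 8) : Summable (fun j : ℕ =>
    (((j + 1 : ℕ) : ℝ) * (((j + 1 : ℕ) : ℝ) - v))⁻¹ * upProd u j) :=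
  Summable.of_norm_bounded summable_upBound fun j => by
    have := abs_euler_term_le hu hv (j := j) (q := 1) (by
      rw [abs_one]; linarith [one_le_upBound j])
    rwa [mul_one] at this

/-- Dominated convergence in the finite formula: each `upQuot` tends to 1 and the bound by `upBound`
is summable. The limit is Gauss's evaluation of a hypergeometric series at 1. -/
theorem tendsto_prod_eulerGen {u v : ℝ} (hv0 : v ≠ 0) (hu : |u| < 1 / 8) (hv : |v| < 1 / 8) :
    Filter.Tendsto (fun N => ∏ m ∈ Finset.range N, ((1 - (u + v) / ((m + 1 : ℕ) : ℝ)) /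
      ((1 - u / ((m + 1 : ℕ) : ℝ)) * (1 - v / ((m + 1 : ℕ) : ℝ))))) Filter.atTop
      (nhds (1 - u * v * eulerGen u v)) := by
  simp only [prod_div_eq_sum hv0 hu hv]
  refine Filter.Tendsto.const_sub _ (Filter.Tendsto.const_mul _ ?_)
  set F : ℕ → ℕ → ℝ := fun N j => if j < N then
    (((j + 1 : ℕ) : ℝ) * (((j + 1 : ℕ) : ℝ) - v))⁻¹ * (upProd u j * upQuot u j (N - 1 - j)) else 0
    with hF
  have e : ∀ N, ∑ j ∈ Finset.range N, (((j + 1 : ℕ) : ℝ) * (((j + 1 : ℕ) : ℝ) - v))⁻¹ *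
          (upProd u j * upQuot u j (N - 1 - j)) = ∑' j, F N j := by
    intro N
    rw [tsum_eq_sum (s := Finset.range N) (fun k hk => by
      rw [hF]; dsimp only; rw [if_neg (by simpa using hk)])]
    refine Finset.sum_congr rfl fun k hk => ?_
    rw [hF]; dsimp only; rw [if_pos (by simpa using hk)]
  simp only [e, eulerGen]
  refine tendsto_tsum_of_dominated_convergence summable_upBound (fun j => ?_)
    (Filter.Eventually.of_forall fun N j => ?_)
  · have h1 : Filter.Tendsto (fun N => upQuot u j (N - 1 - j)) Filter.atTop (nhds 1) :=
      (tendsto_upQuot u j).comp ((Filter.tendsto_sub_atTop_nat j).comp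
        (Filter.tendsto_sub_atTop_nat 1))
    have h2 := (h1.const_mul (upProd u j)).const_mul
      ((((j + 1 : ℕ) : ℝ) * (((j + 1 : ℕ) : ℝ) - v))⁻¹)
    rw [mul_one] at h2
    refine h2.congr' ?_
    filter_upwards [Filter.eventually_gt_atTop j] with N hN
    rw [hF]; dsimp only; rw [if_pos hN]
  · rw [hF]; dsimp only
    split_ifs
    · exact abs_euler_term_le hu hv (abs_upQuot_le hu j _)
    · rw [norm_zero]; positivity

/-! ### The gamma quotient -/

/-- The series `∑ (-log (1 - u / k) - u / k)`, that is `log Γ(1 - u)` without its linear term. -/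
def logGen (u : ℝ) : ℝ :=
  ∑' k : ℕ, (-Real.log (1 - u / ((k + 1 : ℕ) : ℝ)) - u / ((k + 1 : ℕ) : ℝ))

theorem one_sub_div_pos {u : ℝ} (hu : |u| < 1 / 8) (k : ℕ) : 0 < 1 - u / ((k + 1 : ℕ) : ℝ) := by
  have := one_add_div_pos (u := -u) (by rwa [abs_neg]) k
  rwa [neg_div, ← sub_eq_add_neg] at this

theorem summable_logGen {u : ℝ} (hu : |u| < 1 / 8) :
    Summable (fun k : ℕ => -Real.log (1 - u / ((k + 1 : ℕ) : ℝ)) - u / ((k + 1 : ℕ) : ℝ)) := by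
  refine Summable.of_nonneg_of_le (fun k => ?_) (fun k => ?_) (summable_inv_sq.mul_left 2)
  · have := Real.log_le_sub_one_of_pos (one_sub_div_pos hu k)
    linarith
  · have h0 := one_sub_div_pos hu k
    have h1 := Real.one_sub_inv_le_log_of_pos h0
    have h2 : (1:ℝ) ≤ ((k + 1 : ℕ) : ℝ) := by exact_mod_cast (by omega)
    have h3 := half_le_sub hu h2
    generalize ((k + 1 : ℕ) : ℝ) = n at *
    have h4 : u ^ 2 ≤ 1 := by rw [← sq_abs]; nlinarith [abs_nonneg u]
    have h5 : (1 - u / n)⁻¹ - 1 - u / n = u ^ 2 * (n * (n - u))⁻¹ := by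
      have h6 : n - u ≠ 0 := fun h => by linarith
      have h7 : n ≠ 0 := by positivity
      rw [one_sub_div h7]
      field_simp
      ring
    have h8 : (n * (n - u))⁻¹ ≤ 2 * (n ^ 2)⁻¹ := by
      calc (n * (n - u))⁻¹ ≤ (n * (n / 2))⁻¹ := inv_anti₀ (by positivity) (by gcongr)
        _ = _ := by field_simp
    have h9 : 0 ≤ 2 * (n ^ 2)⁻¹ := by positivity
    have h10 : 0 ≤ (n * (n - u))⁻¹ := inv_nonneg.2 (mul_nonneg (by linarith) (by linarith))
    calc _ ≤ (1 - u / n)⁻¹ - 1 - u / n := by linarith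
      _ = u ^ 2 * (n * (n - u))⁻¹ := h5
      _ ≤ 1 * (n * (n - u))⁻¹ := by gcongr
      _ ≤ _ := by rw [one_mul]; exact h8

theorem logGen_zero : logGen 0 = 0 := by simp [logGen]

theorem hasDerivAt_logGen {u : ℝ} (hu : |u| < 1 / 8) :
    HasDerivAt logGen (u * zetaShift u) u := by
  have hmem : ∀ y : ℝ, y ∈ Set.Ioo (-(1 / 8) : ℝ) (1 / 8) ↔ |y| < 1 / 8 := fun y => by
    rw [abs_lt]; rfl
  have h := hasDerivAt_tsum_of_isPreconnected (𝕜 := ℝ) (t := Set.Ioo (-(1 / 8) : ℝ) (1 / 8))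
    (u := fun k : ℕ => 2 * (((k + 1 : ℕ) : ℝ) ^ 2)⁻¹)
    (g := fun (k : ℕ) (u : ℝ) => -Real.log (1 - u / ((k + 1 : ℕ) : ℝ)) - u / ((k + 1 : ℕ) : ℝ))
    (g' := fun (k : ℕ) (u : ℝ) => u * (((k + 1 : ℕ) : ℝ) * (((k + 1 : ℕ) : ℝ) - u))⁻¹)
    (y₀ := u) (y := u)
    (summable_inv_sq.mul_left 2) isOpen_Ioo isPreconnected_Ioo (fun k y hy => ?_)
    (fun k y hy => ?_) ((hmem u).2 hu) (summable_logGen hu) ((hmem u).2 hu)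
  · rw [tsum_mul_left] at h
    exact h
  · rw [hmem] at hy
    have h0 := one_sub_div_pos hy k
    have h1 : HasDerivAt (fun y : ℝ => y / ((k + 1 : ℕ) : ℝ)) (1 / ((k + 1 : ℕ) : ℝ)) y :=
      (hasDerivAt_id y).div_const _
    have h2 := (((h1.const_sub 1).log h0.ne').neg).sub h1
    refine h2.congr_deriv ?_
    have h3 : (1:ℝ) ≤ ((k + 1 : ℕ) : ℝ) := by exact_mod_cast (by omega)
    have h4 := half_le_sub hy h3
    generalize ((k + 1 : ℕ) : ℝ) = n at *
    have h6 : n - y ≠ 0 := fun h => by linarith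
    have h7 : n ≠ 0 := by positivity
    rw [one_sub_div h7]
    field_simp
    ring
  · rw [hmem] at hy
    obtain ⟨h1, h2⟩ := zetaShift_term_le hy k
    rw [Real.norm_eq_abs, abs_mul, abs_of_nonneg h1]
    calc _ ≤ 1 * (2 * (((k + 1 : ℕ) : ℝ) ^ 2)⁻¹) := by
          gcongr
          linarith
      _ = _ := one_mul _

/-- The quotient `Γ(1 - u) Γ(1 - v) / Γ(1 - u - v)`. -/
def gammaQuot (u v : ℝ) : ℝ := Real.exp (logGen u + logGen v - logGen (u + v))

/-- The linear corrections u/k, v/k and (u+v)/k cancel, so the convergent logarithmic series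
exponentiate to exactly this product. -/
theorem tendsto_prod_gammaQuot {u v : ℝ} (hu : |u| < 1 / 8) (hv : |v| < 1 / 8)
    (huv : |u + v| < 1 / 8) :
    Filter.Tendsto (fun N => ∏ m ∈ Finset.range N, ((1 - (u + v) / ((m + 1 : ℕ) : ℝ)) /
      ((1 - u / ((m + 1 : ℕ) : ℝ)) * (1 - v / ((m + 1 : ℕ) : ℝ))))) Filter.atTop
      (nhds (gammaQuot u v)) := by
  have h := (((summable_logGen hu).hasSum.add (summable_logGen hv).hasSum).sub
    (summable_logGen huv).hasSum).tendsto_sum_nat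
  refine ((Real.continuous_exp.tendsto _).comp h).congr fun N => ?_
  rw [Function.comp_apply, Real.exp_sum]
  refine Finset.prod_congr rfl fun m _ => ?_
  have h1 := one_sub_div_pos hu m
  have h2 := one_sub_div_pos hv m
  have h3 := one_sub_div_pos huv m
  rw [← Real.exp_log h1, ← Real.exp_log h2, ← Real.exp_log h3, ← Real.exp_add, ← Real.exp_sub,
    Real.exp_log h1, Real.exp_log h2, Real.exp_log h3]
  congr 1
  ring

theorem gammaQuot_eq {u v : ℝ} (hv0 : v ≠ 0) (hu : |u| < 1 / 8) (hv : |v| < 1 / 8)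
    (huv : |u + v| < 1 / 8) : gammaQuot u v = 1 - u * v * eulerGen u v :=
  tendsto_nhds_unique (tendsto_prod_gammaQuot hu hv huv) (tendsto_prod_eulerGen hv0 hu hv)

/-- On v = -u the factors become 1/((1 - x/m)(1 + x/m)), which is the Euler product of `starGen 0
x`. -/
theorem gammaQuot_neg {x : ℝ} (hx : |x| < 1 / 8) : gammaQuot x (-x) = starGen 0 x := by
  have hxn : |-x| < 1 / 8 := by rwa [abs_neg]
  have hx1 : |x| ≤ 1 / 2 := by linarith
  have h1 := tendsto_prod_gammaQuot hx hxn (by simp)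
  have h2 := (starGen_aux hx1).2.2
  have h3 := (h1.mul h2)
  rw [mul_one] at h3
  refine (tendsto_nhds_unique (tendsto_const_nhds.congr fun N => ?_) h3).symm
  have e := prod_mul_starGen hx1 0 N
  rw [zero_add] at e
  rw [← e, ← mul_assoc, ← Finset.prod_mul_distrib, Finset.prod_eq_one, one_mul]
  intro m _
  have h1 := (one_sub_div_pos hx m).ne'
  have h2 := (one_sub_div_pos hxn m).ne'
  rw [zero_add]
  generalize ((m + 1 : ℕ) : ℝ) = n at *
  have h3 : 1 - x ^ 2 / n ^ 2 = (1 - x / n) * (1 - -x / n) := by ring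
  rw [h3, add_neg_cancel, zero_div, sub_zero, one_div, inv_mul_cancel₀ (mul_ne_zero h1 h2)]

theorem hasDerivAt_add_const_comp {f : ℝ → ℝ} {f' u v : ℝ} (h : HasDerivAt f f' (u + v)) :
    HasDerivAt (fun u => f (u + v)) f' u := by
  have := HasDerivAt.comp (h := fun u => u + v) u h ((hasDerivAt_id u).add_const v)
  rw [mul_one] at this
  exact this

theorem hasDerivAt_gammaQuot {u v : ℝ} (hu : |u| < 1 / 8) (huv : |u + v| < 1 / 8) :
    HasDerivAt (fun u => gammaQuot u v)
      (gammaQuot u v * (u * zetaShift u - (u + v) * zetaShift (u + v))) u :=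
  (((hasDerivAt_logGen hu).add_const (logGen v)).sub
    (hasDerivAt_add_const_comp (hasDerivAt_logGen huv))).exp

theorem hasDerivAt_gammaQuot_deriv {u v : ℝ} (hu : |u| < 1 / 8) (huv : |u + v| < 1 / 8) :
    HasDerivAt (fun u => gammaQuot u v * (u * zetaShift u - (u + v) * zetaShift (u + v)))
      (gammaQuot u v * ((u * zetaShift u - (u + v) * zetaShift (u + v)) ^ 2 +
        (zetaSq u - zetaSq (u + v)))) u := by
  have h := (hasDerivAt_gammaQuot hu huv).mul ((hasDerivAt_mul_zetaShift hu).sub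
    (hasDerivAt_add_const_comp (hasDerivAt_mul_zetaShift huv)))
  refine h.congr_deriv ?_
  simp only [Pi.sub_apply]
  ring

/-! ### Second derivatives of the gamma quotient -/

/-- The coefficients of `eulerGen` with respect to the first variable. -/
def eulerCoeff (p : ℕ) (v : ℝ) : ℝ :=
  ∑' j : ℕ, (((j + 1 : ℕ) : ℝ) * (((j + 1 : ℕ) : ℝ) - v))⁻¹ * esymmInv p 0 j

theorem seriesRep_upProd (k : ℕ) : SeriesRep (1 / 8) (fun p => esymmInv p 0 k) (fun u => upProd u k) := by
  have h : ∀ u, HasSum (fun p => esymmInv p 0 k * u ^ p) (upProd u k) := fun u =>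
    (hasSum_esymmInv u 0 k).replace (fun _ => rfl) (by
      rw [upProd]
      refine Finset.prod_congr rfl fun i _ => ?_
      rw [show 0 + 1 + i = i + 1 by ring])
  exact fun u _ => ⟨(h |u|).summable.congr fun p => by
    rw [abs_of_nonneg (esymmInv_nonneg _ _ _)], h u⟩

theorem seriesRep_eulerGen {v : ℝ} (hv : |v| < 1 / 8) :
    SeriesRep (1 / 8) (fun p => eulerCoeff p v) (fun u => eulerGen u v) :=
  SeriesRep.tsum_of_nonneg (fun j : ℕ => (seriesRep_upProd j).const_mul
      (((j + 1 : ℕ) : ℝ) * (((j + 1 : ℕ) : ℝ) - v))⁻¹)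
    (fun j _ => mul_nonneg (zetaShift_term_le hv j).1 (esymmInv_nonneg _ _ _))
    (fun _ h0 hx => summable_eulerGen (by rwa [abs_of_nonneg h0]) hv)

/-- Expanding 1/(k(k - v)) in powers of `v` turns the sum over the largest entry into the values of
`hasSum_nested_concat`. -/
theorem seriesRep_eulerCoeff (p : ℕ) :
    SeriesRep (1 / 8) (fun q => mzv (rep 1 p ++ [q + 2])) (eulerCoeff p) := by
  have hS : ∀ q, HasSum (fun k : ℕ => (((k + 1 : ℕ) : ℝ) ^ (q + 2))⁻¹ * esymmInv p 0 k)
      (mzv (rep 1 p ++ [q + 2])) := fun q => by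
    rw [mzv_eq_nested]
    exact (hasSum_nested_concat q p 0).replace
      (fun k => by rw [show 0 + 1 + k = k + 1 by ring]) rfl
  have h := SeriesRep.tsum_of_nonneg (fun k : ℕ =>
      ((seriesRep_inv_pow 0 (N := ((k + 1 : ℕ) : ℝ))
        (by exact_mod_cast (by omega))).mono (r' := 1 / 8) (by norm_num)).const_mul
          ((((k + 1 : ℕ) : ℝ))⁻¹ * esymmInv p 0 k))
      (fun k n => mul_nonneg (mul_nonneg (by positivity) (esymmInv_nonneg _ _ _)) (by positivity))
      (fun x h0 hx => by
        have hx' : |x| < 1 / 8 := by rwa [abs_of_nonneg h0]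
        refine Summable.of_nonneg_of_le (fun k => ?_) (fun k => ?_) ((hS 0).summable.mul_left 2)
        · have := (zetaShift_term_le hx' k).1
          rw [zero_add, pow_one, mul_right_comm, ← mul_inv]
          exact mul_nonneg this (esymmInv_nonneg _ _ _)
        · have := (zetaShift_term_le hx' k).2
          rw [zero_add, pow_one, mul_right_comm, ← mul_inv, ← mul_assoc]
          exact mul_le_mul_of_nonneg_right this (esymmInv_nonneg _ _ _))
  convert h using 1
  · funext q
    rw [← (hS q).tsum_eq]
    refine tsum_congr fun k => ?_
    rw [Nat.choose_zero_right, Nat.cast_one, one_mul, pow_succ _ (q + 1), mul_inv, add_zero]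
    ring
  · funext x
    refine tsum_congr fun k => ?_
    rw [mul_inv, zero_add, pow_one]
    ring

/-- First and second `u`-derivatives of `gammaQuot_eq`: on the left through the logarithmic
derivative, on the right by the product rule. -/
theorem gammaQuot_deriv_eq {u v : ℝ} (hv0 : v ≠ 0) (hu : |u| < 1 / 8) (hv : |v| < 1 / 8)
    (huv : |u + v| < 1 / 8) :
    gammaQuot u v * (u * zetaShift u - (u + v) * zetaShift (u + v)) =
      -v * (eulerGen u v + u * deriv (fun u => eulerGen u v) u) ∧
    gammaQuot u v * ((u * zetaShift u - (u + v) * zetaShift (u + v)) ^ 2 +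
        (zetaSq u - zetaSq (u + v))) =
      -v * (2 * deriv (fun u => eulerGen u v) u + u * deriv (deriv fun u => eulerGen u v) u) := by
  have hT : ∀ u, |u| < 1 / 8 → HasDerivAt (fun u => eulerGen u v) (deriv (fun u => eulerGen u v) u) u :=
    fun u hu => ((seriesRep_eulerGen hv).hasDerivAt hu).differentiableAt.hasDerivAt
  have hT' := ((seriesRep_eulerGen hv).deriv.hasDerivAt hu).differentiableAt.hasDerivAt
  have hev : ∀ u, |u + v| < 1 / 8 → ∀ᶠ y in nhds u, |y + v| < 1 / 8 := fun u huv =>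
    (isOpen_lt (continuous_abs.comp (continuous_add_const v)) continuous_const).mem_nhds huv
  have key : ∀ u, |u| < 1 / 8 → |u + v| < 1 / 8 →
      gammaQuot u v * (u * zetaShift u - (u + v) * zetaShift (u + v)) =
      -v * (eulerGen u v + u * deriv (fun u => eulerGen u v) u) := by
    intro u hu huv
    have h1 := hasDerivAt_gammaQuot hu huv
    have h2 := (((hasDerivAt_id u).mul_const v).mul (hT u hu)).const_sub 1
    have h3 := h1.unique (h2.congr_of_eventuallyEq (by
      filter_upwards [eventually_abs_lt hu, hev u huv] with y hy hyv
      exact gammaQuot_eq hv0 hy hv hyv))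
    rw [h3]
    simp only [id]
    ring
  refine ⟨key u hu huv, ?_⟩
  have h1 := hasDerivAt_gammaQuot_deriv hu huv
  have h2 := ((hT u hu).add ((hasDerivAt_id u).mul hT')).const_mul (-v)
  have h3 := h1.unique (h2.congr_of_eventuallyEq (by
    filter_upwards [eventually_abs_lt hu, hev u huv] with y hy hyv
    exact key y hy hyv))
  rw [h3]
  simp only [id]
  ring

theorem SeriesRep.apply_zero {r : ℝ} (hr : 0 < r) {c : ℕ → ℝ} {g : ℝ → ℝ} (h : SeriesRep r c g) :
    g 0 = c 0 := by
  refine (h.hasSum (by rwa [abs_zero])).unique ?_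
  have := hasSum_single (f := fun n => c n * (0:ℝ) ^ n) 0
    (fun n hn => by rw [zero_pow hn, mul_zero])
  simpa using this

/-- The second derivative at `u = 0`, where the quotient is 1; the coefficients in `v` are the
values ζ(1, q+2). -/
theorem eulerCoeff_one {v : ℝ} (hv0 : v ≠ 0) (hv : |v| < 1 / 8) :
    -2 * v * eulerCoeff 1 v = v ^ 2 * zetaShift v ^ 2 + zetaSq 0 - zetaSq v := by
  have h := (gammaQuot_deriv_eq hv0 (u := 0) (by norm_num) hv (by rwa [zero_add])).2
  have h1 : gammaQuot 0 v = 1 := by rw [gammaQuot, zero_add, logGen_zero]; simp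
  have h2 := (seriesRep_eulerGen hv).deriv.apply_zero (by norm_num)
  rw [h1, h2, zero_add] at h
  push_cast at h
  rw [zero_add] at h
  linear_combination -h

/-- At u = x, v = -x the quotient is `starGen 0 x`. The formulas for the quotient and its first
derivative eliminate `eulerGen` and its first derivative from that for the second. -/
theorem eulerGen_deriv_deriv {x : ℝ} (hx0 : x ≠ 0) (hx : |x| < 1 / 8) :
    x ^ 4 * (deriv (deriv fun u => eulerGen u (-x)) x / 2) =
      starGen 0 x * (x ^ 4 * zetaShift x ^ 2 / 2 + x ^ 2 * (zetaSq x - zetaSq 0) / 2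
        - x ^ 2 * zetaShift x) + (starGen 0 x - 1) := by
  have hxn : |-x| < 1 / 8 := by rwa [abs_neg]
  have hn0 : -x ≠ 0 := neg_ne_zero.2 hx0
  have hxx : |x + -x| < 1 / 8 := by simp
  obtain ⟨h1, h2⟩ := gammaQuot_deriv_eq hn0 hx hxn hxx
  have h3 := gammaQuot_eq hn0 hx hxn hxx
  rw [gammaQuot_neg hx] at h1 h2 h3
  rw [add_neg_cancel, zero_mul, sub_zero] at h1 h2
  linear_combination (-x ^ 2 / 2) * h2 + x * h1 - h3

/-- Half of the second derivative of `eulerGen` on the antidiagonal. -/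
def betaGen (x : ℝ) : ℝ := deriv (deriv fun u => eulerGen u (-x)) x / 2

theorem hasSum_betaGen {x v : ℝ} (hx : |x| < 1 / 8) (hv : |v| < 1 / 8) :
    HasSum (fun p : ℕ => ((p + 2).choose 2 : ℝ) * (x ^ p * eulerCoeff (p + 2) v))
      (deriv (deriv fun u => eulerGen u v) x / 2) := by
  refine (((seriesRep_eulerGen hv).deriv.deriv.hasSum hx).div_const 2).replace (fun p => ?_) rfl
  rw [Nat.cast_choose_two]
  push_cast
  ring

/-- Taylor expansion in `u` gives binom(p+2, 2), and substituting v = -x in the second expansion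
gives the signs (-1)^q. -/
theorem seriesRep_betaGen : SeriesRep (1 / 8) (fun n =>
    ∑ x ∈ Finset.HasAntidiagonal.antidiagonal n,
      (-1 : ℝ) ^ x.2 * ((x.1 + 2).choose 2 : ℝ) * mzv (rep 1 (x.1 + 2) ++ [x.2 + 2])) betaGen := by
  have hnn : ∀ s, 0 ≤ mzv s := fun s => by rw [mzv_eq_nested]; exact nested_nonneg _ _ _
  have h := SeriesRep.tsum (fun p : ℕ => ((seriesRep_eulerCoeff (p + 2)).comp_neg.pow_mul p).const_mul
    ((p + 2).choose 2 : ℝ)) (fun x h0 hx => ?_)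
  · have h2 : SeriesRep (1 / 8) _ betaGen := h.congr fun x hx =>
      (hasSum_betaGen hx (v := -x) (by rwa [abs_neg])).tsum_eq
    convert h2 using 1
    funext n
    rw [tsum_eq_sum (s := Finset.range n.succ) (fun p hp => by
      rw [if_neg (by simp at hp; omega), mul_zero]), Finset.Nat.sum_antidiagonal_eq_sum_range_succ
      (fun p q => (-1 : ℝ) ^ q * ((p + 2).choose 2 : ℝ) * mzv (rep 1 (p + 2) ++ [q + 2]))]
    refine Finset.sum_congr rfl fun p hp => ?_
    rw [if_pos (by simp at hp; omega)]
    ring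
  · have hx' : |x| < 1 / 8 := by rwa [abs_of_nonneg h0]
    refine (hasSum_betaGen hx' hx').summable.congr fun p => ?_
    rw [← (((seriesRep_eulerCoeff (p + 2)).pow_mul p).const_mul
      ((p + 2).choose 2 : ℝ)).hasSum hx' |>.tsum_eq]
    refine tsum_congr fun n => ?_
    rw [abs_mul, Nat.abs_cast]
    congr 2
    split_ifs
    · rw [abs_mul, abs_pow, abs_neg, abs_one, one_pow, one_mul, abs_of_nonneg (hnn _)]
    · rw [abs_zero]

/-! ### The identity of power series -/

theorem EvenRep.sub {r : ℝ} {φ ψ : PowerSeries ℝ} {f g : ℝ → ℝ}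
    (h1 : EvenRep r φ f) (h2 : EvenRep r ψ g) : EvenRep r (φ - ψ) (fun x => f x - g x) := by
  have h := h1.add ((EvenRep.const (-1)).mul h2)
  rw [map_neg, map_one, neg_one_mul, ← sub_eq_add_neg] at h
  exact h.congr fun x _ _ => by ring

theorem EvenRep.tail {r : ℝ} {φ : PowerSeries ℝ} {g : ℝ → ℝ} (h : EvenRep r φ g) :
    EvenRep r (PowerSeries.mk fun n => PowerSeries.coeff (n + 1) φ)
      (fun x => (g x - PowerSeries.coeff 0 φ) / x ^ 2) := by
  intro x h0 hx
  obtain ⟨h1, h2⟩ := h x h0 hx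
  have hx2 : x ^ 2 ≠ 0 := by positivity
  have h3 := ((hasSum_nat_add_iff' 1).2 h2).div_const (x ^ 2)
  have h4 := ((summable_nat_add_iff 1).2 h1).div_const (x ^ 2)
  refine ⟨h4.congr fun n => ?_, h3.replace (fun n => ?_) (by simp)⟩
  · rw [PowerSeries.coeff_mk, pow_succ (x ^ 2) n, ← mul_assoc, mul_div_cancel_right₀ _ hx2]
  · rw [PowerSeries.coeff_mk, pow_succ (x ^ 2) n, ← mul_assoc, mul_div_cancel_right₀ _ hx2]

/-- The odd part of `zetaShift`. -/
def zetaOdd (x : ℝ) : ℝ := (zetaShift x - zetaShift (-x)) / (2 * x)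

theorem zetaSq_zero_eq_mzv : zetaSq 0 = mzv [2] := by
  rw [seriesRep_zetaSq.apply_zero (by norm_num)]
  simp

theorem mzvStar_two : mzvStar (rep 2 1) = mzv [2] := by
  rw [mzv_eq_nested, mzvStar_eq_nested]
  exact nested_single_eq 0 1 0 0

/-- The relation `zetaEven_sq` removes every `zetaSq` term, so only squares of the even and odd
parts of `zetaShift` remain. -/
theorem fourGen_eq_zeta {x : ℝ} (hx0 : x ≠ 0) (hx : |x| < 1 / 8) :
    fourGen x = -((altGen x - altGen (-x)) / (2 * x)) +
      2 * starGen 0 x * (zetaEven x ^ 2 + x ^ 2 * zetaOdd x ^ 2) := by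
  rw [fourGen_eq hx0 hx]
  have h := zetaEven_sq hx0 hx
  have hG : zetaShift x - zetaShift (-x) = 2 * x * zetaOdd x := by
    rw [zetaOdd]; field_simp
  rw [hG]
  field_simp
  linear_combination (-2 * starGen 0 x) * h

theorem zetaShift_sq_even {x : ℝ} (hx0 : x ≠ 0) (hx : |x| < 1 / 8) :
    (zetaShift x ^ 2 + zetaShift (-x) ^ 2) / 2 = zetaEven x ^ 2 + x ^ 2 * zetaOdd x ^ 2 := by
  rw [zetaEven_eq hx, zetaOdd]
  field_simp
  ring

theorem eulerCoeff_one_odd {x : ℝ} (hx0 : x ≠ 0) (hx : |x| < 1 / 8) :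
    2 * x ^ 2 * ((eulerCoeff 1 x - eulerCoeff 1 (-x)) / (2 * x)) =
      (zetaSq x + zetaSq (-x)) / 2 - zetaSq 0 -
        x ^ 2 * (zetaEven x ^ 2 + x ^ 2 * zetaOdd x ^ 2) := by
  have hxn : |-x| < 1 / 8 := by rwa [abs_neg]
  have h1 := eulerCoeff_one hx0 hx
  have h2 := eulerCoeff_one (neg_ne_zero.2 hx0) hxn
  rw [← zetaShift_sq_even hx0 hx]
  have : 2 * x ^ 2 * ((eulerCoeff 1 x - eulerCoeff 1 (-x)) / (2 * x)) =
      x * (eulerCoeff 1 x - eulerCoeff 1 (-x)) := by field_simp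
  rw [this]
  linear_combination -(h1 + h2) / 2

theorem betaGen_even {x : ℝ} (hx0 : x ≠ 0) (hx : |x| < 1 / 8) :
    x ^ 4 * ((betaGen x + betaGen (-x)) / 2) =
      starGen 0 x * (x ^ 4 * (zetaEven x ^ 2 + x ^ 2 * zetaOdd x ^ 2) / 2 +
        x ^ 2 * ((zetaSq x + zetaSq (-x)) / 2 - zetaSq 0) / 2 - x ^ 2 * zetaEven x) +
        (starGen 0 x - 1) := by
  have hxn : |-x| < 1 / 8 := by rwa [abs_neg]
  have h1 := eulerGen_deriv_deriv hx0 hx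
  have h2 := eulerGen_deriv_deriv (neg_ne_zero.2 hx0) hxn
  have hS : starGen 0 (-x) = starGen 0 x := by simp [starGen]
  rw [hS] at h2
  rw [← zetaShift_sq_even hx0 hx, zetaEven_eq hx, betaGen, betaGen]
  linear_combination (h1 + h2) / 2

theorem sum_antidiagonal_antidiagonal {M : Type*} [AddCommMonoid M] (f : ℕ → ℕ → ℕ → M) (m : ℕ) :
    ∑ x ∈ (Finset.range (m + 1) ×ˢ Finset.range (m + 1) ×ˢ Finset.range (m + 1)).filter
        (fun x => x.1 + x.2.1 + x.2.2 + 1 = m + 1), f x.1 x.2.1 x.2.2 =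
      ∑ p ∈ Finset.HasAntidiagonal.antidiagonal m,
        ∑ q ∈ Finset.HasAntidiagonal.antidiagonal p.1, f q.1 q.2 p.2 := by
  rw [Finset.sum_sigma']
  refine Finset.sum_bij' (fun x _ => ⟨(x.1 + x.2.1, x.2.2), (x.1, x.2.1)⟩)
    (fun y _ => (y.2.1, y.2.2, y.1.2)) ?_ ?_ ?_ ?_ ?_
  · rintro ⟨a, b, c⟩ h
    simp at h ⊢
    omega
  · rintro ⟨⟨d, c⟩, ⟨a, b⟩⟩ h
    simp at h ⊢
    omega
  · rintro ⟨a, b, c⟩ h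
    rfl
  · rintro ⟨⟨d, c⟩, ⟨a, b⟩⟩ h
    simp at h
    obtain ⟨-, rfl⟩ := h
    rfl
  · rintro ⟨a, b, c⟩ h
    rfl

/-- Coefficient comparison in S = 1 + 2x²Z(x) - x²Z(x/2); the halved argument produces the power of
2. -/
theorem two_mul_mzv_single (n : ℕ) :
    2 * (1 - 1 / 2 ^ (2 * n + 3)) * mzv [2 * n + 4] = mzvStar (rep 2 (n + 2)) := by
  have h := EvenRep.unique (by norm_num) (evenRep_starGen.congr fun x h0 hx => by
    rw [starGen_eq_cot h0.ne' (by rwa [abs_of_pos h0])])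
    (((EvenRep.const 1).add (((EvenRep.const 2).mul EvenRep.X).mul evenRep_zetaEven)).sub
      (EvenRep.X.mul evenRep_zetaEven_half))
  have h2 := congrArg (PowerSeries.coeff (n + 2)) h
  rw [map_sub, map_add, mul_assoc, PowerSeries.coeff_C_mul, show n + 2 = (n + 1) + 1 by ring,
    PowerSeries.coeff_succ_X_mul, PowerSeries.coeff_succ_X_mul] at h2
  simp only [PowerSeries.coeff_mk, PowerSeries.coeff_C] at h2
  rw [if_neg (by omega), zero_add, show 2 * (n + 1) + 2 = 2 * n + 4 by ring] at h2
  rw [show n + 2 = n + 1 + 1 by ring, h2]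
  have : (4:ℝ) ^ (n + 1) = 2 ^ (2 * n + 2) := by
    rw [show 2 * n + 2 = 2 * (n + 1) by ring, pow_mul]; norm_num
  rw [this, pow_succ _ (2 * n + 2)]
  field_simp

/-- The generating series of `ζ⋆({2}^n)`. -/
def starSeries : PowerSeries ℝ := PowerSeries.mk fun n => mzvStar (rep 2 n)

/-- The generating series of `(n + 1) ζ⋆({2}^(n + 1))`. -/
def starDerivSeries : PowerSeries ℝ := PowerSeries.mk fun n => ((n : ℝ) + 1) * mzvStar (rep 2 (n + 1))

/-- The generating series of `ζ(2n + 2)`. -/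
def evenSeries : PowerSeries ℝ := PowerSeries.mk fun n => mzv [2 * n + 2]

/-- The generating series of `ζ(2n + 3)`. -/
def oddSeries : PowerSeries ℝ := PowerSeries.mk fun n => mzv [2 * n + 3]

/-- The series of the coefficients of `φ` from degree one on, divided by the variable. -/
def tailSeries (φ : PowerSeries ℝ) : PowerSeries ℝ := PowerSeries.mk fun n => PowerSeries.coeff (n + 1) φ

/-- Each summand represents an explicit function of `x`, so the claim reduces to an identity in S,
Z, G and the three remaining functions. It follows linearly from `betaGen_even` and
`eulerCoeff_one_odd`, after `fourGen_eq_zeta` has eliminated the left side. -/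
theorem fourSeries_eq :
    (PowerSeries.mk fun n => mzvStar ([4] ++ rep 2 n)) =
      tailSeries (starDerivSeries + starDerivSeries - tailSeries starSeries) - tailSeries evenSeries
      - (PowerSeries.mk fun n => ∑ j ∈ Finset.range (n + 1), (-1) ^ j * depthCoeff j (2 * n + 1 - 2 * j))
      + (PowerSeries.mk fun n => ∑ x ∈ Finset.HasAntidiagonal.antidiagonal (2 * n),
          (-1 : ℝ) ^ x.2 * ((x.1 + 2).choose 2 : ℝ) * mzv (rep 1 (x.1 + 2) ++ [x.2 + 2]))
      - (PowerSeries.mk fun n => mzv (rep 1 1 ++ [2 * n + 1 + 2])) * starSeries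
      + evenSeries * (starDerivSeries - tailSeries starSeries)
      + PowerSeries.X * (oddSeries * starSeries * oddSeries) := by
  have eS : EvenRep (1 / 8) starSeries (starGen 0) := evenRep_starGen
  have eD : EvenRep (1 / 8) starDerivSeries _ := evenRep_starGen_deriv
  have eZ : EvenRep (1 / 8) evenSeries zetaEven := evenRep_zetaEven
  have eG : EvenRep (1 / 8) oddSeries zetaOdd := seriesRep_zetaShift.odd
  have eS1 : EvenRep (1 / 8) (tailSeries starSeries) _ := eS.tail
  have eE : EvenRep (1 / 8) (tailSeries (starDerivSeries + starDerivSeries - tailSeries starSeries)) _ :=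
    ((eD.add eD).sub eS1).tail
  have eZ1 : EvenRep (1 / 8) (tailSeries evenSeries) _ := eZ.tail
  refine EvenRep.unique (by norm_num) evenRep_four ((((((((eE.sub eZ1).sub evenRep_altGen).add
    seriesRep_betaGen.even).sub ((seriesRep_eulerCoeff 1).odd.mul eS)).add
    (eZ.mul (eD.sub eS1))).add (EvenRep.X.mul ((eG.mul eS).mul eG)))).congr fun x h0 hx => ?_)
  have hx' : |x| < 1 / 8 := by rwa [abs_of_pos h0]
  -- The constant term is 2ζ⋆(2) - ζ⋆(2) = ζ(2).
  have c1 : PowerSeries.coeff 0 (starDerivSeries + starDerivSeries - tailSeries starSeries) = zetaSq 0 := by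
    rw [zetaSq_zero_eq_mzv, ← mzvStar_two]
    simp [starDerivSeries, tailSeries, starSeries]
  have c2 : PowerSeries.coeff 0 starSeries = 1 := by
    simp [starSeries, mzvStar_eq_nested, nested_nil]
  have c3 : PowerSeries.coeff 0 evenSeries = zetaSq 0 := by
    rw [zetaSq_zero_eq_mzv]
    simp [evenSeries]
  rw [c1, c2, c3]
  change _ = fourGen x
  rw [fourGen_eq_zeta h0.ne' hx']
  have hT := eulerCoeff_one_odd h0.ne' hx'
  have hB := betaGen_even h0.ne' hx'
  generalize (eulerCoeff 1 x - eulerCoeff 1 (-x)) / (2 * x) = T at *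
  generalize (betaGen x + betaGen (-x)) / 2 = B at *
  generalize (altGen x - altGen (-x)) / (2 * x) = A at *
  generalize starGen 0 x = S at *
  generalize zetaEven x = Z at *
  generalize zetaOdd x = G at *
  generalize (zetaSq x + zetaSq (-x)) / 2 = W at *
  field_simp
  linear_combination hB - S * x ^ 2 / 2 * hT

end

/-! ### Extraction of coefficients -/

theorem mainTheorem7 (n : ℕ) :
    mzvStar ([4] ++ rep 2 n) =
      -((2 * n + 4).choose 3 : ℝ) * mzv [2 * n + 4]
      + 2 * (2 * (n : ℝ) + 3) * (1 - 1 / 2 ^ (2 * n + 3)) * mzv [2 * n + 4]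
      - mzv [2 * n + 4]
      + ∑ j ∈ Finset.Icc 1 n, (-1 : ℝ) ^ (j + 1) *
          ∑ c ∈ Finset.Nat.antidiagonalTuple (j + 1) (2 * n + 1 - 2 * j),
            mzv (cIndex c) * (cWeight c : ℝ)
      + ∑ x ∈ Finset.HasAntidiagonal.antidiagonal (2 * n),
          (-1 : ℝ) ^ x.2 * ((x.1 + 2).choose 2 : ℝ) * mzv (rep 1 (x.1 + 2) ++ [x.2 + 2])
      - ∑ x ∈ Finset.HasAntidiagonal.antidiagonal n, mzv [1, 2 * x.1 + 3] * mzvStar (rep 2 x.2)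
      + ∑ x ∈ Finset.HasAntidiagonal.antidiagonal n,
          (x.2 : ℝ) * mzv [2 * x.1 + 2] * mzvStar (rep 2 (x.2 + 1))
      + ∑ x ∈ (Finset.range n ×ˢ Finset.range n ×ˢ Finset.range n).filter
            (fun x => x.1 + x.2.1 + x.2.2 + 1 = n),
          mzvStar (rep 2 x.1 ++ [3] ++ rep 2 x.2.1) * mzv [2 * x.2.2 + 3] := by
  have h := congrArg (PowerSeries.coeff n) fourSeries_eq
  -- The depth `j = 0` separates off as the binomial term; the remaining sign is absorbed into `(-1)
  -- ^ (j + 1)`.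
  have e1 : ∑ j ∈ Finset.range (n + 1), (-1 : ℝ) ^ j * depthCoeff j (2 * n + 1 - 2 * j) =
      ((2 * n + 4).choose 3 : ℝ) * mzv [2 * n + 4] - ∑ j ∈ Finset.Icc 1 n, (-1 : ℝ) ^ (j + 1) *
          ∑ c ∈ Finset.Nat.antidiagonalTuple (j + 1) (2 * n + 1 - 2 * j),
            mzv (cIndex c) * (cWeight c : ℝ) := by
    rw [Finset.sum_range_succ', pow_zero, one_mul, mul_zero, Nat.sub_zero, depthCoeff_zero,
      ← Finset.Ico_add_one_right_eq_Icc, Finset.sum_Ico_eq_sum_range, Nat.add_sub_cancel,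
      show 2 * n + 1 + 3 = 2 * n + 4 by ring, add_comm, sub_eq_add_neg, ← Finset.sum_neg_distrib]
    congr 1
    refine Finset.sum_congr rfl fun j _ => ?_
    rw [add_comm 1 j, pow_succ _ (j + 1), depthCoeff]
    ring
  -- The factor b arises as (b + 1) - 1, from S' minus the shifted series of S.
  have e2 : ∑ x ∈ Finset.HasAntidiagonal.antidiagonal n, mzv [2 * x.1 + 2] *
      (((x.2 : ℝ) + 1) * mzvStar (rep 2 (x.2 + 1)) - mzvStar (rep 2 (x.2 + 1))) =
      ∑ x ∈ Finset.HasAntidiagonal.antidiagonal n,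
          (x.2 : ℝ) * mzv [2 * x.1 + 2] * mzvStar (rep 2 (x.2 + 1)) :=
    Finset.sum_congr rfl fun x _ => by ring
  have e3 : PowerSeries.coeff n (PowerSeries.X * (oddSeries * starSeries * oddSeries)) =
      ∑ x ∈ (Finset.range n ×ˢ Finset.range n ×ˢ Finset.range n).filter
            (fun x => x.1 + x.2.1 + x.2.2 + 1 = n),
          mzvStar (rep 2 x.1 ++ [3] ++ rep 2 x.2.1) * mzv [2 * x.2.2 + 3] := by
    cases n with
    | zero => simp
    | succ m =>
      rw [PowerSeries.coeff_succ_X_mul, PowerSeries.coeff_mul, sum_antidiagonal_antidiagonal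
        (fun a b c => mzvStar (rep 2 a ++ [3] ++ rep 2 b) * mzv [2 * c + 3])]
      refine Finset.sum_congr rfl fun p _ => ?_
      rw [← Finset.sum_mul, PowerSeries.coeff_mul]
      simp only [oddSeries, starSeries, PowerSeries.coeff_mk, mzvStar_eq_nested,
        sum_nested_two_three_two]
      congr 1
      refine Finset.sum_congr rfl fun q _ => ?_
      rw [mzv_eq_nested, nested_single_eq 1 0]
  -- The first series contributes (2(n+2) - 1) ζ⋆({2}^(n+2)), which this converts into the multiple
  -- of ζ(2n+4) with factor 2n + 3.
  have e4 := two_mul_mzv_single n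
  have e5 : ∑ x ∈ Finset.HasAntidiagonal.antidiagonal n,
      mzv (rep 1 1 ++ [2 * x.1 + 1 + 2]) * mzvStar (rep 2 x.2) =
      ∑ x ∈ Finset.HasAntidiagonal.antidiagonal n, mzv [1, 2 * x.1 + 3] * mzvStar (rep 2 x.2) :=
    Finset.sum_congr rfl fun x _ => rfl
  rw [map_add, e3] at h
  simp only [map_add, map_sub, PowerSeries.coeff_mk, PowerSeries.coeff_mul, tailSeries, evenSeries,
    starDerivSeries, starSeries] at h
  rw [e1, e2, e5, show n + 1 + 1 = n + 2 by ring, ← e4, show 2 * (n + 1) + 2 = 2 * n + 4 by ring] at h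
  rw [h]
  push_cast
  ring
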